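/- **Theorem 2.6.** Let $(X,\mathcal O)$ be a finite ringed space: $X$ is a finite topological space and $\mathcal O$ is a sheaf of commutative rings with unity. Assume that $X$ is $T_0$, so that $p\le q \iff \overline{\{p\}}\subseteq\overline{\{q\}}$ is a partial order on $X$. Write $U_p=\{q\in X: q\ge p\}$ for the smallest open subset containing $p$, and, for an $\mathcal O$-module $\mathcal M$, write $\mathcal M_p=\mathcal M(U_p)$ for the stalk at $p$. Let $\mathcal M$ be an $\mathcal O$-module. *The standard complex* $\mathcal C^\bullet\mathcal M$ has the terms $$(\mathcal C^i\mathcal M)(U)=\prod_{x_0<\cdots<x_i,\ x_0\in U}\mathcal M_{x_i},$$ with the projections as restriction maps. *The pseudo-Čech complex* $\check{\mathcal C}^\bullet\mathcal M$ has the terms $$\check{\mathcal C}^i\mathcal M=\prod_{x_0<\cdots<x_i}\mathcal M_{U_{x_i}},\qquad \mathcal M_U:=j_*(\mathcal M_{|U})\ \text{ for the inclusion } j\colon U\hookrightarrow X.$$ In both complexes the differential is $$(ds)_{x_0<\cdots<x_{i+1}}=\sum_{k=0}^{i}(-1)^k s_{x_0<\cdots<\widehat{x_k}<\cdots<x_{i+1}}+(-1)^{i+1}\,\bar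 s_{x_0<\cdots<x_i},$$ where $\bar s_{x_0<\cdots<x_i}$ is the restriction of $s_{x_0<\cdots<x_i}$ to $\mathcal M_{x_{i+1}}$, respectively to $\mathcal M_{U_{x_{i+1}}}$. Both complexes are augmented by the natural morphisms $\mathcal M\to\mathcal C^0\mathcal M$ and $\mathcal M\to\check{\mathcal C}^0\mathcal M$ given by restriction. The finite ringed space $(X,\mathcal O)$ is called *semi-separated* if the restriction maps $\mathcal O_p\to\mathcal O_q$ are flat for all $p\le q$, the module $R^i\delta_*\mathcal O$ is quasi-coherent for all $i\ge 0$, and $R^i\delta_*\mathcal O=0$ for all $i>0$. Here $\delta\colon X\to X\times X$ is the diagonal morphism, and $X\times X$ carries the sheaf of rings with stalks $\mathcal O_p\otimes_{\mathbb Z}\mathcal O_q$. 1. $\mathcal C^\bullet\mathcal M$ is a finite flasque resolution of $\mathcal M$: the sequence $0\to\mathcal M\to\mathcal C^0\mathcal M\to\mathcal C^1\mathcal M\to\cdots$ is exact, every $\mathcal C^i\mathcal M$ is flasque, and $\mathcal C^i\mathcal M=0$ for $i>\dim X$ (in particular for all large $i$). 2. If $(X,\mathcal O)$ is semi-separated and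 $\mathcal M$ is quasi-coherent, then $\check{\mathcal C}^\bullet\mathcal M$ is a resolution of $\mathcal M$ by acyclic quasi-coherent $\mathcal O$-modules: the sequence $0\to\mathcal M\to\check{\mathcal C}^0\mathcal M\to\check{\mathcal C}^1\mathcal M\to\cdots$ is exact, and every $\check{\mathcal C}^i\mathcal M$ is quasi-coherent with $H^k(X,\check{\mathcal C}^i\mathcal M)=0$ for all $k>0$. -/

import Mathlib

open CategoryTheory TopologicalSpace Opposite AlgebraicGeometry

universe u

namespace FiniteRinged

noncomputable section

/-! ### Modules on a ringed space -/

/-- The structure sheaf of a ringed space, as a sheaf of (not necessarily commutative) rings. -/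
abbrev ringSheaf (X : RingedSpace.{u, u}) :
    Sheaf (Opens.grothendieckTopology X.carrier) RingCat.{u} :=
  (sheafCompose (Opens.grothendieckTopology X.carrier)
    (forget₂ CommRingCat.{u} RingCat.{u})).obj X.sheaf

/-- The category `Mod(X)` of sheaves of `𝒪`-modules on a ringed space `(X, 𝒪)`. -/
abbrev OMod (X : RingedSpace.{u, u}) := SheafOfModules.{u} (ringSheaf X)

/-- The abelian sheaf underlying an `𝒪`-module. -/
def toAb {X : RingedSpace.{u, u}} (M : OMod X) : TopCat.Sheaf AddCommGrpCat.{u} X.carrier :=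
  (SheafOfModules.toSheaf (ringSheaf X)).obj M

/-- An `𝒪`-module is acyclic if `H^i(X, M) = 0` for all `i > 0`. -/
def IsAcyclic {X : RingedSpace.{u, u}} (M : OMod X) : Prop :=
  ∀ i : ℕ, 0 < i → Subsingleton (Sheaf.H (toAb M) i)

/-- An `𝒪`-module is flasque if all restriction maps `M(U) → M(V)` are surjective. -/
def IsFlasque {X : RingedSpace.{u, u}} (M : OMod X) : Prop :=
  TopCat.Sheaf.IsFlasque (toAb M)

/-- The homomorphism `𝒪_Y → f_* 𝒪_X` of a morphism of ringed spaces, between sheaves of rings. -/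
def pushHom {X Y : RingedSpace.{u, u}} (f : X ⟶ Y) : ringSheaf Y ⟶
    ((Opens.map f.hom.base).sheafPushforwardContinuous RingCat.{u}
      (Opens.grothendieckTopology Y.carrier) (Opens.grothendieckTopology X.carrier)).obj
        (ringSheaf X) where
  hom := Functor.whiskerRight f.hom.c (forget₂ CommRingCat.{u} RingCat.{u})

/-- The direct image functor `f_* : Mod(X) ⥤ Mod(Y)`. -/
def push {X Y : RingedSpace.{u, u}} (f : X ⟶ Y) : OMod X ⥤ OMod Y :=
  SheafOfModules.pushforward (pushHom f)

instance pushforwardAb_additive {X Y : TopCat.{u}} (f : X ⟶ Y) :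
    (TopCat.Sheaf.pushforward AddCommGrpCat.{u} f).Additive where
  map_add := rfl

/-- The abelian sheaf underlying `R^i f_* M`, i.e. the `i`-th right derived functor of the direct
image functor for abelian sheaves. -/
def higherDirectImage {X Y : RingedSpace.{u, u}} (f : X ⟶ Y) (i : ℕ) (M : OMod X) :
    TopCat.Sheaf AddCommGrpCat.{u} Y.carrier :=
  ((TopCat.Sheaf.pushforward AddCommGrpCat.{u} f.hom.base).rightDerived i).obj (toAb M)

/-- A cochain complex `K` of `𝒪`-modules with an augmentation `ε : M ⟶ K⁰` is a resolution of `M`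
if the sequence `0 → M → K⁰ → K¹ → ⋯` is exact. -/
structure IsResolution {X : RingedSpace.{u, u}} {M : OMod X} {K : CochainComplex (OMod X) ℕ}
    (ε : M ⟶ K.X 0) : Prop where
  mono : Mono ε
  zero : ε ≫ K.d 0 1 = 0
  exact_zero : (ShortComplex.mk ε (K.d 0 1) zero).Exact
  exact_succ : ∀ i : ℕ, K.ExactAt (i + 1)

/-! ### Sections and restrictions -/

/-- The commutative ring `𝒪(U)`. -/
abbrev O (X : RingedSpace.{u, u}) (U : Opens X.carrier) : Type u := X.presheaf.obj (op U)

/-- The restriction `𝒪(U) → 𝒪(V)`. -/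
def resO {X : RingedSpace.{u, u}} {U V : Opens X.carrier} (h : V ≤ U) : O X U →+* O X V :=
  (X.presheaf.map (homOfLE h).op).hom

lemma resO_self {X : RingedSpace.{u, u}} {U : Opens X.carrier} (h : U ≤ U) (s : O X U) :
    resO h s = s := by
  simp [resO]

lemma resO_resO {X : RingedSpace.{u, u}} {U V W : Opens X.carrier} (h : V ≤ U) (h' : W ≤ V)
    (s : O X U) : resO h' (resO h s) = resO (h'.trans h) s := by
  have : (homOfLE (h'.trans h)).op = (homOfLE h).op ≫ (homOfLE h').op := rfl
  simp [resO, this]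

/-- `𝒪(U)`, as a scalar ring for modules. -/
abbrev Scal (X : RingedSpace.{u, u}) (U : Opens X.carrier) : Type u :=
  (ringSheaf X).obj.obj (op U)

/-- The restriction `𝒪(U) → 𝒪(V)`, on scalars. -/
def resS {X : RingedSpace.{u, u}} {U V : Opens X.carrier} (h : V ≤ U) : Scal X U →+* Scal X V :=
  ((ringSheaf X).obj.map (homOfLE h).op).hom

lemma resS_resS {X : RingedSpace.{u, u}} {U V W : Opens X.carrier} (h : V ≤ U) (h' : W ≤ V)
    (s : Scal X U) : resS h' (resS h s) = resS (h'.trans h) s :=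
  resO_resO (X := X) h h' s

/-- The sections `M(U)`. -/
abbrev Sec {X : RingedSpace.{u, u}} (M : OMod X) (U : Opens X.carrier) : Type u :=
  M.val.obj (op U)

/-- The restriction `M(U) → M(V)`. -/
def res {X : RingedSpace.{u, u}} (M : OMod X) {U V : Opens X.carrier} (h : V ≤ U) :
    Sec M U →+ Sec M V :=
  (M.val.restrictₛₗ (homOfLE h).op).toAddMonoidHom

lemma res_smul {X : RingedSpace.{u, u}} (M : OMod X) {U V : Opens X.carrier} (h : V ≤ U)
    (r : Scal X U) (m : Sec M U) : res M h (r • m) = resS h r • res M h m :=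
  M.val.map_smul _ r m

lemma res_self {X : RingedSpace.{u, u}} (M : OMod X) {U : Opens X.carrier} (h : U ≤ U)
    (m : Sec M U) : res M h m = m := by
  have : (homOfLE h).op = 𝟙 (op U) := rfl
  change M.val.presheaf.map (homOfLE h).op m = m
  rw [this, M.val.presheaf.map_id]
  rfl

lemma res_res {X : RingedSpace.{u, u}} (M : OMod X) {U V W : Opens X.carrier} (h : V ≤ U)
    (h' : W ≤ V) (m : Sec M U) : res M h' (res M h m) = res M (h'.trans h) m :=
  (M.val.map_comp_apply (homOfLE h).op (homOfLE h').op m).symm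

/-! ### Finite ringed spaces

The points of `X` are preordered by `x ≤ y` iff `closure {x} ⊆ closure {y}`, that is `y ⤳ x`. -/

/-- The smallest open subset `U_x = {y | x ≤ y}` containing `x`. -/
def minOpen {X : TopCat.{u}} [Finite X] (x : X) : Opens X :=
  ⟨nhdsKer {x}, isOpen_nhdsKer⟩

lemma mem_minOpen {X : TopCat.{u}} [Finite X] {x y : X} : y ∈ minOpen x ↔ y ⤳ x :=
  mem_nhdsKer_singleton

lemma minOpen_le {X : TopCat.{u}} [Finite X] {x : X} {U : Opens X} (h : x ∈ U) :
    minOpen x ≤ U :=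
  fun _ hy => (mem_minOpen.1 hy).mem_open U.isOpen h

lemma minOpen_mono {X : TopCat.{u}} [Finite X] {x y : X} (h : y ⤳ x) :
    minOpen y ≤ minOpen x :=
  minOpen_le (mem_minOpen.2 h)

/-- A finite ringed space is a finite space if the restriction maps
`𝒪_x = 𝒪(U_x) → 𝒪(U_y) = 𝒪_y` are flat for all `x ≤ y`. -/
def IsFiniteSpace (X : RingedSpace.{u, u}) [Finite X.carrier] : Prop :=
  ∀ (x y : X.carrier) (h : y ⤳ x), (resO (X := X) (minOpen_mono h)).Flat

lemma O_ext {X : RingedSpace.{u, u}} [Finite X.carrier] {V : Opens X.carrier} {s t : O X V}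
    (h : ∀ (x : X.carrier) (hx : x ∈ V), resO (minOpen_le hx) s = resO (minOpen_le hx) t) :
    s = t := by
  refine X.sheaf.eq_of_locally_eq' (fun x : V => minOpen x.1) V
    (fun x => homOfLE (minOpen_le x.2)) ?_ s t (fun x => h x.1 x.2)
  intro x hx
  exact Opens.mem_iSup.2 ⟨⟨x, hx⟩, mem_minOpen.2 specializes_rfl⟩

/-- The ring of compatible families of elements of the stalks `𝒪_x = 𝒪(U_x)`, `x ∈ V`. -/
def compatO (X : RingedSpace.{u, u}) [Finite X.carrier] (V : Opens X.carrier) :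
    Subring (∀ x : V, O X (minOpen x.1)) where
  carrier := {s | ∀ (x y : V) (h : y.1 ⤳ x.1), resO (minOpen_mono h) (s x) = s y}
  mul_mem' ha hb x y h := by simp [ha x y h, hb x y h]
  one_mem' x y h := by simp
  add_mem' ha hb x y h := by simp [ha x y h, hb x y h]
  zero_mem' x y h := by simp
  neg_mem' ha x y h := by simp [ha x y h]

/-- A section over `V` gives a compatible family. -/
def toCompatO (X : RingedSpace.{u, u}) [Finite X.carrier] (V : Opens X.carrier) :
    O X V →+* compatO X V :=
  (RingHom.pi fun x : V => resO (minOpen_le x.2)).codRestrict _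
    (fun s _ _ _ => resO_resO _ _ s)

lemma toCompatO_bijective (X : RingedSpace.{u, u}) [Finite X.carrier] (V : Opens X.carrier) :
    Function.Bijective (toCompatO X V) := by
  constructor
  · intro s t h
    refine O_ext fun x hx => ?_
    exact congrFun (congrArg Subtype.val h) ⟨x, hx⟩
  · intro s
    obtain ⟨t, ht, -⟩ := X.sheaf.existsUnique_gluing' (fun x : V => minOpen x.1) V
      (fun x => homOfLE (minOpen_le x.2))
      (fun x hx => Opens.mem_iSup.2 ⟨⟨x, hx⟩, mem_minOpen.2 specializes_rfl⟩) s.1 (by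
        intro x y
        refine O_ext (X := X) fun z hz => ?_
        have hz' : z ∈ V := minOpen_le x.2 hz.1
        have h1 := s.2 x ⟨z, hz'⟩ (mem_minOpen.1 hz.1)
        have h2 := s.2 y ⟨z, hz'⟩ (mem_minOpen.1 hz.2)
        exact (resO_resO _ _ _).trans ((h1.trans h2.symm).trans (resO_resO _ _ _).symm))
    exact ⟨t, Subtype.ext (funext ht)⟩

/-- `𝒪(V)` is the ring of compatible families of elements of `𝒪_x`, `x ∈ V`. -/
def compatEquiv (X : RingedSpace.{u, u}) [Finite X.carrier] (V : Opens X.carrier) :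
    O X V ≃+* compatO X V :=
  RingEquiv.ofBijective _ (toCompatO_bijective X V)

lemma compatEquiv_symm_res (X : RingedSpace.{u, u}) [Finite X.carrier] (V : Opens X.carrier)
    (s : compatO X V) (x : X.carrier) (hx : x ∈ V) :
    resO (minOpen_le hx) ((compatEquiv X V).symm s) = s.1 ⟨x, hx⟩ :=
  congrFun (congrArg Subtype.val ((compatEquiv X V).apply_symm_apply s)) ⟨x, hx⟩

/-! ### Products and the diagonal -/

/-- A functorial family of commutative rings `R_p` with maps `R_p → R_q` for `p ≤ q`, indexed by
the points of a space. -/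
structure RingData (Z : TopCat.{u}) where
  /-- the ring at a point -/
  stalk : Z → Type u
  [commRing : ∀ p, CommRing (stalk p)]
  /-- the transition maps -/
  map : ∀ {p q : Z}, q ⤳ p → (stalk p →+* stalk q)
  map_self : ∀ (p : Z) (h : p ⤳ p) (a : stalk p), map h a = a
  map_map : ∀ {p q r : Z} (h : q ⤳ p) (h' : r ⤳ q) (a : stalk p),
    map h' (map h a) = map (h'.trans h) a

namespace RingData

attribute [instance] RingData.commRing

variable {Z : TopCat.{u}} (R : RingData Z)

/-- Sections over `W` of the sheaf attached to `R`: compatible families of elements. -/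
def sec (W : Opens Z) : Subring (∀ p : W, R.stalk p.1) where
  carrier := {s | ∀ (p q : W) (h : q.1 ⤳ p.1), R.map h (s p) = s q}
  mul_mem' ha hb x y h := by simp [ha x y h, hb x y h]
  one_mem' x y h := by simp
  add_mem' ha hb x y h := by simp [ha x y h, hb x y h]
  zero_mem' x y h := by simp
  neg_mem' ha x y h := by simp [ha x y h]

/-- The restriction maps of the sheaf attached to `R`. -/
def secRes {W W' : Opens Z} (i : W' ≤ W) : R.sec W →+* R.sec W' where
  toFun s := ⟨fun p => s.1 ⟨p.1, i p.2⟩, fun p q h => s.2 ⟨p.1, i p.2⟩ ⟨q.1, i q.2⟩ h⟩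
  map_one' := rfl
  map_mul' _ _ := rfl
  map_zero' := rfl
  map_add' _ _ := rfl

/-- The presheaf of rings attached to `R`. On a finite space it is a sheaf whose sections over the
smallest open neighbourhood of `p`, i.e. whose stalk at `p`, is `R_p`. -/
def presheaf : TopCat.Presheaf CommRingCat.{u} Z where
  obj W := CommRingCat.of (R.sec W.unop)
  map i := CommRingCat.ofHom (R.secRes i.unop.le)
  map_id _ := rfl
  map_comp _ _ := rfl

lemma isSheaf : R.presheaf.IsSheaf := by
  rw [TopCat.Presheaf.isSheaf_iff_isSheafUniqueGluing]
  intro ι U sf hsf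
  have key : ∀ (i j : ι) (p : Z) (hi : p ∈ U i) (hj : p ∈ U j),
      (sf i).1 ⟨p, hi⟩ = (sf j).1 ⟨p, hj⟩ := fun i j p hi hj =>
    congrFun (congrArg Subtype.val (hsf i j)) ⟨p, hi, hj⟩
  have hex : ∀ p : ↥(iSup U), ∃ i, p.1 ∈ U i := fun p => Opens.mem_iSup.1 p.2
  choose k hk using hex
  refine ⟨⟨fun p => (sf (k p)).1 ⟨p.1, hk p⟩, ?_⟩, ?_, ?_⟩
  · intro p q h
    have hq : q.1 ∈ U (k p) := h.mem_open (U (k p)).isOpen (hk p)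
    exact ((sf (k p)).2 ⟨p.1, hk p⟩ ⟨q.1, hq⟩ h).trans (key _ _ _ _ _)
  · intro i
    exact Subtype.ext (funext fun p => key _ _ _ _ _)
  · intro t ht
    refine Subtype.ext (funext fun p => ?_)
    exact congrFun (congrArg Subtype.val (ht (k p))) ⟨p.1, hk p⟩

end RingData

open TensorProduct in
/-- The map `𝒪_x ⊗_ℤ 𝒪_y → 𝒪_x' ⊗_ℤ 𝒪_y'` for `(x, y) ≤ (x', y')`. -/
def prodRes (X Y : RingedSpace.{u, u}) [Finite X.carrier] [Finite Y.carrier]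
    {p q : X.carrier × Y.carrier} (h : q ⤳ p) :
    O X (minOpen p.1) ⊗[ℤ] O Y (minOpen p.2) →+* O X (minOpen q.1) ⊗[ℤ] O Y (minOpen q.2) :=
  (Algebra.TensorProduct.map
    (resO (X := X) (minOpen_mono (specializes_prod.1 h).1)).toIntAlgHom
    (resO (X := Y) (minOpen_mono (specializes_prod.1 h).2)).toIntAlgHom).toRingHom

open TensorProduct in
lemma prodRes_tmul (X Y : RingedSpace.{u, u}) [Finite X.carrier] [Finite Y.carrier]
    {p q : X.carrier × Y.carrier} (h : q ⤳ p) (a : O X (minOpen p.1)) (b : O Y (minOpen p.2)) :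
    prodRes X Y h (a ⊗ₜ[ℤ] b) = resO (X := X) (minOpen_mono (specializes_prod.1 h).1) a ⊗ₜ[ℤ]
      resO (X := Y) (minOpen_mono (specializes_prod.1 h).2) b :=
  Algebra.TensorProduct.map_tmul _ _ _ _

open TensorProduct in
/-- The stalks `𝒪_x ⊗_ℤ 𝒪_y` of the structure sheaf of `X × Y`. -/
def prodData (X Y : RingedSpace.{u, u}) [Finite X.carrier] [Finite Y.carrier] :
    RingData (TopCat.of (X.carrier × Y.carrier)) where
  stalk p := O X (minOpen p.1) ⊗[ℤ] O Y (minOpen p.2)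
  map h := prodRes X Y h
  map_self p h a := by
    induction a using TensorProduct.induction_on with
    | zero => exact map_zero _
    | add a b ha hb => rw [map_add, ha, hb]
    | tmul a b => rw [prodRes_tmul, resO_self, resO_self]
  map_map h h' a := by
    induction a using TensorProduct.induction_on with
    | zero => simp only [map_zero]
    | add a b ha hb => simp only [map_add, ha, hb]
    | tmul a b => rw [prodRes_tmul, prodRes_tmul, prodRes_tmul, resO_resO, resO_resO]

/-- The product `X × Y` of finite ringed spaces: the product topological space, with the sheaf of
rings whose stalk at `(x, y)` is `𝒪_x ⊗_ℤ 𝒪_y`. -/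
def prod (X Y : RingedSpace.{u, u}) [Finite X.carrier] [Finite Y.carrier] :
    RingedSpace.{u, u} where
  carrier := TopCat.of (X.carrier × Y.carrier)
  presheaf := (prodData X Y).presheaf
  IsSheaf := (prodData X Y).isSheaf

/-- The continuous map `x ↦ (x, x)`. -/
def diagBase (X : RingedSpace.{u, u}) [Finite X.carrier] : X.carrier ⟶ (prod X X).carrier :=
  TopCat.ofHom ⟨fun x => (x, x), by fun_prop⟩

/-- The multiplication `𝒪_x ⊗_ℤ 𝒪_x → 𝒪_x`. -/
def mulStalk (X : RingedSpace.{u, u}) [Finite X.carrier] (x : X.carrier) :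
    (prodData X X).stalk (x, x) →+* O X (minOpen x) :=
  (Algebra.TensorProduct.lmul' (S := O X (minOpen x)) ℤ).toRingHom

lemma mulStalk_map (X : RingedSpace.{u, u}) [Finite X.carrier] {x y : X.carrier}
    (h : y ⤳ x) (h' : (y, y) ⤳ (x, x)) (t : (prodData X X).stalk (x, x)) :
    resO (X := X) (minOpen_mono h) (mulStalk X x t) = mulStalk X y ((prodData X X).map h' t) := by
  let F := (resO (X := X) (minOpen_mono h)).comp (mulStalk X x)
  let G := (mulStalk X y).comp ((prodData X X).map h')
  change F t = G t
  induction t using TensorProduct.induction_on with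
  | zero => exact (map_zero F).trans (map_zero G).symm
  | add a b ha hb =>
    exact (map_add F a b).trans ((congrArg₂ (· + ·) ha hb).trans (map_add G a b).symm)
  | tmul a b =>
    refine (congrArg (resO _) (Algebra.TensorProduct.lmul'_apply_tmul a b)).trans ?_
    refine (map_mul (resO _) a b).trans ?_
    exact ((congrArg (mulStalk X y) (prodRes_tmul X X h' a b)).trans
      (Algebra.TensorProduct.lmul'_apply_tmul _ _)).symm

/-- The compatible family in `∏ 𝒪_x` obtained by multiplication from a section of `𝒪_{X × X}`. -/
def diagFamily (X : RingedSpace.{u, u}) [Finite X.carrier] (W : Opens (prod X X).carrier) :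
    (prodData X X).sec W →+* compatO X ((Opens.map (diagBase X)).obj W) where
  toFun s := ⟨fun x => mulStalk X x.1 (s.1 ⟨(x.1, x.1), x.2⟩), fun x y h =>
    have h' : (y.1, y.1) ⤳ (x.1, x.1) := specializes_prod.2 ⟨h, h⟩
    (mulStalk_map X h h' _).trans
      (congrArg (mulStalk X y.1) (s.2 ⟨(x.1, x.1), x.2⟩ ⟨(y.1, y.1), y.2⟩ h'))⟩
  map_one' := Subtype.ext (funext fun x => map_one (mulStalk X x.1))
  map_mul' _ _ := Subtype.ext (funext fun x => map_mul (mulStalk X x.1) _ _)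
  map_zero' := Subtype.ext (funext fun x => map_zero (mulStalk X x.1))
  map_add' _ _ := Subtype.ext (funext fun x => map_add (mulStalk X x.1) _ _)

/-- The homomorphism `𝒪_{X × X}(W) → 𝒪(δ⁻¹ W)` given at a point `(x, x)` by the multiplication
`𝒪_x ⊗_ℤ 𝒪_x → 𝒪_x`. -/
def diagRingHom (X : RingedSpace.{u, u}) [Finite X.carrier]
    (W : Opens (prod X X).carrier) :
    (prodData X X).sec W →+* O X ((Opens.map (diagBase X)).obj W) :=
  (compatEquiv X _).symm.toRingHom.comp (diagFamily X W)

lemma diagRingHom_res (X : RingedSpace.{u, u}) [Finite X.carrier]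
    (W : Opens (prod X X).carrier) (s : (prodData X X).sec W) (x : X.carrier)
    (hx : x ∈ (Opens.map (diagBase X)).obj W) :
    resO (minOpen_le hx) (diagRingHom X W s) = mulStalk X x (s.1 ⟨(x, x), hx⟩) :=
  compatEquiv_symm_res X _ _ x hx

/-- The diagonal morphism `δ : X ⟶ X × X`. -/
def diag (X : RingedSpace.{u, u}) [Finite X.carrier] : X ⟶ prod X X :=
  InducedCategory.homMk
    { base := diagBase X
      c :=
        { app := fun W => CommRingCat.ofHom (diagRingHom X W.unop)
          naturality := by
            intro W W' i
            ext s
            refine O_ext fun x hx => ?_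
            have hx' : x ∈ (Opens.map (diagBase X)).obj W.unop := i.unop.le hx
            refine (diagRingHom_res X W'.unop _ x hx).trans ?_
            refine (diagRingHom_res X W.unop s x hx').symm.trans ?_
            exact (resO_resO (X := X) (U := (Opens.map (diagBase X)).obj W.unop)
              (V := (Opens.map (diagBase X)).obj W'.unop)
              (fun _ hz => i.unop.le hz) (minOpen_le hx) _).symm } }

/-- A finite ringed space is semi-separated if it is a finite space, `R^i δ_* 𝒪` is
quasi-coherent for all `i ≥ 0`, and `R^i δ_* 𝒪 = 0` for all `i > 0`. As the zero module is
quasi-coherent, quasi-coherence is a condition on `R^0 δ_* 𝒪 = δ_* 𝒪` only. -/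
structure IsSemiSeparated (X : RingedSpace.{u, u}) [Finite X.carrier] : Prop where
  isFiniteSpace : IsFiniteSpace X
  isQuasicoherent : ((push (diag X)).obj (SheafOfModules.unit (ringSheaf X))).IsQuasicoherent
  isZero : ∀ i : ℕ, 0 < i →
    Limits.IsZero (higherDirectImage (diag X) i (SheafOfModules.unit (ringSheaf X)))

/-! ### Chains of points -/

/-- A chain `x_0 < ⋯ < x_n` of points. -/
@[ext]
structure Chain (X : TopCat.{u}) (n : ℕ) where
  /-- the points of the chain -/
  pt : Fin (n + 1) → X
  lt : ∀ ⦃i j : Fin (n + 1)⦄, i < j → pt j ⤳ pt i ∧ ¬ pt i ⤳ pt j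

namespace Chain

variable {X : TopCat.{u}} {n : ℕ}

lemma le (c : Chain X n) {i j : Fin (n + 1)} (h : i ≤ j) : c.pt j ⤳ c.pt i := by
  rcases h.eq_or_lt with rfl | h
  · exact specializes_rfl
  · exact (c.lt h).1

/-- The last point of a chain. -/
def last (c : Chain X n) : X := c.pt (Fin.last n)

/-- The subchain given by an increasing map of indices. -/
def sub {m : ℕ} (c : Chain X n) (φ : Fin (m + 1) ↪o Fin (n + 1)) : Chain X m where
  pt i := c.pt (φ i)
  lt _ _ h := c.lt (φ.lt_iff_lt.2 h)

/-- The chain `x_0 < ⋯ < x̂_k < ⋯ < x_{n+1}` obtained by omitting `x_k`. -/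
def face (c : Chain X (n + 1)) (k : Fin (n + 2)) : Chain X n := c.sub (Fin.succAboveOrderEmb k)

lemma sub_last {m : ℕ} (c : Chain X n) (φ : Fin (m + 1) ↪o Fin (n + 1)) :
    c.last ⤳ (c.sub φ).last := c.le (Fin.le_last _)

lemma face_last (c : Chain X (n + 1)) (k : Fin (n + 2)) : c.last ⤳ (c.face k).last :=
  c.sub_last _

lemma sub_mem {m : ℕ} (c : Chain X n) (φ : Fin (m + 1) ↪o Fin (n + 1)) {U : Opens X}
    (h : c.pt 0 ∈ U) : (c.sub φ).pt 0 ∈ U :=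
  (c.le (Fin.zero_le _)).mem_open U.isOpen h

lemma face_mem (c : Chain X (n + 1)) (k : Fin (n + 2)) {U : Opens X}
    (h : c.pt 0 ∈ U) : (c.face k).pt 0 ∈ U :=
  c.sub_mem _ h

end Chain

/-- The cancellation behind `d ∘ d = 0`. -/
lemma alternating_sum_eq_zero {A : Type*} [AddCommGroup A] {n : ℕ}
    (g : (Fin (n + 1) ↪o Fin (n + 3)) → A) :
    ∑ k : Fin (n + 3), (-1 : ℤ) ^ (k : ℕ) • ∑ l : Fin (n + 2), (-1 : ℤ) ^ (l : ℕ) •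
      g ((Fin.succAboveOrderEmb l).trans (Fin.succAboveOrderEmb k)) = 0 := by
  simp only [Finset.smul_sum, smul_smul, ← pow_add]
  rw [Finset.sum_comm, ← Finset.sum_product']
  let P := Fin (n + 2) × Fin (n + 3)
  let S : Finset P := {ij : P | (ij.2 : ℕ) ≤ (ij.1 : ℕ)}
  rw [Finset.univ_product_univ, ← Finset.sum_add_sum_compl S, ← eq_neg_iff_add_eq_zero,
    ← Finset.sum_neg_distrib]
  let φ : ∀ ij : P, ij ∈ S → P := fun ij hij =>
    (Fin.castLT ij.2 (lt_of_le_of_lt (Finset.mem_filter.mp hij).right (Fin.is_lt ij.1)), ij.1.succ)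
  apply Finset.sum_bij φ
  · intro ij hij
    simp_rw [S, φ, Finset.compl_filter, Finset.mem_filter_univ, Fin.val_succ,
      Fin.val_castLT] at hij ⊢
    lia
  · rintro ⟨i, j⟩ hij ⟨i', j'⟩ hij' h
    rw [Prod.mk_inj]
    exact ⟨by simpa [φ] using! congr_arg Prod.snd h,
      by simpa [φ, Fin.castSucc_castLT] using! congr_arg Fin.castSucc (congr_arg Prod.fst h)⟩
  · rintro ⟨i', j'⟩ hij'
    simp_rw [S, Finset.compl_filter, Finset.mem_filter_univ, not_le] at hij'
    refine ⟨(j'.pred <| ?_, Fin.castSucc i'), ?_, ?_⟩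
    · rintro rfl
      simp only [Fin.val_zero, not_lt_zero] at hij'
    · simpa [S] using! Nat.le_sub_one_of_lt hij'
    · simp only [φ, Fin.castLT_castSucc, Fin.succ_pred]
  · rintro ⟨i, j⟩ hij
    have hij' : (j : ℕ) ≤ i := by simpa [S] using! hij
    dsimp only [φ]
    rw [← neg_smul]
    congr 1
    · simp only [Fin.val_succ, Fin.val_castLT]
      rw [show (i : ℕ) + 1 + j = (j + i) + 1 by ring, pow_succ]
      ring
    · congr 1
      ext a
      simp only [RelEmbedding.coe_trans, Function.comp_apply, Fin.succAboveOrderEmb_apply,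
        Fin.succAbove, Fin.lt_def, Fin.val_castSucc, Fin.val_castLT]
      split_ifs <;> simp_all <;> omega

/-! ### The standard complex -/

section Standard

variable {X : RingedSpace.{u, u}} [Finite X.carrier] (M : OMod X) (n : ℕ)

/-- `(C^n M)(U) = ∏_{(x_0 < ⋯ < x_n) ∈ U} M_{x_n}`, where `M_x = M(U_x)` is the stalk. -/
def StdSec (U : Opens X.carrier) : Type u :=
  ∀ c : {c : Chain X.carrier n // c.pt 0 ∈ U}, Sec M (minOpen c.1.last)

instance (U : Opens X.carrier) : AddCommGroup (StdSec M n U) :=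
  inferInstanceAs (AddCommGroup (∀ c : {c : Chain X.carrier n // c.pt 0 ∈ U},
    Sec M (minOpen c.1.last)))

lemma last_le {U : Opens X.carrier} {n : ℕ} (c : Chain X.carrier n) (h : c.pt 0 ∈ U) :
    minOpen c.last ≤ U :=
  minOpen_le ((c.le (Fin.zero_le _)).mem_open U.isOpen h)

/-- `𝒪(U)` acts on the factor `M_{x_n}` through the restriction `𝒪(U) → 𝒪_{x_n}`. -/
instance (U : Opens X.carrier) : Module (Scal X U) (StdSec M n U) :=
  letI (c : {c : Chain X.carrier n // c.pt 0 ∈ U}) :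
      Module (Scal X U) (Sec M (minOpen c.1.last)) :=
    Module.compHom _ (resS (X := X) (last_le c.1 c.2))
  inferInstanceAs (Module (Scal X U) (∀ c : {c : Chain X.carrier n // c.pt 0 ∈ U},
    Sec M (minOpen c.1.last)))

lemma stdSec_add_apply {U : Opens X.carrier} (s t : StdSec M n U)
    (c : {c : Chain X.carrier n // c.pt 0 ∈ U}) : (s + t) c = s c + t c := rfl

lemma stdSec_smul_apply {U : Opens X.carrier} (r : Scal X U) (s : StdSec M n U)
    (c : {c : Chain X.carrier n // c.pt 0 ∈ U}) :
    (r • s) c = resS (last_le c.1 c.2) r • s c := rfl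

/-- The abelian presheaf underlying `C^n M`; the restrictions are the projections. -/
def stdPresheaf : TopCat.Presheaf AddCommGrpCat.{u} X.carrier where
  obj U := AddCommGrpCat.of (StdSec M n U.unop)
  map {U V} i := AddCommGrpCat.ofHom
    { toFun := fun (s : StdSec M n U.unop) => (fun c => s ⟨c.1, i.unop.le c.2⟩ : StdSec M n V.unop)
      map_zero' := rfl
      map_add' := fun _ _ => rfl }

instance (U : (Opens X.carrier)ᵒᵖ) :
    Module ((ringSheaf X).obj.obj U) ((stdPresheaf M n).obj U) :=
  inferInstanceAs (Module (Scal X U.unop) (StdSec M n U.unop))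

lemma stdPresheaf_isSheaf : (stdPresheaf M n).IsSheaf := by
  rw [TopCat.Presheaf.isSheaf_iff_isSheafUniqueGluing]
  intro ι U sf hsf
  have key : ∀ (i j : ι) (c : Chain X.carrier n) (hi : c.pt 0 ∈ U i) (hj : c.pt 0 ∈ U j),
      (sf i : StdSec M n (U i)) ⟨c, hi⟩ = (sf j : StdSec M n (U j)) ⟨c, hj⟩ := fun i j c hi hj =>
    congrFun (hsf i j) ⟨c, hi, hj⟩
  have hex : ∀ c : {c : Chain X.carrier n // c.pt 0 ∈ iSup U}, ∃ i, c.1.pt 0 ∈ U i :=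
    fun c => Opens.mem_iSup.1 c.2
  choose k hk using hex
  refine ⟨(fun c => (sf (k c) : StdSec M n (U (k c))) ⟨c.1, hk c⟩ : StdSec M n (iSup U)), ?_, ?_⟩
  · intro i
    exact funext fun c => key _ _ _ _ _
  · intro t ht
    exact funext fun c => congrFun (ht (k c)) ⟨c.1, hk c⟩

/-- The `𝒪`-module `C^n M`. -/
def stdObj : OMod X where
  val := PresheafOfModules.ofPresheaf (stdPresheaf M n) (by
    intro U V i r s
    refine funext fun c => ?_
    exact congrArg (· • (s : StdSec M n U.unop) ⟨c.1, i.unop.le c.2⟩)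
      (resS_resS (X := X) i.unop.le (last_le c.1 c.2) r).symm)
  isSheaf := stdPresheaf_isSheaf M n

/-- The differential on sections: `(ds)_{x_0 < ⋯ < x_{n+1}} = ∑_k (-1)^k s_{x_0 < ⋯ x̂_k ⋯ < x_{n+1}}`,
where the term `k = n + 1` is restricted from `M_{x_n}` to `M_{x_{n+1}}`. (For `k ≤ n` the last
point is unchanged and the restriction below is the identity.) -/
def stdDSec (U : Opens X.carrier) : StdSec M n U →+ StdSec M (n + 1) U where
  toFun s := fun c => ∑ k : Fin (n + 2), (-1 : ℤ) ^ (k : ℕ) •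
    res M (minOpen_mono (c.1.face_last k)) (s ⟨c.1.face k, c.1.face_mem k c.2⟩)
  map_zero' := funext fun c => Finset.sum_eq_zero fun k _ =>
    (congrArg ((-1 : ℤ) ^ (k : ℕ) • ·) (map_zero (res M _))).trans (smul_zero _)
  map_add' s t := by
    funext c
    simp only [stdSec_add_apply, map_add, smul_add, Finset.sum_add_distrib]
    rfl

lemma stdDSec_apply {U : Opens X.carrier} (s : StdSec M n U)
    (c : {c : Chain X.carrier (n + 1) // c.pt 0 ∈ U}) :
    stdDSec M n U s c = ∑ k : Fin (n + 2), (-1 : ℤ) ^ (k : ℕ) •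
      res M (minOpen_mono (c.1.face_last k)) (s ⟨c.1.face k, c.1.face_mem k c.2⟩) := rfl

lemma stdDSec_smul {U : Opens X.carrier} (r : Scal X U) (s : StdSec M n U) :
    stdDSec M n U (r • s) = r • stdDSec M n U s := by
  funext c
  rw [stdSec_smul_apply, stdDSec_apply, stdDSec_apply, Finset.smul_sum]
  refine Finset.sum_congr rfl fun k _ => ?_
  rw [stdSec_smul_apply, res_smul, resS_resS, smul_comm]

lemma stdDSec_stdDSec {U : Opens X.carrier} (s : StdSec M n U) :
    stdDSec M (n + 1) U (stdDSec M n U s) = 0 := by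
  funext c
  refine Eq.trans ?_ (alternating_sum_eq_zero (fun φ : Fin (n + 1) ↪o Fin (n + 3) =>
    res M (minOpen_mono (c.1.sub_last φ)) (s ⟨c.1.sub φ, c.1.sub_mem φ c.2⟩)))
  simp only [stdDSec_apply, map_sum, map_zsmul, res_res]
  rfl

/-- The differential `C^n M ⟶ C^{n+1} M`. -/
def stdD : stdObj M n ⟶ stdObj M (n + 1) where
  val := PresheafOfModules.homMk (M₁ := (stdObj M n).val) (M₂ := (stdObj M (n + 1)).val)
    { app := fun U => AddCommGrpCat.ofHom (stdDSec M n U.unop)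
      naturality := fun _ _ _ => rfl }
    (fun U r s => stdDSec_smul M n (U := U.unop) r s)

lemma stdD_comp : stdD M n ≫ stdD M (n + 1) = 0 := by
  apply SheafOfModules.hom_ext
  apply PresheafOfModules.hom_ext
  intro U
  ext s
  exact stdDSec_stdDSec M n (U := U.unop) s

/-- The standard complex `C^• M`. -/
def stdComplex : CochainComplex (OMod X) ℕ :=
  CochainComplex.of (stdObj M) (stdD M) (stdD_comp M)

/-- The natural map `M(U) → (C^0 M)(U)`, sending a section to the family of its germs. -/
def stdAugSec (U : Opens X.carrier) : Sec M U →+ StdSec M 0 U where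
  toFun s := fun c => res M (last_le c.1 c.2) s
  map_zero' := funext fun _ => map_zero (res M _)
  map_add' _ _ := funext fun _ => map_add (res M _) _ _

/-- The natural morphism `M ⟶ C^0 M`. -/
def stdAug : M ⟶ (stdComplex M).X 0 where
  val := PresheafOfModules.homMk (M₁ := M.val) (M₂ := (stdObj M 0).val)
    { app := fun U => AddCommGrpCat.ofHom (stdAugSec M U.unop)
      naturality := fun U V i => by
        ext s
        exact funext fun c => res_res M i.unop.le (last_le c.1 c.2) s }
    (fun U r s => funext fun c => res_smul M (last_le (U := U.unop) c.1 c.2) r s)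

end Standard

/-! ### The pseudo-Čech complex -/

section Cech

variable {X : RingedSpace.{u, u}} [Finite X.carrier] (M : OMod X) (n : ℕ)

/-- `(Č^n M)(V) = ∏_{x_0 < ⋯ < x_n} M_{U_{x_n}}(V)`, where `M_U = j_* (M|_U)` for the inclusion
`j : U ↪ X`, i.e. `M_U(V) = M(V ∩ U)`. -/
def CechSec (V : Opens X.carrier) : Type u :=
  ∀ c : Chain X.carrier n, Sec M (V ⊓ minOpen c.last)

instance (V : Opens X.carrier) : AddCommGroup (CechSec M n V) :=
  inferInstanceAs (AddCommGroup (∀ c : Chain X.carrier n, Sec M (V ⊓ minOpen c.last)))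

/-- `𝒪(V)` acts on the factor `M(V ∩ U_{x_n})` through the restriction
`𝒪(V) → 𝒪(V ∩ U_{x_n})`. -/
instance (V : Opens X.carrier) : Module (Scal X V) (CechSec M n V) :=
  letI (c : Chain X.carrier n) : Module (Scal X V) (Sec M (V ⊓ minOpen c.last)) :=
    Module.compHom _ (resS (X := X) (V := V ⊓ minOpen c.last) inf_le_left)
  inferInstanceAs (Module (Scal X V) (∀ c : Chain X.carrier n, Sec M (V ⊓ minOpen c.last)))

lemma cechSec_add_apply {V : Opens X.carrier} (s t : CechSec M n V) (c : Chain X.carrier n) :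
    (s + t) c = s c + t c := rfl

lemma cechSec_smul_apply {V : Opens X.carrier} (r : Scal X V) (s : CechSec M n V)
    (c : Chain X.carrier n) :
    (r • s) c = resS (V := V ⊓ minOpen c.last) inf_le_left r • s c := rfl

/-- The restriction maps of `Č^n M`. -/
def cechRes {V W : Opens X.carrier} (h : W ≤ V) : CechSec M n V →+ CechSec M n W where
  toFun s := fun c => res M (inf_le_inf_right _ h) (s c)
  map_zero' := funext fun _ => map_zero (res M _)
  map_add' _ _ := funext fun _ => map_add (res M _) _ _

lemma cechRes_apply {V W : Opens X.carrier} (h : W ≤ V) (s : CechSec M n V)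
    (c : Chain X.carrier n) : cechRes M n h s c = res M (inf_le_inf_right _ h) (s c) := rfl

lemma cechRes_smul {V W : Opens X.carrier} (h : W ≤ V) (r : Scal X V) (s : CechSec M n V) :
    cechRes M n h (r • s) = resS h r • cechRes M n h s := by
  funext c
  rw [cechRes_apply, cechSec_smul_apply, cechSec_smul_apply, cechRes_apply, res_smul, resS_resS,
    resS_resS]

/-- The abelian presheaf underlying `Č^n M`. -/
def cechPresheaf : TopCat.Presheaf AddCommGrpCat.{u} X.carrier where
  obj V := AddCommGrpCat.of (CechSec M n V.unop)
  map i := AddCommGrpCat.ofHom (cechRes M n i.unop.le)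
  map_id V := by
    ext s
    exact funext fun c => res_self M _ _
  map_comp i j := by
    ext s
    exact funext fun c => (res_res M _ _ _).symm

instance (V : (Opens X.carrier)ᵒᵖ) :
    Module ((ringSheaf X).obj.obj V) ((cechPresheaf M n).obj V) :=
  inferInstanceAs (Module (Scal X V.unop) (CechSec M n V.unop))

lemma cechPresheaf_isSheaf : (cechPresheaf M n).IsSheaf := by
  rw [TopCat.Presheaf.isSheaf_iff_isSheafUniqueGluing]
  intro ι U sf hsf
  have hex : ∀ c : Chain X.carrier n, ∃! t : Sec M (iSup U ⊓ minOpen c.last),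
      ∀ i, res M (inf_le_inf_right _ (le_iSup U i)) t = (sf i : CechSec M n (U i)) c := by
    intro c
    refine (toAb M).existsUnique_gluing' (fun i => U i ⊓ minOpen c.last)
      (iSup U ⊓ minOpen c.last) (fun i => homOfLE (inf_le_inf_right _ (le_iSup U i)))
      (by rw [iSup_inf_eq]) (fun i => (sf i : CechSec M n (U i)) c) ?_
    intro i j
    have h := congrFun (hsf i j) c
    have hle : (U i ⊓ minOpen c.last) ⊓ (U j ⊓ minOpen c.last) ≤ (U i ⊓ U j) ⊓ minOpen c.last :=
      le_inf (inf_le_inf inf_le_left inf_le_left) (inf_le_left.trans inf_le_right)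
    have h' := congrArg (res M hle) h
    exact (res_res M _ hle _).symm.trans (h'.trans (res_res M _ hle _))
  choose t ht htu using hex
  refine ⟨(t : CechSec M n (iSup U)), fun i => funext fun c => ht c i, ?_⟩
  intro t' ht'
  exact funext fun c => htu c _ fun i => congrFun (ht' i) c

/-- The `𝒪`-module `Č^n M`. -/
def cechObj : OMod X where
  val := PresheafOfModules.ofPresheaf (cechPresheaf M n)
    (fun _ _ i r s => cechRes_smul M n i.unop.le r s)
  isSheaf := cechPresheaf_isSheaf M n

/-- The differential on sections, by the same formula as for the standard complex. (For `k ≤ n`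
the last point is unchanged and the restriction below is the identity.) -/
def cechDSec (V : Opens X.carrier) : CechSec M n V →+ CechSec M (n + 1) V where
  toFun s := fun c => ∑ k : Fin (n + 2), (-1 : ℤ) ^ (k : ℕ) •
    res M (inf_le_inf_left V (minOpen_mono (c.face_last k))) (s (c.face k))
  map_zero' := funext fun c => Finset.sum_eq_zero fun k _ =>
    (congrArg ((-1 : ℤ) ^ (k : ℕ) • ·) (map_zero (res M _))).trans (smul_zero _)
  map_add' s t := by
    funext c
    simp only [cechSec_add_apply, map_add, smul_add, Finset.sum_add_distrib]
    rfl

lemma cechDSec_apply {V : Opens X.carrier} (s : CechSec M n V) (c : Chain X.carrier (n + 1)) :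
    cechDSec M n V s c = ∑ k : Fin (n + 2), (-1 : ℤ) ^ (k : ℕ) •
      res M (inf_le_inf_left V (minOpen_mono (c.face_last k))) (s (c.face k)) := rfl

lemma cechDSec_smul {V : Opens X.carrier} (r : Scal X V) (s : CechSec M n V) :
    cechDSec M n V (r • s) = r • cechDSec M n V s := by
  funext c
  rw [cechSec_smul_apply, cechDSec_apply, cechDSec_apply, Finset.smul_sum]
  refine Finset.sum_congr rfl fun k _ => ?_
  rw [cechSec_smul_apply, res_smul, resS_resS, smul_comm]

lemma cechDSec_cechDSec {V : Opens X.carrier} (s : CechSec M n V) :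
    cechDSec M (n + 1) V (cechDSec M n V s) = 0 := by
  funext c
  refine Eq.trans ?_ (alternating_sum_eq_zero (fun φ : Fin (n + 1) ↪o Fin (n + 3) =>
    res M (inf_le_inf_left V (minOpen_mono (c.sub_last φ))) (s (c.sub φ))))
  simp only [cechDSec_apply, map_sum, map_zsmul, res_res]
  rfl

lemma cechDSec_res {V W : Opens X.carrier} (h : W ≤ V) (s : CechSec M n V) :
    cechDSec M n W (cechRes M n h s) = cechRes M (n + 1) h (cechDSec M n V s) := by
  funext c
  simp only [cechDSec_apply, cechRes_apply, map_sum, map_zsmul, res_res]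

/-- The differential `Č^n M ⟶ Č^{n+1} M`. -/
def cechD : cechObj M n ⟶ cechObj M (n + 1) where
  val := PresheafOfModules.homMk (M₁ := (cechObj M n).val) (M₂ := (cechObj M (n + 1)).val)
    { app := fun V => AddCommGrpCat.ofHom (cechDSec M n V.unop)
      naturality := fun V W i => by
        ext s
        exact cechDSec_res M n i.unop.le s }
    (fun V r s => cechDSec_smul M n (V := V.unop) r s)

lemma cechD_comp : cechD M n ≫ cechD M (n + 1) = 0 := by
  apply SheafOfModules.hom_ext
  apply PresheafOfModules.hom_ext
  intro V
  ext s
  exact cechDSec_cechDSec M n (V := V.unop) s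

/-- The pseudo-Čech complex `Č^• M`. -/
def cechComplex : CochainComplex (OMod X) ℕ :=
  CochainComplex.of (cechObj M) (cechD M) (cechD_comp M)

/-- The natural map `M(V) → (Č^0 M)(V)`, given by restriction to the `V ∩ U_x`. -/
def cechAugSec (V : Opens X.carrier) : Sec M V →+ CechSec M 0 V where
  toFun s := fun _ => res M inf_le_left s
  map_zero' := funext fun _ => map_zero (res M _)
  map_add' _ _ := funext fun _ => map_add (res M _) _ _

/-- The natural morphism `M ⟶ Č^0 M`. -/
def cechAug : M ⟶ (cechComplex M).X 0 where
  val := PresheafOfModules.homMk (M₁ := M.val) (M₂ := (cechObj M 0).val)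
    { app := fun V => AddCommGrpCat.ofHom (cechAugSec M V.unop)
      naturality := fun V W i => by
        ext s
        exact funext fun c => (res_res M i.unop.le inf_le_left s).trans
          (res_res M inf_le_left (inf_le_inf_right _ i.unop.le) s).symm }
    (fun V r s => funext fun c =>
      res_smul M (V := V.unop ⊓ minOpen c.last) inf_le_left r s)

end Cech

end

end FiniteRinged

/-! On a finite space the minimal open set `U_x` has no proper open subset containing `x`, so
sections over `U_x` are an exact functor (the stalk). All exactness is tested there. Both complexes,
over any open set, are complexes of cochains on chains with values `M(N x)` for some decreasing
family `N x ⊆ U_x`; `ChainCover` treats them together.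

For a Godement sheaf `∏ F_x` these cochains are exact in positive degrees: appending the point `z`
to a chain contracts the factor at `z` (`exactAt_god`). Dimension shifting along `0 → S → god S → Q
→ 0` then shows that exactness of the standard cochains over `U` behaves like vanishing of the
higher cohomology on `U`; it is automatic for flasque sheaves and for `U = U_x`. The last case gives
part 1, since the terms `C^i M` are flasque by extension by zero. A Leray-type comparison
(`exactAt_of_std`) reduces exactness of the pseudo-Čech cochains over `U_p` to acyclicity of `M` on
the intersections `U_p ∩ U_q`.

For part 2, a module is quasi-coherent exactly when `M_p ⊗ 𝒪_q → M_q` is an isomorphism for all `p ≤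
q` (`isBC_of_isQuasicoherent`, `isQuasicoherent_of_isBC`). Vanishing of `R^i δ_* 𝒪` makes `𝒪`
acyclic on `V = U_p ∩ U_q`, because `δ⁻¹(U_p × U_q) = V`. The standard complex of `M` over `V` is
`M_q` tensored with that of `𝒪`; the latter is a bounded exact complex of flat `𝒪_q`-modules,
augmented by `𝒪(V)`, and stays exact after tensoring. Hence `M` is acyclic on `V` and `M(V) = M_q ⊗
𝒪(V)` (`std_exactAt_and_isBC`). Acyclicity gives exactness of the pseudo-Čech complex and, applied
one chain at a time, acyclicity of its terms. The formula for `M(V)`, together with quasi-coherence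
of `δ_* 𝒪`, gives quasi-coherence of its terms. -/

namespace FiniteRinged

noncomputable section

/-! ### Chains -/

namespace Chain

variable {X : TopCat.{u}} {n : ℕ}

/-- The chain consisting of one point. -/
def single (x : X) : Chain X 0 where
  pt _ := x
  lt _ _ h := absurd h (by simp)

lemma eq_single (c : Chain X 0) : c = single c.last :=
  Chain.ext (funext fun _ => congrArg c.pt (Subsingleton.elim (α := Fin 1) _ _))

/-- The chain `x < y`. -/
def pair (x y : X) (h : y ⤳ x) (h' : ¬ x ⤳ y) : Chain X 1 where
  pt := ![x, y]
  lt := by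
    intro i j hij
    obtain ⟨rfl, rfl⟩ : i = 0 ∧ j = 1 := by
      revert i j
      decide
    exact ⟨h, h'⟩

lemma pair_face_zero (x y : X) (h : y ⤳ x) (h' : ¬ x ⤳ y) : (pair x y h h').face 0 = single y :=
  Chain.ext (funext fun i => by
    rw [Subsingleton.elim (α := Fin 1) i 0]
    rfl)

lemma pair_face_one (x y : X) (h : y ⤳ x) (h' : ¬ x ⤳ y) : (pair x y h h').face 1 = single x :=
  Chain.ext (funext fun i => by
    rw [Subsingleton.elim (α := Fin 1) i 0]
    rfl)

/-- The chain `x_0 < ⋯ < x_n < z`. -/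
def snoc (c : Chain X n) (z : X) (h : z ⤳ c.last) (h' : ¬ c.last ⤳ z) : Chain X (n + 1) where
  pt := Fin.snoc (α := fun _ => X) c.pt z
  lt i j hij := by
    induction i using Fin.lastCases with
    | last => exact absurd hij (not_lt.2 (Fin.le_last j))
    | cast i =>
      induction j using Fin.lastCases with
      | last =>
        simp only [Fin.snoc_last, Fin.snoc_castSucc]
        exact ⟨h.trans (c.le (Fin.le_last i)), fun h'' => h' ((c.le (Fin.le_last i)).trans h'')⟩
      | cast j =>
        simp only [Fin.snoc_castSucc]
        exact c.lt (Fin.castSucc_lt_castSucc_iff.1 hij)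

lemma snoc_last (c : Chain X n) (z : X) (h : z ⤳ c.last) (h' : ¬ c.last ⤳ z) :
    (c.snoc z h h').last = z :=
  Fin.snoc_last (α := fun _ => X) _ _

lemma snoc_pt_zero (c : Chain X n) (z : X) (h : z ⤳ c.last) (h' : ¬ c.last ⤳ z) :
    (c.snoc z h h').pt 0 = c.pt 0 :=
  Fin.snoc_castSucc (α := fun _ => X) z c.pt (0 : Fin (n + 1))

lemma snoc_face_last (c : Chain X n) (z : X) (h : z ⤳ c.last) (h' : ¬ c.last ⤳ z) :
    (c.snoc z h h').face (Fin.last _) = c :=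
  Chain.ext (funext fun i => by
    change Fin.snoc (α := fun _ => X) c.pt z ((Fin.last _).succAbove i) = _
    rw [Fin.succAbove_last, Fin.snoc_castSucc])

/-- Omitting an old point commutes with appending `z`; together with `snoc_face_last` this is what
makes appending a point a contracting homotopy. -/
lemma snoc_face_castSucc (c : Chain X (n + 1)) (z : X) (h : z ⤳ c.last) (h' : ¬ c.last ⤳ z)
    (k : Fin (n + 2)) :
    (c.snoc z h h').face k.castSucc =
      (c.face k).snoc z (h.trans (c.face_last k)) (fun h'' => h' ((c.face_last k).trans h'')) :=
  Chain.ext (funext fun i => by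
    change Fin.snoc (α := fun _ => X) c.pt z (k.castSucc.succAbove i) =
      Fin.snoc (α := fun _ => X) (c.face k).pt z i
    induction i using Fin.lastCases with
    | last =>
      rw [Fin.succAbove_ne_last_last (Fin.castSucc_ne_last k), Fin.snoc_last, Fin.snoc_last]
    | cast i =>
      rw [Fin.snoc_castSucc, Fin.castSucc_succAbove_castSucc, Fin.snoc_castSucc]
      rfl)

lemma face_castSucc_last (c : Chain X (n + 1)) (k : Fin (n + 1)) :
    (c.face k.castSucc).last = c.last := by
  change c.pt (k.castSucc.succAbove (Fin.last n)) = c.pt _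
  rw [Fin.succAbove_ne_last_last (Fin.castSucc_ne_last k)]

lemma face_last_last (c : Chain X (n + 1)) :
    (c.face (Fin.last _)).last = c.pt (Fin.last n).castSucc := by
  change c.pt ((Fin.last _).succAbove (Fin.last n)) = _
  rw [Fin.succAbove_last]

lemma last_specializes (c : Chain X (n + 1)) : c.last ⤳ (c.face (Fin.last _)).last ∧
    ¬ (c.face (Fin.last _)).last ⤳ c.last := by
  rw [face_last_last]
  exact c.lt (Fin.castSucc_lt_last _)

lemma face_last_snoc (c : Chain X (n + 1)) :
    (c.face (Fin.last _)).snoc c.last c.last_specializes.1 c.last_specializes.2 = c :=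
  Chain.ext (funext fun i => by
    change Fin.snoc (α := fun _ => X) (c.face (Fin.last _)).pt c.last i = _
    induction i using Fin.lastCases with
    | last => rw [Fin.snoc_last]; rfl
    | cast i =>
      rw [Fin.snoc_castSucc]
      change c.pt ((Fin.last _).succAbove i) = _
      rw [Fin.succAbove_last])

end Chain

/-! ### Abelian presheaves on finite spaces -/

section Ab

variable {X : TopCat.{u}}

/-- The restriction `F(U) → F(V)`. -/
def rs (F : TopCat.Presheaf AddCommGrpCat.{u} X) {U V : Opens X} (h : V ≤ U) :
    F.obj (op U) →+ F.obj (op V) :=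
  (F.map (homOfLE h).op).hom

lemma rs_self (F : TopCat.Presheaf AddCommGrpCat.{u} X) {U : Opens X} (h : U ≤ U)
    (s : F.obj (op U)) : rs F h s = s := by
  have : (homOfLE h).op = 𝟙 (op U) := rfl
  change F.map (homOfLE h).op s = s
  rw [this, F.map_id]
  rfl

lemma rs_rs (F : TopCat.Presheaf AddCommGrpCat.{u} X) {U V W : Opens X} (h : V ≤ U) (h' : W ≤ V)
    (s : F.obj (op U)) : rs F h' (rs F h s) = rs F (h'.trans h) s := by
  have : (homOfLE (h'.trans h)).op = (homOfLE h).op ≫ (homOfLE h').op := rfl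
  change F.map (homOfLE h').op (F.map (homOfLE h).op s) = F.map (homOfLE (h'.trans h)).op s
  rw [this, F.map_comp]
  rfl

lemma rs_app {F G : TopCat.Presheaf AddCommGrpCat.{u} X} (φ : F ⟶ G) {U V : Opens X} (h : V ≤ U)
    (s : F.obj (op U)) : rs G h (φ.app (op U) s) = φ.app (op V) (rs F h s) :=
  (ConcreteCategory.congr_hom (φ.naturality (homOfLE h).op) s).symm

lemma sheaf_ext [Finite X] (F : TopCat.Sheaf AddCommGrpCat.{u} X) {U : Opens X}
    {s t : F.obj.obj (op U)}
    (h : ∀ (x : X) (hx : x ∈ U), rs F.obj (minOpen_le hx) s = rs F.obj (minOpen_le hx) t) :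
    s = t :=
  F.eq_of_locally_eq' (fun x : U => minOpen x.1) U (fun x => homOfLE (minOpen_le x.2))
    (fun x hx => Opens.mem_iSup.2 ⟨⟨x, hx⟩, mem_minOpen.2 specializes_rfl⟩) s t
    (fun x => h x.1 x.2)

/-- The sections of `0 → K → F → Q` over every open subset form an exact sequence. -/
structure LeftExact {K F Q : TopCat.Presheaf AddCommGrpCat.{u} X} (ι : K ⟶ F) (π : F ⟶ Q) :
    Prop where
  inj : ∀ U : Opens X, Function.Injective (ι.app (op U))
  comp : ∀ (U : Opens X) (s : K.obj (op U)), π.app (op U) (ι.app (op U) s) = 0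
  lift : ∀ (U : Opens X) (s : F.obj (op U)), π.app (op U) s = 0 → ∃ t, ι.app (op U) t = s

end Ab

/-- The index data of a complex of chain cochains: chains start in `V`, the factor of a chain `c`
consists of the sections over `N c.last`, and the complex is augmented by the sections over `A`. -/
structure ChainCover (X : TopCat.{u}) [Finite X] where
  /-- the open set where chains start -/
  V : Opens X
  /-- the open set covered by the `N x` -/
  A : Opens X
  /-- the open set attached to a point -/
  N : X → Opens X
  N_le : ∀ x ∈ V, N x ≤ A
  N_le_minOpen : ∀ x, N x ≤ minOpen x
  mono : ∀ {x y : X}, y ⤳ x → N y ≤ N x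
  mem_V : ∀ x ∈ A, x ∈ V
  mem_N : ∀ x ∈ A, x ∈ N x

namespace ChainCover

variable {X : TopCat.{u}} [Finite X] (𝒰 : ChainCover X)

/-- The cover of `V` by minimal open sets. -/
def std (V : Opens X) : ChainCover X where
  V := V
  A := V
  N := minOpen
  N_le _ h := minOpen_le h
  N_le_minOpen _ := le_rfl
  mono := minOpen_mono
  mem_V _ h := h
  mem_N _ _ := mem_minOpen.2 specializes_rfl

/-- The cover of `W` by its intersections with all minimal open sets. -/
def cech (W : Opens X) : ChainCover X where
  V := ⊤
  A := W
  N x := W ⊓ minOpen x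
  N_le _ _ := inf_le_left
  N_le_minOpen _ := inf_le_right
  mono h := inf_le_inf_left W (minOpen_mono h)
  mem_V _ _ := trivial
  mem_N _ h := ⟨h, mem_minOpen.2 specializes_rfl⟩

variable (K F Q : TopCat.Presheaf AddCommGrpCat.{u} X) (n : ℕ)

/-- The cochains. -/
def Coch : Type u := ∀ c : {c : Chain X n // c.pt 0 ∈ 𝒰.V}, F.obj (op (𝒰.N c.1.last))

instance : AddCommGroup (𝒰.Coch F n) :=
  inferInstanceAs (AddCommGroup (∀ c : {c : Chain X n // c.pt 0 ∈ 𝒰.V},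
    F.obj (op (𝒰.N c.1.last))))

variable {F n} in
lemma coch_congr (s : 𝒰.Coch F n) {c c' : {c : Chain X n // c.pt 0 ∈ 𝒰.V}} (h : c = c')
    {W : Opens X} (hW : W ≤ 𝒰.N c.1.last) (hW' : W ≤ 𝒰.N c'.1.last) :
    rs F hW (s c) = rs F hW' (s c') := by
  subst h
  rfl

/-- The differential. -/
def d : 𝒰.Coch F n →+ 𝒰.Coch F (n + 1) where
  toFun s := fun c => ∑ k : Fin (n + 2), (-1 : ℤ) ^ (k : ℕ) •
    rs F (𝒰.mono (c.1.face_last k)) (s ⟨c.1.face k, c.1.face_mem k c.2⟩)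
  map_zero' := funext fun c => Finset.sum_eq_zero fun k _ =>
    (congrArg ((-1 : ℤ) ^ (k : ℕ) • ·) (map_zero (rs F _))).trans (smul_zero _)
  map_add' s t := funext fun c => by
    refine Eq.trans (Finset.sum_congr rfl fun k _ => ?_) Finset.sum_add_distrib
    exact (congrArg ((-1 : ℤ) ^ (k : ℕ) • ·) (map_add (rs F _) _ _)).trans (smul_add _ _ _)

lemma d_apply (s : 𝒰.Coch F n) (c : {c : Chain X (n + 1) // c.pt 0 ∈ 𝒰.V}) :
    𝒰.d F n s c = ∑ k : Fin (n + 2), (-1 : ℤ) ^ (k : ℕ) •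
      rs F (𝒰.mono (c.1.face_last k)) (s ⟨c.1.face k, c.1.face_mem k c.2⟩) := rfl

lemma d_d (s : 𝒰.Coch F n) : 𝒰.d F (n + 1) (𝒰.d F n s) = 0 := by
  funext c
  refine Eq.trans ?_ (alternating_sum_eq_zero (fun φ : Fin (n + 1) ↪o Fin (n + 3) =>
    rs F (𝒰.mono (c.1.sub_last φ)) (s ⟨c.1.sub φ, c.1.sub_mem φ c.2⟩)))
  simp only [d_apply, map_sum, map_zsmul, rs_rs]
  rfl

variable {K F Q}

/-- The map of cochains induced by a morphism of presheaves. -/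
def map (φ : F ⟶ Q) : 𝒰.Coch F n →+ 𝒰.Coch Q n where
  toFun s := fun c => φ.app _ (s c)
  map_zero' := funext fun _ => map_zero (φ.app _).hom
  map_add' _ _ := funext fun _ => map_add (φ.app _).hom _ _

lemma d_map (φ : F ⟶ Q) (s : 𝒰.Coch F n) :
    𝒰.d Q n (𝒰.map n φ s) = 𝒰.map (n + 1) φ (𝒰.d F n s) := by
  funext c
  have e : 𝒰.map (n + 1) φ (𝒰.d F n s) c = (φ.app (op (𝒰.N c.1.last))).hom (𝒰.d F n s c) := rfl
  rw [e, d_apply, d_apply]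
  refine Eq.trans ?_ (map_sum (φ.app (op (𝒰.N c.1.last))).hom _ _).symm
  refine Finset.sum_congr rfl fun k _ => ?_
  refine Eq.trans ?_ (map_zsmul (φ.app _).hom _ _).symm
  exact congrArg ((-1 : ℤ) ^ (k : ℕ) • ·) (rs_app φ _ _)

lemma map_surjective (φ : F ⟶ Q)
    (h : ∀ x : X, Function.Surjective (φ.app (op (𝒰.N x)))) : Function.Surjective (𝒰.map n φ) := by
  intro s
  choose t ht using fun c : {c : Chain X n // c.pt 0 ∈ 𝒰.V} => h c.1.last (s c)
  exact ⟨t, funext ht⟩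

lemma map_injective {ι : K ⟶ F} {π : F ⟶ Q} (h : LeftExact ι π) :
    Function.Injective (𝒰.map n ι) :=
  fun _ _ hst => funext fun c => h.inj _ (congrFun hst c)

lemma map_map_eq_zero {ι : K ⟶ F} {π : F ⟶ Q} (h : LeftExact ι π) (s : 𝒰.Coch K n) :
    𝒰.map n π (𝒰.map n ι s) = 0 :=
  funext fun _ => h.comp _ _

lemma map_lift {ι : K ⟶ F} {π : F ⟶ Q} (h : LeftExact ι π) (s : 𝒰.Coch F n)
    (hs : 𝒰.map n π s = 0) : ∃ t, 𝒰.map n ι t = s := by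
  choose t ht using fun c => h.lift _ (s c) (congrFun hs c)
  exact ⟨t, funext ht⟩

variable (F) in
/-- Exactness of the complex of cochains in degree `n + 1`. -/
def ExactAt : Prop := ∀ s : 𝒰.Coch F (n + 1), 𝒰.d F (n + 1) s = 0 → ∃ t, 𝒰.d F n t = s

variable (F) in
/-- The augmentation. -/
def aug : F.obj (op 𝒰.A) →+ 𝒰.Coch F 0 where
  toFun s := fun c => rs F (𝒰.N_le _ (by
    have := c.2
    rw [c.1.eq_single] at this
    exact this)) s
  map_zero' := funext fun _ => map_zero (rs F _)
  map_add' _ _ := funext fun _ => map_add (rs F _) _ _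

lemma aug_apply (s : F.obj (op 𝒰.A)) (c : {c : Chain X 0 // c.pt 0 ∈ 𝒰.V})
    (h : 𝒰.N c.1.last ≤ 𝒰.A) : 𝒰.aug F s c = rs F h s := rfl

lemma map_aug (φ : F ⟶ Q) (s : F.obj (op 𝒰.A)) :
    𝒰.map 0 φ (𝒰.aug F s) = 𝒰.aug Q (φ.app _ s) :=
  funext fun _ => (rs_app φ _ _).symm

lemma d_zero_apply (s : 𝒰.Coch F 0) (c : {c : Chain X 1 // c.pt 0 ∈ 𝒰.V}) :
    𝒰.d F 0 s c = rs F (𝒰.mono (c.1.face_last 0)) (s ⟨c.1.face 0, c.1.face_mem 0 c.2⟩) -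
      rs F (𝒰.mono (c.1.face_last 1)) (s ⟨c.1.face 1, c.1.face_mem 1 c.2⟩) := by
  rw [d_apply, Fin.sum_univ_two]
  simp [sub_eq_add_neg]

lemma d_aug (s : F.obj (op 𝒰.A)) : 𝒰.d F 0 (𝒰.aug F s) = 0 := by
  funext c
  have h (k : Fin 2) : 𝒰.N (c.1.face k).last ≤ 𝒰.A := 𝒰.N_le _ (by
    have := c.1.face_mem k c.2
    rwa [(c.1.face k).eq_single] at this)
  rw [d_zero_apply, aug_apply _ _ _ (h 0), aug_apply _ _ _ (h 1)]
  exact sub_eq_zero.2 ((rs_rs _ _ _ _).trans (rs_rs _ _ _ _).symm)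

section Sheaf

variable (S : TopCat.Sheaf AddCommGrpCat.{u} X)

/-- Each `x ∈ A` lies in `N x`, so the germ at `x` can be read off from the component at the
one-point chain `x`. -/
lemma aug_injective : Function.Injective (𝒰.aug S.obj) := by
  intro s t hst
  refine sheaf_ext S fun x hx => ?_
  have := congrFun hst ⟨Chain.single x, 𝒰.mem_V x hx⟩
  have h2 := congrArg (rs S.obj (minOpen_le (𝒰.mem_N x hx))) this
  exact (rs_rs _ _ _ _).symm.trans (h2.trans (rs_rs _ _ _ _))

/-- A degree-zero cocycle is a compatible family on the sets `N x`, which the sheaf condition glues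
to a section over `A`. -/
lemma exists_aug_eq [T0Space X] (s : 𝒰.Coch S.obj 0) (hs : 𝒰.d S.obj 0 s = 0) :
    ∃ a, 𝒰.aug S.obj a = s := by
  have key : ∀ (x y : X) (hx : x ∈ 𝒰.V) (hy : y ∈ 𝒰.V) (h : y ⤳ x),
      rs S.obj (𝒰.mono h) (s ⟨Chain.single x, hx⟩) = s ⟨Chain.single y, hy⟩ := by
    intro x y hx hy h
    -- By `T0`, distinct comparable points form a chain `x < y`, and the cocycle condition on that
    -- chain is the compatibility wanted.
    by_cases hxy : x = y
    · subst hxy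
      exact rs_self _ _ _
    · have h' : ¬ x ⤳ y := fun h' => hxy (h'.antisymm h).eq
      have := congrFun hs ⟨Chain.pair x y h h', hx⟩
      rw [d_zero_apply] at this
      have h2 := sub_eq_zero.1 this
      have e0 := 𝒰.coch_congr s (c := ⟨(Chain.pair x y h h').face 0, Chain.face_mem _ 0 hx⟩)
        (c' := ⟨Chain.single y, hy⟩) (Subtype.ext (Chain.pair_face_zero x y h h'))
        (W := 𝒰.N y) (𝒰.mono (Chain.face_last _ _)) le_rfl
      have e1 := 𝒰.coch_congr s (c := ⟨(Chain.pair x y h h').face 1, Chain.face_mem _ 1 hx⟩)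
        (c' := ⟨Chain.single x, hx⟩) (Subtype.ext (Chain.pair_face_one x y h h'))
        (W := 𝒰.N y) (𝒰.mono (Chain.face_last _ _)) (𝒰.mono h)
      exact e1.symm.trans (h2.symm.trans (e0.trans (rs_self _ _ _)))
  -- On overlaps the germs at `z` are compared through `s` at `z` itself; this works because `N x ⊆
  -- U_x` forces `x ≤ z`.
  obtain ⟨a, ha, -⟩ := S.existsUnique_gluing' (fun x : 𝒰.A => 𝒰.N x.1) 𝒰.A
    (fun x => homOfLE (𝒰.N_le _ (𝒰.mem_V _ x.2)))
    (fun x hx => Opens.mem_iSup.2 ⟨⟨x, hx⟩, 𝒰.mem_N x hx⟩)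
    (fun x => s ⟨Chain.single x.1, 𝒰.mem_V _ x.2⟩) (by
      intro x y
      refine sheaf_ext S fun z hz => ?_
      have hzA : z ∈ 𝒰.A := 𝒰.N_le _ (𝒰.mem_V _ x.2) hz.1
      have h1 := key x.1 z (𝒰.mem_V _ x.2) (𝒰.mem_V _ hzA)
        (mem_minOpen.1 (𝒰.N_le_minOpen _ hz.1))
      have h2 := key y.1 z (𝒰.mem_V _ y.2) (𝒰.mem_V _ hzA)
        (mem_minOpen.1 (𝒰.N_le_minOpen _ hz.2))
      have h3 := congrArg (rs S.obj (minOpen_le (𝒰.mem_N z hzA))) (h1.trans h2.symm)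
      exact (rs_rs S.obj (U := 𝒰.N x.1) (V := 𝒰.N x.1 ⊓ 𝒰.N y.1) _ _ _).trans
        ((rs_rs S.obj (U := 𝒰.N x.1) _ _ _).symm.trans (h3.trans
        ((rs_rs S.obj (U := 𝒰.N y.1) _ _ _).trans
          (rs_rs S.obj (U := 𝒰.N y.1) (V := 𝒰.N x.1 ⊓ 𝒰.N y.1) _ _ _).symm))))
  refine ⟨a, funext fun ⟨c, hc⟩ => ?_⟩
  obtain ⟨x, rfl⟩ : ∃ x, c = Chain.single x := ⟨_, c.eq_single⟩
  refine sheaf_ext S fun z hz => ?_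
  have hzA : z ∈ 𝒰.A := 𝒰.N_le _ hc hz
  have h1 := key x z hc (𝒰.mem_V _ hzA) (mem_minOpen.1 (𝒰.N_le_minOpen _ hz))
  have h2 := congrArg (rs S.obj (minOpen_le (𝒰.mem_N z hzA))) (h1.trans (ha ⟨z, hzA⟩).symm)
  have h3 := (rs_rs S.obj (U := 𝒰.N x) (V := 𝒰.N z) (W := minOpen z) _ _ _).symm.trans
    (h2.trans (rs_rs S.obj (𝒰.N_le _ (𝒰.mem_V _ hzA)) _ _))
  exact (rs_rs S.obj (𝒰.N_le _ hc) _ _).trans h3.symm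

end Sheaf

/-! ### Dimension shifting -/

section Shift

variable {ι : K ⟶ F} {π : F ⟶ Q} (h : LeftExact ι π)

include h

/-- A piece of the long exact sequence of cochain cohomology, as a diagram chase. `ExactAt n`
concerns degree `n + 1`, so the connecting map goes from `ExactAt Q n` to `ExactAt K (n + 1)`. -/
lemma exactAt_succ_of_quotient (hπ : ∀ x : X, Function.Surjective (π.app (op (𝒰.N x))))
    (hF : 𝒰.ExactAt F (n + 1)) (hQ : 𝒰.ExactAt Q n) : 𝒰.ExactAt K (n + 1) := by
  intro s hs
  obtain ⟨t, ht⟩ := hF (𝒰.map _ ι s) (by rw [d_map, hs, map_zero])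
  obtain ⟨v, hv⟩ := hQ (𝒰.map _ π t) (by rw [d_map, ht, 𝒰.map_map_eq_zero _ h])
  obtain ⟨v', rfl⟩ := 𝒰.map_surjective n π hπ v
  obtain ⟨w, hw⟩ := 𝒰.map_lift _ h (t - 𝒰.d F n v') (by
    rw [map_sub, ← d_map, hv, sub_self])
  refine ⟨w, 𝒰.map_injective _ h ?_⟩
  rw [← d_map, hw, map_sub, ht, d_d, sub_zero]

lemma exactAt_of_sub (hπ : ∀ x : X, Function.Surjective (π.app (op (𝒰.N x))))
    (hF : 𝒰.ExactAt F n) (hK : 𝒰.ExactAt K (n + 1)) : 𝒰.ExactAt Q n := by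
  intro s hs
  obtain ⟨t, rfl⟩ := 𝒰.map_surjective _ π hπ s
  obtain ⟨v, hv⟩ := 𝒰.map_lift _ h (𝒰.d F (n + 1) t) (by rw [← d_map, hs])
  obtain ⟨w, hw⟩ := hK v (𝒰.map_injective _ h (by rw [← d_map, hv, d_d, map_zero]))
  obtain ⟨z, hz⟩ := hF (t - 𝒰.map _ ι w) (by rw [map_sub, d_map, hw, hv, sub_self])
  refine ⟨𝒰.map _ π z, ?_⟩
  rw [d_map, hz, map_sub, 𝒰.map_map_eq_zero _ h, sub_zero]

end Shift

section ShiftSheaf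

variable [T0Space X] {K F Q : TopCat.Sheaf AddCommGrpCat.{u} X} {ι : K.obj ⟶ F.obj}
  {π : F.obj ⟶ Q.obj} (h : LeftExact ι π)

include h

/-- The bottom of the long exact sequence: degree-zero cocycles of `Q` are sections over `A`, so
lifting these sections to `F` replaces exactness for `Q`. -/
lemma exactAt_zero_of_surjective
    (hF : 𝒰.ExactAt F.obj 0) (hA : Function.Surjective (π.app (op 𝒰.A))) :
    𝒰.ExactAt K.obj 0 := by
  intro s hs
  obtain ⟨t, ht⟩ := hF (𝒰.map _ ι s) (by rw [d_map, hs, map_zero])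
  obtain ⟨v, hv⟩ := 𝒰.exists_aug_eq Q (𝒰.map _ π t) (by rw [d_map, ht, 𝒰.map_map_eq_zero _ h])
  obtain ⟨v', rfl⟩ := hA v
  obtain ⟨w, hw⟩ := 𝒰.map_lift _ h (t - 𝒰.aug F.obj v') (by
    rw [map_sub, map_aug, hv, sub_self])
  refine ⟨w, 𝒰.map_injective _ h ?_⟩
  rw [← d_map, hw, map_sub, ht, d_aug, sub_zero]

lemma surjective_of_exactAt_zero (hπ : ∀ x : X, Function.Surjective (π.app (op (𝒰.N x))))
    (hK : 𝒰.ExactAt K.obj 0) : Function.Surjective (π.app (op 𝒰.A)) := by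
  intro s
  obtain ⟨t, ht⟩ := 𝒰.map_surjective 0 π hπ (𝒰.aug _ s)
  obtain ⟨v, hv⟩ := 𝒰.map_lift _ h (𝒰.d F.obj 0 t) (by rw [← d_map, ht, d_aug])
  obtain ⟨w, hw⟩ := hK v (𝒰.map_injective _ h (by rw [← d_map, hv, d_d, map_zero]))
  obtain ⟨z, hz⟩ := 𝒰.exists_aug_eq F (t - 𝒰.map _ ι w) (by rw [map_sub, d_map, hw, hv, sub_self])
  refine ⟨z, 𝒰.aug_injective Q ?_⟩
  rw [← map_aug, hz, map_sub, ht, 𝒰.map_map_eq_zero _ h, sub_zero]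

end ShiftSheaf

end ChainCover

/-! ### The Godement sheaf -/

lemma isFlasque_of_surjective {X : TopCat.{u}} (S : TopCat.Sheaf AddCommGrpCat.{u} X)
    (h : ∀ {U V : Opens X} (i : V ≤ U), Function.Surjective (rs S.obj i)) : S.IsFlasque where
  epi i := (AddCommGrpCat.epi_iff_surjective _).2 (h i.unop.le)

lemma mono_of_injective {X : TopCat.{u}} {S T : TopCat.Sheaf AddCommGrpCat.{u} X} (φ : S ⟶ T)
    (h : ∀ U : Opens X, Function.Injective (φ.hom.app (op U))) : Mono φ := by
  refine ⟨fun a b hab => ?_⟩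
  apply Sheaf.hom_ext
  ext U s
  exact h U.unop (ConcreteCategory.congr_hom (congrArg (fun f => f.hom.app U) hab) s)

section Godement

variable {X : TopCat.{u}} [Finite X] (F : TopCat.Presheaf AddCommGrpCat.{u} X)

/-- The sections `∏_{x ∈ U} F(U_x)` of the Godement sheaf. -/
def GodSec (U : Opens X) : Type u := ∀ x : U, F.obj (op (minOpen x.1))

instance (U : Opens X) : AddCommGroup (GodSec F U) :=
  inferInstanceAs (AddCommGroup (∀ x : U, F.obj (op (minOpen x.1))))

/-- The sheaf of discontinuous sections of a presheaf `F`. -/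
def godPresheaf : TopCat.Presheaf AddCommGrpCat.{u} X where
  obj U := AddCommGrpCat.of (GodSec F U.unop)
  map {U V} i := AddCommGrpCat.ofHom
    { toFun := fun (s : GodSec F U.unop) => (fun x => s ⟨x.1, i.unop.le x.2⟩ : GodSec F V.unop)
      map_zero' := rfl
      map_add' := fun _ _ => rfl }

lemma godPresheaf_isSheaf : (godPresheaf F).IsSheaf := by
  rw [TopCat.Presheaf.isSheaf_iff_isSheafUniqueGluing]
  intro ι U sf hsf
  have key : ∀ (i j : ι) (c : X) (hi : c ∈ U i) (hj : c ∈ U j),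
      (sf i : GodSec F (U i)) ⟨c, hi⟩ = (sf j : GodSec F (U j)) ⟨c, hj⟩ := fun i j c hi hj =>
    congrFun (hsf i j) ⟨c, hi, hj⟩
  have hex : ∀ c : ↥(iSup U), ∃ i, c.1 ∈ U i := fun c => Opens.mem_iSup.1 c.2
  choose k hk using hex
  refine ⟨(fun c => (sf (k c) : GodSec F (U (k c))) ⟨c.1, hk c⟩ : GodSec F (iSup U)), ?_, ?_⟩
  · intro i
    exact funext fun c => key _ _ _ _ _
  · intro t ht
    exact funext fun c => congrFun (ht (k c)) ⟨c.1, hk c⟩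

/-- The Godement sheaf, as a sheaf. -/
def god : TopCat.Sheaf AddCommGrpCat.{u} X := ⟨godPresheaf F, godPresheaf_isSheaf F⟩

instance : (god F).IsFlasque := by
  classical
  refine isFlasque_of_surjective _ fun {U V} i s => ?_
  -- The components of the section are unrelated to one another, so it extends by zero.
  refine ⟨(fun x => if h : x.1 ∈ V then (s : GodSec F V) ⟨x.1, h⟩ else 0 : GodSec F U), ?_⟩
  exact funext fun x => dif_pos x.2

/-- The map from a presheaf to its Godement sheaf. -/
def toGodPresheaf : F ⟶ godPresheaf F where
  app U := AddCommGrpCat.ofHom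
    { toFun := fun s => (fun x => rs F (minOpen_le x.2) s : GodSec F U.unop)
      map_zero' := funext fun _ => map_zero (rs F _)
      map_add' := fun _ _ => funext fun _ => map_add (rs F _) _ _ }
  naturality U V i := by
    ext s
    exact funext fun x => rs_rs F i.unop.le (minOpen_le (U := V.unop) x.2) s

variable (S : TopCat.Sheaf AddCommGrpCat.{u} X)

/-- The map from a sheaf to its Godement sheaf. -/
def toGod : S ⟶ god S.obj where
  hom := toGodPresheaf S.obj

lemma toGod_injective (U : Opens X) : Function.Injective ((toGod S).hom.app (op U)) :=
  fun _ _ h => sheaf_ext S fun x hx => congrFun h ⟨x, hx⟩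

instance : Mono (toGod S) := mono_of_injective _ (toGod_injective S)

end Godement

/-! ### Short exact sequences of abelian sheaves -/

section ShortExact

open CategoryTheory.Limits

variable {X : TopCat.{u}}

lemma injective_of_mono {S T : TopCat.Sheaf AddCommGrpCat.{u} X} (φ : S ⟶ T) [Mono φ]
    (U : Opens X) : Function.Injective (φ.hom.app (op U)) := by
  have : Mono φ.hom := inferInstanceAs (Mono ((TopCat.Sheaf.forget _ _).map φ))
  rw [← AddCommGrpCat.mono_iff_injective]
  infer_instance

lemma leftExact_of_exact {S : ShortComplex (TopCat.Sheaf AddCommGrpCat.{u} X)}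
    (hS : S.Exact) (hf : Mono S.f) : LeftExact S.f.hom S.g.hom where
  inj := injective_of_mono S.f
  comp U s := ConcreteCategory.congr_hom (congrArg (fun f => f.hom.app (op U)) S.zero) s
  lift _ s h := TopCat.Sheaf.sections_exact_of_left_exact hS hf s h

lemma surjective_of_isFlasque {S : ShortComplex (TopCat.Sheaf AddCommGrpCat.{u} X)}
    (hS : S.ShortExact) [S.X₁.IsFlasque] (U : Opens X) :
    Function.Surjective (S.g.hom.app (op U)) :=
  (AddCommGrpCat.epi_iff_surjective _).1 (TopCat.Sheaf.IsFlasque.epi_of_shortExact hS)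

/-- An epimorphism lifts a section on some neighbourhood of `x` inside `U_x`, and the only such
neighbourhood is `U_x`. -/
lemma surjective_minOpen_of_epi [Finite X] {S T : TopCat.Sheaf AddCommGrpCat.{u} X} (φ : S ⟶ T)
    [Epi φ] (x : X) : Function.Surjective (φ.hom.app (op (minOpen x))) := by
  intro s
  have h := (Sheaf.isLocallySurjective_iff_epi' AddCommGrpCat.{u} φ).mpr ‹_›
  obtain ⟨W, hW, ⟨t, ht⟩, hx⟩ := (TopCat.Presheaf.isLocallySurjective_iff φ.hom).mp h (minOpen x) s
    x (mem_minOpen.2 specializes_rfl)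
  obtain rfl : W = minOpen x := le_antisymm hW (minOpen_le hx)
  exact ⟨t, ht.trans (rs_self T.obj le_rfl s)⟩

variable [Finite X] (S : TopCat.Sheaf AddCommGrpCat.{u} X)

/-- The short exact sequence given by the embedding of a sheaf in its Godement sheaf. -/
def godSeq : ShortComplex (TopCat.Sheaf AddCommGrpCat.{u} X) :=
  ShortComplex.mk (toGod S) (cokernel.π (toGod S)) (cokernel.condition _)

lemma godSeq_shortExact : (godSeq S).ShortExact where
  exact := ShortComplex.exact_cokernel (toGod S)
  mono_f := inferInstanceAs (Mono (toGod S))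
  epi_g := inferInstanceAs (Epi (cokernel.π (toGod S)))

instance : (godSeq S).X₂.IsFlasque := inferInstanceAs (god S.obj).IsFlasque

end ShortExact

/-! ### Acyclicity with respect to chain cochains -/

namespace ChainCover

variable {X : TopCat.{u}} [Finite X] (𝒰 : ChainCover X)

section

variable (F : TopCat.Presheaf AddCommGrpCat.{u} X) {n : ℕ}

open Classical in
/-- The homotopy on cochains of a Godement sheaf given by appending a point to a chain. -/
def godHomotopy (s : 𝒰.Coch (god F).obj (n + 1)) : 𝒰.Coch (god F).obj n :=
  fun c => (fun z => if h : c.1.last ⤳ z.1 then 0 else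
    (s ⟨c.1.snoc z.1 (mem_minOpen.1 (𝒰.N_le_minOpen _ z.2)) h, by
      rw [c.1.snoc_pt_zero]
      exact c.2⟩ : GodSec F _) ⟨z.1, by
        rw [c.1.snoc_last]
        refine 𝒰.mem_N _ (𝒰.N_le _ ?_ z.2)
        exact (c.1.le (Fin.zero_le _)).mem_open 𝒰.V.isOpen c.2⟩ : GodSec F _)

lemma god_congr {m : ℕ} (s : 𝒰.Coch (god F).obj m) {c c' : {c : Chain X m // c.pt 0 ∈ 𝒰.V}}
    (h : c = c') {z : X} (hz : z ∈ 𝒰.N c.1.last) (hz' : z ∈ 𝒰.N c'.1.last) :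
    (s c : GodSec F _) ⟨z, hz⟩ = (s c' : GodSec F _) ⟨z, hz'⟩ := by
  subst h
  rfl

lemma d_god_apply {m : ℕ} (s : 𝒰.Coch (god F).obj m)
    (c : {c : Chain X (m + 1) // c.pt 0 ∈ 𝒰.V}) {z : X} (hz : z ∈ 𝒰.N c.1.last) :
    (𝒰.d _ m s c : GodSec F _) ⟨z, hz⟩ = ∑ k : Fin (m + 2), (-1 : ℤ) ^ (k : ℕ) •
      (s ⟨c.1.face k, c.1.face_mem k c.2⟩ : GodSec F _) ⟨z, 𝒰.mono (c.1.face_last k) hz⟩ := by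
  rw [d_apply]
  exact Finset.sum_apply _ _ _

/-- Evaluation at `z` takes values in the fixed group `F(U_z)`, where the restrictions in the
differential disappear. If `h` appends `z`, then `d (h s) = (-1)^(n+1) s` for a cocycle `s`. -/
lemma exactAt_god [T0Space X] (n : ℕ) : 𝒰.ExactAt (god F).obj n := by
  classical
  intro s hs
  refine ⟨(-1 : ℤ) ^ (n + 1) • 𝒰.godHomotopy F s, ?_⟩
  rw [map_zsmul]
  suffices h : 𝒰.d _ n (𝒰.godHomotopy F s) = (-1 : ℤ) ^ (n + 1) • s by
    rw [h, smul_smul, ← mul_pow]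
    simp
  funext c
  refine funext fun ⟨z, hz⟩ => ?_
  rw [d_god_apply]
  change _ = (-1 : ℤ) ^ (n + 1) • (s c : GodSec F _) ⟨z, hz⟩
  -- If the chain already ends at `z`, every face but the last still ends at `z`, where the homotopy
  -- is zero. The last face with `z` put back is `c`, with sign `(-1)^(n+1)`.
  by_cases h : c.1.last ⤳ z
  · obtain rfl : c.1.last = z := (h.antisymm (mem_minOpen.1 (𝒰.N_le_minOpen _ hz))).eq
    rw [Fin.sum_univ_castSucc, Finset.sum_eq_zero, zero_add]
    · refine congrArg₂ (· • ·) rfl ((dif_neg c.1.last_specializes.2).trans ?_)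
      exact 𝒰.god_congr F s (Subtype.ext c.1.face_last_snoc) _ _
    · intro k _
      refine (congrArg (_ • ·) (dif_pos ?_)).trans (smul_zero _)
      exact specializes_of_eq (c.1.face_castSucc_last k)
  · have hz' : z ⤳ c.1.last := mem_minOpen.1 (𝒰.N_le_minOpen _ hz)
    have hzN : z ∈ 𝒰.N (c.1.snoc z hz' h).last := by
      rw [c.1.snoc_last]
      refine 𝒰.mem_N _ (𝒰.N_le _ ?_ hz)
      exact (c.1.le (Fin.zero_le _)).mem_open 𝒰.V.isOpen c.2
    have hV : (c.1.snoc z hz' h).pt 0 ∈ 𝒰.V := by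
      rw [c.1.snoc_pt_zero]
      exact c.2
    -- Otherwise the cocycle condition on `c` extended by `z` expresses the sum over the extended
    -- faces as minus `(-1)^(n+2)` times the value at `c`.
    have key := congrFun (congrFun hs ⟨c.1.snoc z hz' h, hV⟩) ⟨z, hzN⟩
    rw [d_god_apply, Fin.sum_univ_castSucc] at key
    have key' := eq_neg_of_add_eq_zero_left key
    have e1 : ∀ k : Fin (n + 2), 𝒰.godHomotopy F s ⟨c.1.face k, c.1.face_mem k c.2⟩
        ⟨z, 𝒰.mono (c.1.face_last k) hz⟩ = (s ⟨(c.1.snoc z hz' h).face k.castSucc,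
          Chain.face_mem _ _ hV⟩ : GodSec F _) ⟨z, 𝒰.mono (Chain.face_last _ _) hzN⟩ := fun k =>
      (dif_neg fun h'' => h ((c.1.face_last k).trans h'')).trans
        (𝒰.god_congr F s (Subtype.ext (c.1.snoc_face_castSucc z hz' h k).symm) _ _)
    have e2 := 𝒰.god_congr F s (c := ⟨(c.1.snoc z hz' h).face (Fin.last _),
      Chain.face_mem _ _ hV⟩) (c' := c) (Subtype.ext (c.1.snoc_face_last z hz' h))
        (𝒰.mono (Chain.face_last _ _) hzN) hz
    refine (Finset.sum_congr rfl fun k _ => congrArg (_ • ·) (e1 k)).trans (key'.trans ?_)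
    rw [Fin.val_last, pow_succ _ (n + 1), mul_neg_one, neg_smul, neg_neg]
    exact congrArg (_ • ·) e2

end

section

variable [T0Space X]

/-- The quotient of the Godement sheaf by a flasque sheaf is again flasque, and sections over every
open set lift, so dimension shifting applies for any cover. -/
lemma exactAt_of_isFlasque (n : ℕ) (S : TopCat.Sheaf AddCommGrpCat.{u} X) (hS : S.IsFlasque) :
    𝒰.ExactAt S.obj n := by
  induction n generalizing S with
  | zero =>
    have : (godSeq S).X₁.IsFlasque := hS
    exact 𝒰.exactAt_zero_of_surjective
      (leftExact_of_exact (godSeq_shortExact S).exact (godSeq_shortExact S).mono_f)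
      (𝒰.exactAt_god _ _) (surjective_of_isFlasque (godSeq_shortExact S) _)
  | succ n ih =>
    have : (godSeq S).X₁.IsFlasque := hS
    exact 𝒰.exactAt_succ_of_quotient n
      (leftExact_of_exact (godSeq_shortExact S).exact (godSeq_shortExact S).mono_f)
      (fun _ => surjective_of_isFlasque (godSeq_shortExact S) _) (𝒰.exactAt_god _ _)
      (ih _ (TopCat.Sheaf.IsFlasque.of_shortExact_of_isFlasque₁₂ (godSeq_shortExact S)))

/-! ### Standard cochains as a measure of cohomology: shifting along a flasque middle term -/

section Std

variable (U : Opens X) {S : ShortComplex (TopCat.Sheaf AddCommGrpCat.{u} X)} (hS : S.ShortExact)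
  (h₂ : S.X₂.IsFlasque)

include hS h₂

/-- For the standard cover the sets `N x` are minimal, so an epimorphism of sheaves is surjective on
every factor and both chases apply. -/
lemma std_exactAt_succ_iff (n : ℕ) :
    (std U).ExactAt S.X₁.obj (n + 1) ↔ (std U).ExactAt S.X₃.obj n :=
  have := hS.epi_g
  ⟨(std U).exactAt_of_sub n (leftExact_of_exact hS.exact hS.mono_f)
    (surjective_minOpen_of_epi S.g) ((std U).exactAt_of_isFlasque n _ h₂),
  (std U).exactAt_succ_of_quotient n (leftExact_of_exact hS.exact hS.mono_f)
    (surjective_minOpen_of_epi S.g) ((std U).exactAt_of_isFlasque _ _ h₂)⟩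

lemma std_exactAt_zero_iff :
    (std U).ExactAt S.X₁.obj 0 ↔ Function.Surjective (S.g.hom.app (op U)) :=
  have := hS.epi_g
  ⟨(std U).surjective_of_exactAt_zero (leftExact_of_exact hS.exact hS.mono_f)
    (surjective_minOpen_of_epi S.g),
  (std U).exactAt_zero_of_surjective (leftExact_of_exact hS.exact hS.mono_f)
    ((std U).exactAt_of_isFlasque _ _ h₂)⟩

end Std

/-- Sections over `U_x` form an exact functor, so the surjectivity criterion holds at every stage of
the shifting. -/
lemma std_minOpen_exactAt (x : X) (n : ℕ) (S : TopCat.Sheaf AddCommGrpCat.{u} X) :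
    (std (minOpen x)).ExactAt S.obj n := by
  induction n generalizing S with
  | zero =>
    have := (godSeq_shortExact S).epi_g
    exact (std_exactAt_zero_iff _ (godSeq_shortExact S) inferInstance).2
      (surjective_minOpen_of_epi (godSeq S).g x)
  | succ n ih =>
    exact (std_exactAt_succ_iff _ (godSeq_shortExact S) inferInstance n).2 (ih _)

/-- Comparison of chain cochains for a cover by acyclic open subsets with those for the cover by
minimal open subsets. -/
lemma exactAt_of_std (n : ℕ) (S : TopCat.Sheaf AddCommGrpCat.{u} X)
    (hN : ∀ x m, (std (𝒰.N x)).ExactAt S.obj m) (hA : ∀ m, (std 𝒰.A).ExactAt S.obj m) :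
    𝒰.ExactAt S.obj n := by
  have hG := godSeq_shortExact S
  -- Acyclicity of `S` on `N x` is what makes the sequence of cochains for this cover exact on the
  -- right.
  have hπ : ∀ x, Function.Surjective ((godSeq S).g.hom.app (op (𝒰.N x))) := fun x =>
    (std_exactAt_zero_iff _ hG inferInstance).1 (hN x 0)
  induction n generalizing S with
  | zero =>
    exact 𝒰.exactAt_zero_of_surjective (leftExact_of_exact hG.exact hG.mono_f)
      (𝒰.exactAt_god _ _) ((std_exactAt_zero_iff _ hG inferInstance).1 (hA 0))
  | succ n ih =>
    -- The quotient inherits the hypotheses with a shift by one; hence they are assumed in all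
    -- degrees.
    have hN' : ∀ x m, (std (𝒰.N x)).ExactAt (godSeq S).X₃.obj m := fun x m =>
      (std_exactAt_succ_iff _ hG inferInstance m).1 (hN x (m + 1))
    exact 𝒰.exactAt_succ_of_quotient n (leftExact_of_exact hG.exact hG.mono_f) hπ
      (𝒰.exactAt_god _ _) (ih _ hN'
        (fun m => (std_exactAt_succ_iff _ hG inferInstance m).1 (hA (m + 1)))
        (godSeq_shortExact _)
        (fun x => (std_exactAt_zero_iff _ (godSeq_shortExact _) inferInstance).1 (hN' x 0)))

end

end ChainCover

/-! ### Cohomology and chain cochains -/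

section Cohomology

open CategoryTheory.Limits Abelian

variable {X : TopCat.{u}}

/-- The category of abelian sheaves. -/
abbrev AbSheaf (X : TopCat.{u}) := Sheaf (Opens.grothendieckTopology X) AddCommGrpCat.{u}

/-- An injective sheaf is a retract of its Godement sheaf: lift the section there and retract it. -/
lemma isFlasque_of_injective [Finite X] (S : TopCat.Sheaf AddCommGrpCat.{u} X) [Injective S] :
    S.IsFlasque := by
  refine isFlasque_of_surjective S fun {U V} i s => ?_
  have h : (god S.obj).IsFlasque := inferInstance
  obtain ⟨t, ht⟩ := (AddCommGrpCat.epi_iff_surjective _).1 (h.epi (homOfLE i).op)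
    ((toGod S).hom.app (op V) s)
  let r := Injective.factorThru (𝟙 S) (toGod S)
  refine ⟨r.hom.app (op U) t, (rs_app r.hom i t).trans ?_⟩
  refine (congrArg (r.hom.app (op V)) ht).trans ?_
  exact ConcreteCategory.congr_hom (congrArg (fun f => f.hom.app (op V))
    (Injective.comp_factorThru (𝟙 S) (toGod S))) s

/-! ### Vanishing of sheaf cohomology from the long exact sequence -/

section

variable {S : ShortComplex (AbSheaf X)} (hS : S.ShortExact)

include hS

/-- Every class of the subobject is a connecting image, and the connecting map kills whatever comes
from the middle term. -/
lemma subsingleton_H_succ_of_shortExact (k : ℕ) (h₂ : Subsingleton (Sheaf.H S.X₂ (k + 1)))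
    (h₃ : ∀ x : Sheaf.H S.X₃ k, ∃ y : Sheaf.H S.X₂ k, Sheaf.H.map S.g k y = x) :
    Subsingleton (Sheaf.H S.X₁ (k + 1)) := by
  refine subsingleton_of_forall_eq 0 fun x => ?_
  obtain ⟨y, hy⟩ := Ext.covariant_sequence_exact₁ _ hS x (Subsingleton.elim _ _) rfl
  obtain ⟨z, rfl⟩ := h₃ y
  rw [← hy, Sheaf.H.map_apply, Ext.comp_assoc _ _ _ (by omega) (zero_add 1) (by omega),
    hS.comp_extClass, Ext.comp_zero]

lemma subsingleton_H_succ_of_subsingleton (k : ℕ)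
    (h₂ : Subsingleton (Sheaf.H S.X₂ (k + 1))) (h₃ : Subsingleton (Sheaf.H S.X₃ k)) :
    Subsingleton (Sheaf.H S.X₁ (k + 1)) :=
  subsingleton_H_succ_of_shortExact hS k h₂ fun _ => ⟨0, Subsingleton.elim _ _⟩

lemma subsingleton_H_one_of_surjective (h₂ : Subsingleton (Sheaf.H S.X₂ 1))
    (h : Function.Surjective (S.g.hom.app (op ⊤))) : Subsingleton (Sheaf.H S.X₁ 1) := by
  refine subsingleton_H_succ_of_shortExact hS 0 h₂ fun x => ?_
  have hT : IsTerminal (⊤ : Opens X) := isTerminalTop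
  obtain ⟨y, hy⟩ := h (Sheaf.H.equiv₀ S.X₃ hT x)
  refine ⟨(Sheaf.H.equiv₀ S.X₂ hT).symm y, (Sheaf.H.equiv₀ S.X₃ hT).injective ?_⟩
  rw [← Sheaf.H.equiv₀_naturality, AddEquiv.apply_symm_apply, hy]

end

/-- The short exact sequence given by the embedding of a sheaf in an injective one. -/
def injSeq (S : TopCat.Sheaf AddCommGrpCat.{u} X) :
    ShortComplex (TopCat.Sheaf AddCommGrpCat.{u} X) :=
  ShortComplex.mk (Injective.ι S) (cokernel.π _) (cokernel.condition _)

lemma injSeq_shortExact (S : TopCat.Sheaf AddCommGrpCat.{u} X) : (injSeq S).ShortExact where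
  exact := ShortComplex.exact_cokernel (Injective.ι S)
  mono_f := inferInstanceAs (Mono (Injective.ι S))
  epi_g := inferInstanceAs (Epi (cokernel.π (Injective.ι S)))

instance (S : TopCat.Sheaf AddCommGrpCat.{u} X) : Injective (injSeq S).X₂ :=
  inferInstanceAs (Injective (Injective.under S))

lemma subsingleton_H_of_injective (k : ℕ) (S : AbSheaf X) (_ : Injective S) :
    Subsingleton (Sheaf.H S (k + 1)) := inferInstance

/-- Dimension shifting in an injective sheaf, which is flasque, so that the quotient is flasque too.
-/
lemma subsingleton_H_of_isFlasque [Finite X] (k : ℕ) (S : TopCat.Sheaf AddCommGrpCat.{u} X)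
    (hS : S.IsFlasque) : Subsingleton (Sheaf.H S (k + 1)) := by
  have hT := injSeq_shortExact S
  have : (injSeq S).X₁.IsFlasque := hS
  induction k generalizing S with
  | zero =>
    exact subsingleton_H_one_of_surjective hT (subsingleton_H_of_injective 0 _
      (inferInstanceAs (Injective (injSeq S).X₂)))
      (surjective_of_isFlasque hT _)
  | succ k ih =>
    have : (injSeq S).X₂.IsFlasque := isFlasque_of_injective _
    have h₃ : (injSeq S).X₃.IsFlasque := TopCat.Sheaf.IsFlasque.of_shortExact_of_isFlasque₁₂ hT
    have h := ih (injSeq S).X₃ h₃ (injSeq_shortExact _) h₃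
    exact subsingleton_H_succ_of_subsingleton hT (k + 1)
      (subsingleton_H_of_injective (k + 1) _ (inferInstanceAs (Injective (injSeq S).X₂))) h

/-- Along the Godement sequence, cohomology and standard cochains over the whole space shift in
parallel, so exactness of the cochains transfers to vanishing of cohomology. -/
lemma subsingleton_H_of_std_exactAt [Finite X] [T0Space X] (k : ℕ)
    (S : TopCat.Sheaf AddCommGrpCat.{u} X)
    (h : ∀ n, (ChainCover.std (⊤ : Opens X)).ExactAt S.obj n) :
    Subsingleton (Sheaf.H S (k + 1)) := by
  have hG := godSeq_shortExact S
  induction k generalizing S with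
  | zero =>
    exact subsingleton_H_one_of_surjective hG (subsingleton_H_of_isFlasque 0 _ inferInstance)
      ((ChainCover.std_exactAt_zero_iff _ hG inferInstance).1 (h 0))
  | succ k ih =>
    have h := ih (godSeq S).X₃
      (fun n => (ChainCover.std_exactAt_succ_iff _ hG inferInstance n).1 (h (n + 1)))
      (godSeq_shortExact _)
    exact subsingleton_H_succ_of_subsingleton hG (k + 1)
      (subsingleton_H_of_isFlasque (k + 1) _ inferInstance) h

end Cohomology

/-! ### Higher direct images and chain cochains -/

section DirectImage

open CategoryTheory.Limits

variable {X : TopCat.{u}}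

lemma epi_kernel_lift_of_exact {S : ShortComplex (TopCat.Sheaf AddCommGrpCat.{u} X)}
    (hS : S.Exact) : Epi (kernel.lift S.g S.f S.zero) :=
  (ShortComplex.exact_iff_epi_kernel_lift S).1 hS

lemma leftExact_kernel {S T : TopCat.Sheaf AddCommGrpCat.{u} X} (φ : S ⟶ T) :
    LeftExact (kernel.ι φ).hom φ.hom :=
  leftExact_of_exact (S := ShortComplex.mk (kernel.ι φ) φ (kernel.condition φ))
    (ShortComplex.exact_kernel φ) (inferInstanceAs (Mono (kernel.ι φ)))

lemma comp_hom_app {S T R : TopCat.Sheaf AddCommGrpCat.{u} X} {φ : S ⟶ T} {ψ : T ⟶ R} {χ : S ⟶ R}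
    (h : φ ≫ ψ = χ) {U : Opens X} (s : S.obj.obj (op U)) :
    ψ.hom.app (op U) (φ.hom.app (op U) s) = χ.hom.app (op U) s :=
  ConcreteCategory.congr_hom (congrArg (fun f => f.hom.app (op U)) h) s

/-- A section killed by `g` lies in the kernel sheaf, onto which `f` is an epimorphism, hence
surjective over `U_x`. -/
lemma sections_exact_minOpen [Finite X] {S : ShortComplex (TopCat.Sheaf AddCommGrpCat.{u} X)}
    (hS : S.Exact) (x : X) (s : S.X₂.obj.obj (op (minOpen x)))
    (h : S.g.hom.app (op (minOpen x)) s = 0) : ∃ t, S.f.hom.app (op (minOpen x)) t = s := by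
  obtain ⟨k, rfl⟩ := (leftExact_kernel S.g).lift _ s h
  have := epi_kernel_lift_of_exact hS
  obtain ⟨t, rfl⟩ := surjective_minOpen_of_epi (kernel.lift S.g S.f S.zero) x k
  exact ⟨t, (comp_hom_app (kernel.lift_ι S.g S.f S.zero) t).symm⟩

/-- The short exact sequence `0 → K → F → ker g → 0` given by an exact sequence
`0 → K → F → G → H`. -/
lemma shortExact_kernel_lift {S : ShortComplex (TopCat.Sheaf AddCommGrpCat.{u} X)} (hS : S.Exact)
    (hf : Mono S.f) {H : TopCat.Sheaf AddCommGrpCat.{u} X} (g : S.X₃ ⟶ H) (w : S.g ≫ g = 0)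
    (hg : (ShortComplex.mk S.g g w).Exact) :
    (ShortComplex.mk S.f (kernel.lift g S.g w) (by
      rw [← cancel_mono (kernel.ι g), Category.assoc, kernel.lift_ι, S.zero,
        zero_comp])).ShortExact where
  exact := by
    refine (ShortComplex.exact_iff_of_epi_of_isIso_of_mono
      (S₁ := ShortComplex.mk S.f (kernel.lift g S.g w) _) (S₂ := S)
      { τ₁ := 𝟙 _, τ₂ := 𝟙 _, τ₃ := kernel.ι g }).2 hS
  mono_f := hf
  epi_g := epi_kernel_lift_of_exact hg

lemma surjective_kernel_lift {S : ShortComplex (TopCat.Sheaf AddCommGrpCat.{u} X)}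
    {U : Opens X}
    (h : ∀ s, S.g.hom.app (op U) s = 0 → ∃ t, S.f.hom.app (op U) t = s) :
    Function.Surjective ((kernel.lift S.g S.f S.zero).hom.app (op U)) := by
  intro k
  obtain ⟨t, ht⟩ := h _ ((leftExact_kernel S.g).comp U k)
  exact ⟨t, (leftExact_kernel S.g).inj U ((comp_hom_app (kernel.lift_ι S.g S.f S.zero) t).trans ht)⟩

/-- The resolution is cut into short exact sequences of cocycle sheaves with flasque middle terms.
The induction moves from the cocycles in degree `m` to those in degree `m + 1`, which is why `K` and
`m` vary. -/
lemma std_exactAt_of_sections [Finite X] [T0Space X] (U : Opens X)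
    {K : TopCat.Sheaf AddCommGrpCat.{u} X}
    (I : CochainComplex (TopCat.Sheaf AddCommGrpCat.{u} X) ℕ) (hI : ∀ n, (I.X n).IsFlasque)
    (hex : ∀ n, (I.sc' n (n + 1) (n + 2)).Exact)
    (hU : ∀ n (s : (I.X (n + 1)).obj.obj (op U)), (I.d (n + 1) (n + 2)).hom.app (op U) s = 0 →
      ∃ t, (I.d n (n + 1)).hom.app (op U) t = s)
    (m : ℕ) (ι : K ⟶ I.X m) (hm : Mono ι) (w : ι ≫ I.d m (m + 1) = 0)
    (hι : (ShortComplex.mk ι (I.d m (m + 1)) w).Exact) (n : ℕ) :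
    (ChainCover.std U).ExactAt K.obj n := by
  induction n generalizing K m with
  | zero =>
    have hS := shortExact_kernel_lift hι hm (I.d (m + 1) (m + 2))
      (I.d_comp_d m (m + 1) (m + 2)) (hex m)
    exact (ChainCover.std_exactAt_zero_iff U hS (hI m)).2
      (surjective_kernel_lift (S := I.sc' m (m + 1) (m + 2)) (hU m))
  | succ n ih =>
    have hS := shortExact_kernel_lift hι hm (I.d (m + 1) (m + 2))
      (I.d_comp_d m (m + 1) (m + 2)) (hex m)
    refine (ChainCover.std_exactAt_succ_iff U hS (hI m) n).2 ?_
    exact ih (m + 1) (kernel.ι _) inferInstance (kernel.condition _) (ShortComplex.exact_kernel _)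

/-- If the higher direct images of an abelian sheaf vanish, then the sheaf is acyclic on the
preimages of the minimal open subsets. -/
lemma std_exactAt_of_isZero_rightDerived [Finite X] [T0Space X] {Y : TopCat.{u}} [Finite Y]
    (f : X ⟶ Y) (K : TopCat.Sheaf AddCommGrpCat.{u} X)
    (h : ∀ i : ℕ, 0 < i →
      IsZero (((TopCat.Sheaf.pushforward AddCommGrpCat.{u} f).rightDerived i).obj K))
    (y : Y) (n : ℕ) : (ChainCover.std ((Opens.map f).obj (minOpen y))).ExactAt K.obj n := by
  let I := injectiveResolution K
  have hI (n : ℕ) : (I.cocomplex.X n).IsFlasque := isFlasque_of_injective _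
  refine std_exactAt_of_sections _ I.cocomplex hI I.exact_succ ?_ 0 (I.ι.f 0)
    inferInstance I.ι_f_zero_comp_complex_d I.exact₀ n
  intro n s hs
  let F := TopCat.Sheaf.pushforward AddCommGrpCat.{u} f
  -- The cohomology sheaves of the direct image of the resolution are the higher direct images, so
  -- `J` is exact in positive degrees. Its sections over `U_y` are those of the resolution over the
  -- preimage.
  let J := (F.mapHomologicalComplex (ComplexShape.up ℕ)).obj I.cocomplex
  have h0 : IsZero (J.homology (n + 1)) :=
    (h (n + 1) n.succ_pos).of_iso (I.isoRightDerivedObj F (n + 1)).symm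
  have h1 : (J.sc' n (n + 1) (n + 2)).Exact :=
    (HomologicalComplex.exactAt_iff' _ n (n + 1) (n + 2) (by simp)
      (by simp only [CochainComplex.next]; rfl)).1 ((J.exactAt_iff_isZero_homology (n + 1)).2 h0)
  exact sections_exact_minOpen h1 y s hs

end DirectImage

/-! ### Exactness of complexes of modules -/

section Modules

open CategoryTheory.Limits

variable {X : RingedSpace.{u, u}}

/-- The action of a morphism of modules on sections. -/
def onSec {M N : OMod X} (φ : M ⟶ N) (U : Opens X.carrier) : Sec M U →ₗ[Scal X U] Sec N U :=
  (φ.val.app (op U)).hom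

lemma onSec_comp {M N P : OMod X} (φ : M ⟶ N) (ψ : N ⟶ P) (U : Opens X.carrier) (s : Sec M U) :
    onSec (φ ≫ ψ) U s = onSec ψ U (onSec φ U s) := rfl

lemma res_onSec {M N : OMod X} (φ : M ⟶ N) {U V : Opens X.carrier} (h : V ≤ U) (s : Sec M U) :
    res N h (onSec φ U s) = onSec φ V (res M h s) :=
  rs_app ((SheafOfModules.toSheaf (ringSheaf X)).map φ).hom h s

lemma hom_ext_sec {M N : OMod X} {φ ψ : M ⟶ N} (h : ∀ U (s : Sec M U), onSec φ U s = onSec ψ U s) :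
    φ = ψ := by
  apply SheafOfModules.hom_ext
  apply PresheafOfModules.hom_ext
  intro U
  ext s
  exact h U.unop s

lemma sec_ext [Finite X.carrier] (M : OMod X) {U : Opens X.carrier} {s t : Sec M U}
    (h : ∀ (x : X.carrier) (hx : x ∈ U), res M (minOpen_le hx) s = res M (minOpen_le hx) t) :
    s = t :=
  sheaf_ext (toAb M) h

lemma mono_of_injective_minOpen [Finite X.carrier] {M N : OMod X} (φ : M ⟶ N)
    (h : ∀ x, Function.Injective (onSec φ (minOpen x))) : Mono φ := by
  refine ⟨fun a b hab => hom_ext_sec fun U s => sec_ext _ fun x hx => ?_⟩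
  rw [res_onSec, res_onSec]
  apply h
  rw [← onSec_comp, ← onSec_comp, hab]

/-- Morphisms of sheaves are determined by their action on sections over minimal open sets, so
surjectivity there is enough. -/
lemma epi_of_surjective_minOpen [Finite X.carrier] {M N : OMod X} (φ : M ⟶ N)
    (h : ∀ x, Function.Surjective (onSec φ (minOpen x))) : Epi φ := by
  refine ⟨fun a b hab => hom_ext_sec fun U s => sec_ext _ fun x hx => ?_⟩
  rw [res_onSec, res_onSec]
  obtain ⟨t, ht⟩ := h x (res N (minOpen_le hx) s)
  rw [← ht, ← onSec_comp, ← onSec_comp, hab]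

lemma onSec_injective_of_mono {M N : OMod X} (φ : M ⟶ N) [Mono φ] (U : Opens X.carrier) :
    Function.Injective (onSec φ U) :=
  have : Mono φ.val := inferInstanceAs (Mono ((SheafOfModules.forget _).map φ))
  PresheafOfModules.injective_of_mono φ.val (op U)

lemma exact_of_sections [Finite X.carrier] (S : ShortComplex (OMod X))
    (h : ∀ x (s : Sec S.X₂ (minOpen x)), onSec S.g _ s = 0 → ∃ t, onSec S.f _ t = s) :
    S.Exact := by
  rw [ShortComplex.exact_iff_epi_kernel_lift]
  refine epi_of_surjective_minOpen _ fun x k => ?_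
  obtain ⟨t, ht⟩ := h x (onSec (kernel.ι S.g) _ k) (by
    rw [← onSec_comp, kernel.condition]
    rfl)
  refine ⟨t, onSec_injective_of_mono (kernel.ι S.g) _ ?_⟩
  rw [← onSec_comp, kernel.lift_ι, ht]

lemma isResolution_of_sections [Finite X.carrier] {M : OMod X} (K : ℕ → OMod X)
    (d : ∀ n, K n ⟶ K (n + 1)) (hd : ∀ n, d n ≫ d (n + 1) = 0) (ε : M ⟶ K 0)
    (hε : ∀ x, Function.Injective (onSec ε (minOpen x)))
    (h₀ : ∀ x s, onSec (d 0) (minOpen x) (onSec ε (minOpen x) s) = 0)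
    (h₁ : ∀ x (s : Sec (K 0) (minOpen x)), onSec (d 0) _ s = 0 → ∃ t, onSec ε _ t = s)
    (h₂ : ∀ n x (s : Sec (K (n + 1)) (minOpen x)), onSec (d (n + 1)) _ s = 0 →
      ∃ t, onSec (d n) _ t = s) :
    IsResolution (K := CochainComplex.of K d hd) (M := M) ε := by
  have e (n : ℕ) : (CochainComplex.of K d hd).d n (n + 1) = d n := CochainComplex.of_d K d n
  have w : ε ≫ (CochainComplex.of K d hd).d 0 1 = 0 := by
    refine (congrArg (ε ≫ ·) (e 0)).trans (hom_ext_sec fun U s => sec_ext _ fun x hx => ?_)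
    rw [res_onSec, onSec_comp, h₀]
    exact (map_zero (res _ _)).symm
  have e' (n : ℕ) (x : X.carrier) (s : Sec (K n) (minOpen x)) :
      onSec ((CochainComplex.of K d hd).d n (n + 1)) (minOpen x) s = onSec (d n) (minOpen x) s :=
    congrArg (fun f : K n ⟶ K (n + 1) => onSec f (minOpen x) s) (e n)
  exact
  { mono := mono_of_injective_minOpen ε hε
    zero := w
    exact_zero := exact_of_sections _ fun x s hs => h₁ x s ((e' 0 x s).symm.trans hs)
    exact_succ := fun i => by
      rw [HomologicalComplex.exactAt_iff' _ i (i + 1) (i + 2) (by simp)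
        (by simp only [CochainComplex.next]; rfl)]
      refine exact_of_sections _ fun x s hs => ?_
      obtain ⟨t, ht⟩ := h₂ i x s ((e' (i + 1) x s).symm.trans hs)
      exact ⟨t, (e' i x t).trans ht⟩ }

end Modules

/-! ### The standard complex is a flasque resolution -/

section Standard

open CategoryTheory.Limits

variable {X : RingedSpace.{u, u}} [Finite X.carrier] (M : OMod X) (n : ℕ)

lemma isFlasque_stdObj : IsFlasque (stdObj M n) := by
  classical
  refine isFlasque_of_surjective _ fun {U V} i s => ?_
  refine ⟨(fun c => if h : c.1.pt 0 ∈ V then (s : StdSec M n V) ⟨c.1, h⟩ else 0 : StdSec M n U), ?_⟩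
  exact funext fun c => dif_pos c.2

lemma isResolution_stdAug [T0Space X.carrier] :
    IsResolution (K := stdComplex M) (stdAug M) :=
  isResolution_of_sections (stdObj M) (stdD M) (stdD_comp M) (stdAug M)
    (fun x => (ChainCover.std (minOpen x)).aug_injective (toAb M))
    (fun x => (ChainCover.std (minOpen x)).d_aug (F := (toAb M).obj))
    (fun x => (ChainCover.std (minOpen x)).exists_aug_eq (toAb M))
    (fun n x => ChainCover.std_minOpen_exactAt x n (toAb M))

lemma isZero_stdObj (h : IsEmpty (Chain X.carrier n)) : IsZero (stdObj M n) := by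
  rw [IsZero.iff_id_eq_zero]
  exact hom_ext_sec fun U s => funext fun c => (h.false c.1).elim

lemma Chain.pt_injective {Y : TopCat.{u}} {n : ℕ} (c : Chain Y n) : Function.Injective c.pt := by
  intro i j h
  by_contra hij
  rcases lt_or_gt_of_ne hij with hij | hij
  · exact (c.lt hij).2 (h ▸ specializes_rfl)
  · exact (c.lt hij).2 (h ▸ specializes_rfl)

lemma isEmpty_chain_of_card_le {Y : TopCat.{u}} [Finite Y] {n : ℕ} (h : Nat.card Y ≤ n) :
    IsEmpty (Chain Y n) := by
  refine ⟨fun c => ?_⟩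
  have := Nat.card_le_card_of_injective _ c.pt_injective
  rw [Nat.card_fin] at this
  omega

/-- The closures of the points of a chain form a strictly increasing chain of irreducible closed
sets. -/
lemma le_topologicalKrullDim {Y : TopCat.{u}} {n : ℕ} (c : Chain Y n) :
    n ≤ topologicalKrullDim Y := by
  let F : Fin (n + 1) → IrreducibleCloseds Y := fun i =>
    ⟨closure {c.pt i}, isIrreducible_singleton.closure, isClosed_closure⟩
  have hF : StrictMono F := by
    intro i j hij
    obtain ⟨h, h'⟩ := c.lt hij
    refine lt_of_le_not_ge (specializes_iff_closure_subset.1 h) fun h'' => h' ?_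
    exact specializes_iff_closure_subset.2 h''
  exact Order.le_krullDim_iff.2 ⟨LTSeries.mk n F hF, rfl⟩

end Standard

/-! ### Sections of sheaves of modules over local objects of a site -/

section Site

open CategoryTheory.Limits

universe w' w v₁ u₁

variable {C : Type u₁} [Category.{v₁} C] {J : GrothendieckTopology C}

/-- An object is local if it has no covering sieves but the maximal one. -/
def IsLocalObj (J : GrothendieckTopology C) (W : C) : Prop := ∀ S ∈ J W, S = ⊤

/-- The sieve on which two sections with the same image agree is covering, hence contains the
identity of `W`. -/
lemma IsLocalObj.injective {W : C} (hW : IsLocalObj J W) {F G : Cᵒᵖ ⥤ AddCommGrpCat.{u}}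
    (φ : F ⟶ G)
    [Presheaf.IsLocallyInjective J φ] : Function.Injective (φ.app (op W)) := by
  intro s t h
  have := hW _ (Presheaf.equalizerSieve_mem J φ s t h)
  have h1 : (Presheaf.equalizerSieve s t).arrows (𝟙 W) := by rw [this]; trivial
  simpa [Presheaf.equalizerSieve_apply] using h1

lemma IsLocalObj.surjective {W : C} (hW : IsLocalObj J W) {F G : Cᵒᵖ ⥤ AddCommGrpCat.{u}}
    (φ : F ⟶ G)
    [Presheaf.IsLocallySurjective J φ] : Function.Surjective (φ.app (op W)) := by
  intro s
  have := hW _ (Presheaf.imageSieve_mem J φ s)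
  have h1 : (Presheaf.imageSieve φ s).arrows (𝟙 W) := by rw [this]; trivial
  obtain ⟨t, ht⟩ := h1
  exact ⟨t, by simpa using ht⟩

variable {R : Sheaf J RingCat.{u}}

/-- The value of a global section. -/
def secAt {M : SheafOfModules.{u} R} (s : M.sections) (W : C) : M.val.obj (op W) := s.val (op W)

lemma secAt_map {M : SheafOfModules.{u} R} (s : M.sections) {W W' : C} (f : W' ⟶ W) :
    M.val.restrictₛₗ f.op (secAt s W) = secAt s W' := s.property f.op

lemma map_secAt {M N : SheafOfModules.{u} R} (φ : M ⟶ N) (s : M.sections) (W : C) :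
    (φ.val.app (op W)).hom (secAt s W) = secAt (SheafOfModules.sectionsMap φ s) W := rfl

lemma restrict_linearCombination (M : SheafOfModules.{u} R) {I : Type*} {W W' : C} (f : W' ⟶ W)
    (s : I → M.val.obj (op W)) (a : I →₀ R.obj.obj (op W)) :
    M.val.restrictₛₗ f.op (Finsupp.linearCombination _ s a) =
      Finsupp.linearCombination _ (fun i => M.val.restrictₛₗ f.op (s i))
        (a.mapRange (R.obj.map f.op).hom (map_zero _)) := by
  induction a using Finsupp.induction_linear with
  | zero => simp only [Finsupp.mapRange_zero, map_zero]
  | add a b ha hb => rw [Finsupp.mapRange_add (map_add _), map_add, map_add, ha, hb, map_add]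
  | single i a =>
    rw [Finsupp.mapRange_single, Finsupp.linearCombination_single,
      Finsupp.linearCombination_single, map_smulₛₗ]

variable [HasSheafify J AddCommGrpCat.{u}] [J.WEqualsLocallyBijective AddCommGrpCat.{u}]

/-- The unit of sheafification is locally bijective, so it is bijective on a local object. -/
lemma IsLocalObj.isIso_eval_unit {W : C} (hW : IsLocalObj J W) (P : PresheafOfModules.{u} R.obj) :
   IsIso ((PresheafOfModules.evaluation R.obj (op W)).map
    ((PresheafOfModules.sheafificationAdjunction (𝟙 R.obj)).unit.app P)) := by
  have : IsIso ((forget (ModuleCat (R.obj.obj (op W)))).map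
      ((PresheafOfModules.evaluation R.obj (op W)).map
    ((PresheafOfModules.sheafificationAdjunction (𝟙 R.obj)).unit.app P))) := by
    rw [CategoryTheory.isIso_iff_bijective]
    exact ⟨hW.injective (toSheafify J P.presheaf), hW.surjective (toSheafify J P.presheaf)⟩
  exact isIso_of_reflects_iso _ (forget _)

/-- Colimits of sheaves are sheafifications of presheaf colimits, which are computed objectwise, and
sheafification changes nothing at `W`. Consequently free sheaves are free at `W` and epimorphisms
are surjective there. -/
lemma IsLocalObj.preservesColimitsOfShape_evaluation {W : C} (hW : IsLocalObj J W) (K : Type w)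
    [Category.{w'} K] [HasColimitsOfShape K AddCommGrpCat.{u}] :
    PreservesColimitsOfShape K (SheafOfModules.evaluation.{u} R (op W)) where
  preservesColimit {F} := by
    let e : F ≅ (F ⋙ SheafOfModules.forget R) ⋙ PresheafOfModules.sheafification (𝟙 R.obj) :=
      Functor.isoWhiskerLeft F
        (asIso (PresheafOfModules.sheafificationAdjunction (𝟙 R.obj)).counit).symm
    suffices PreservesColimit ((F ⋙ SheafOfModules.forget R) ⋙
      PresheafOfModules.sheafification (𝟙 R.obj)) (SheafOfModules.evaluation.{u} R (op W)) from
      preservesColimit_of_iso_diagram _ e.symm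
    let ev : PresheafOfModules.evaluation R.obj (op W) ⟶
        PresheafOfModules.sheafification (𝟙 R.obj) ⋙ SheafOfModules.evaluation.{u} R (op W) :=
     { app P := (PresheafOfModules.evaluation R.obj (op W)).map
         ((PresheafOfModules.sheafificationAdjunction (𝟙 R.obj)).unit.app P)
       naturality P Q f := by
         have := (PresheafOfModules.sheafificationAdjunction (𝟙 R.obj)).unit.naturality f
         exact congrArg (PresheafOfModules.evaluation R.obj (op W)).map this }
    have : ∀ P, IsIso (ev.app P) := fun P => hW.isIso_eval_unit P
    have : IsIso ev := NatIso.isIso_of_isIso_app ev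
    refine preservesColimit_of_preserves_colimit_cocone
      (isColimitOfPreserves (PresheafOfModules.sheafification (𝟙 R.obj))
        (colimit.isColimit (F ⋙ SheafOfModules.forget R))) ?_
    have := isColimitOfPreserves (PresheafOfModules.evaluation R.obj (op W))
      (colimit.isColimit (F ⋙ SheafOfModules.forget R))
    have := (IsColimit.mapCoconeEquiv (asIso ev) this)
    exact this

lemma linearCombination_bijective_of_isColimit {A : Type u} [Ring A] {I : Type u}
    {P : ModuleCat.{u} A}
    (e : I → (ModuleCat.of A A ⟶ P)) (hc : IsColimit (Cofan.mk P e)) :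
    Function.Bijective (Finsupp.linearCombination A (fun i => (e i).hom 1)) := by
  let L : ModuleCat.of A (I →₀ A) ⟶ P :=
    ModuleCat.ofHom (Finsupp.linearCombination A (fun i => (e i).hom 1))
  let D : P ⟶ ModuleCat.of A (I →₀ A) :=
    Cofan.IsColimit.desc hc (fun i => ModuleCat.ofHom (Finsupp.lsingle i))
  have hL (i : I) : ModuleCat.ofHom (Finsupp.lsingle i) ≫ L = e i := by
    ext
    simp [L]
  have hD (i : I) : e i ≫ D = ModuleCat.ofHom (Finsupp.lsingle i) := Cofan.IsColimit.fac hc _ i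
  have h1 : D ≫ L = 𝟙 _ := by
    refine Cofan.IsColimit.hom_ext hc _ _ fun i => ?_
    exact (Category.assoc _ _ _).symm.trans ((congrArg (· ≫ L) (hD i)).trans
      ((hL i).trans (Category.comp_id _).symm))
  have h2 : L ≫ D = 𝟙 _ := by
    apply ModuleCat.hom_ext
    refine Finsupp.lhom_ext' fun i => ?_
    exact congrArg ModuleCat.Hom.hom ((Category.assoc _ L D).symm.trans
      ((congrArg (· ≫ D) (hL i)).trans (hD i)))
  have : IsIso L := ⟨D, h2, h1⟩
  exact (CategoryTheory.isIso_iff_bijective ((forget (ModuleCat A)).map L)).1 inferInstance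

lemma IsLocalObj.linearCombination_bijective {W : C} (hW : IsLocalObj J W) (I : Type u) :
    Function.Bijective (Finsupp.linearCombination (R.obj.obj (op W))
      (fun i : I => secAt (SheafOfModules.freeSection (R := R) i) W)) := by
  have := hW.preservesColimitsOfShape_evaluation (R := R) (Discrete I)
  exact linearCombination_bijective_of_isColimit _
    (isColimitCofanMkObjOfIsColimit (SheafOfModules.evaluation.{u} R (op W)) _ _
      (SheafOfModules.isColimitFreeCofan (R := R) I))

lemma IsLocalObj.surjective_of_epi {W : C} (hW : IsLocalObj J W) {M N : SheafOfModules.{u} R}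
    (φ : M ⟶ N) [Epi φ] : Function.Surjective (φ.val.app (op W)) := by
  have := hW.preservesColimitsOfShape_evaluation (R := R) WalkingSpan
  have : Epi ((SheafOfModules.evaluation.{u} R (op W)).map φ) := inferInstance
  exact (ModuleCat.epi_iff_surjective _).1 this
lemma map_linearCombination_freeSection {M : SheafOfModules.{u} R} {I : Type u} (s : I → M.sections)
    (W : C) (a : I →₀ R.obj.obj (op W)) :
    ((M.freeHomEquiv.symm s).val.app (op W)).hom
      (Finsupp.linearCombination _ (fun i => secAt (SheafOfModules.freeSection (R := R) i) W) a) =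
    Finsupp.linearCombination _ (fun i => secAt (s i) W) a := by
  rw [Finsupp.apply_linearCombination]
  congr 2
  ext i
  exact (map_secAt _ _ W).trans (congrArg (fun t => secAt t W)
    (SheafOfModules.sectionsMap_freeHomEquiv_symm_freeSection s i))

lemma exists_kernel_eq {M N : SheafOfModules.{u} R} (φ : M ⟶ N) (W : C) {x : M.val.obj (op W)}
    (hx : (φ.val.app (op W)).hom x = 0) :
    ∃ t, ((kernel.ι φ).val.app (op W)).hom t = x := by
  have hk : IsLimit ((KernelFork.ofι _ (kernel.condition φ)).map
    (SheafOfModules.evaluation R (op W))) := KernelFork.mapIsLimit _ (kernelIsKernel _) _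
  exact (ShortComplex.moduleCat_exact_iff _).1 (ShortComplex.exact_of_f_is_kernel
    (ShortComplex.mk ((SheafOfModules.evaluation R (op W)).map (kernel.ι φ))
      ((SheafOfModules.evaluation R (op W)).map φ)
      (((SheafOfModules.evaluation R (op W)).map_comp _ _).symm.trans
        ((congrArg _ (kernel.condition φ)).trans (Functor.map_zero _ _ _)))) hk) _ hx

/-- The generators and relations of a presentation are global sections, so the ones at `W` restrict
to those at `W'`. Evaluation at local objects keeps the presentation exact, so the same data present
the values at both. -/
lemma exists_relations {M : SheafOfModules.{u} R} (P : M.Presentation) {W W' : C} (f : W' ⟶ W)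
    (hW : IsLocalObj J W) (hW' : IsLocalObj J W') :
    ∃ (I K : Type u) (s : I → M.val.obj (op W)) (ρ : K → I →₀ R.obj.obj (op W)),
      (∀ k, Finsupp.linearCombination _ s (ρ k) = 0) ∧
      Function.Surjective (Finsupp.linearCombination (R.obj.obj (op W)) s) ∧
      Function.Surjective (Finsupp.linearCombination (R.obj.obj (op W'))
        (fun i => M.val.restrictₛₗ f.op (s i))) ∧
      ∀ a, Finsupp.linearCombination (R.obj.obj (op W'))
        (fun i => M.val.restrictₛₗ f.op (s i)) a = 0 →
        a ∈ Submodule.span (R.obj.obj (op W'))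
          (Set.range fun k => (ρ k).mapRange (R.obj.map f.op).hom (map_zero _)) := by
  let F := SheafOfModules.free (R := R) P.generators.I
  let e (W : C) (i : P.generators.I) : F.val.obj (op W) :=
    secAt (SheafOfModules.freeSection (R := R) i) W
  let s (W : C) (i : P.generators.I) : M.val.obj (op W) := secAt (P.generators.s i) W
  let r (k : P.relations.I) : F.sections :=
    SheafOfModules.sectionsMap (kernel.ι P.generators.π) (P.relations.s k)
  have hb (W : C) (hW : IsLocalObj J W) : Function.Bijective
      (Finsupp.linearCombination (R.obj.obj (op W)) (e W)) := hW.linearCombination_bijective _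
  have hπ (W : C) (a) : (P.generators.π.val.app (op W)).hom (Finsupp.linearCombination _ (e W) a) =
    Finsupp.linearCombination _ (s W) a := map_linearCombination_freeSection _ W a
  have hs (W : C) (hW : IsLocalObj J W) : Function.Surjective
      (Finsupp.linearCombination (R.obj.obj (op W)) (s W)) := by
    intro m
    obtain ⟨t, rfl⟩ := hW.surjective_of_epi P.generators.π m
    obtain ⟨a, rfl⟩ := (hb W hW).2 t
    exact ⟨a, (hπ W a).symm⟩
  have hres : (fun i => M.val.restrictₛₗ f.op (s W i)) = s W' :=
    funext fun i => secAt_map (P.generators.s i) f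
  have hrese : (fun i => F.val.restrictₛₗ f.op (e W i)) = e W' :=
    funext fun i => secAt_map _ f
  have hr (W : C) (k) : (P.generators.π.val.app (op W)).hom (secAt (r k) W) = 0 := by
    have := congrArg (fun φ : kernel P.generators.π ⟶ M =>
      (φ.val.app (op W)).hom (secAt (P.relations.s k) W)) (kernel.condition P.generators.π)
    exact this
  choose ρ hρ using fun k => (hb W hW).2 (secAt (r k) W)
  refine ⟨P.generators.I, P.relations.I, s W, ρ, fun k => ?_, hs W hW, ?_, ?_⟩
  · rw [← hπ, hρ, hr]
  · rw [hres]
    exact hs W' hW'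
  · rw [hres]
    intro a ha
    rw [← hπ] at ha
    have hρ' (k) : Finsupp.linearCombination _ (e W')
        ((ρ k).mapRange (R.obj.map f.op).hom (map_zero _)) = secAt (r k) W' := by
      rw [← hrese, ← restrict_linearCombination, hρ, secAt_map]
    obtain ⟨t, ht⟩ := exists_kernel_eq P.generators.π W' ha
    -- The kernel is covered by the free sheaf on the relations; coordinates there are the
    -- coefficients `b`.
    obtain ⟨t, rfl⟩ := hW'.surjective_of_epi P.relations.π t
    obtain ⟨b, rfl⟩ := (hW'.linearCombination_bijective _).2 t
    have h1 : Finsupp.linearCombination _ (e W') (Finsupp.linearCombination _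
        (fun k => (ρ k).mapRange (R.obj.map f.op).hom (map_zero _)) b) =
          Finsupp.linearCombination _ (e W') a := by
      rw [Finsupp.apply_linearCombination]
      refine Eq.trans ?_ ht
      refine Eq.trans ?_ (congrArg ((kernel.ι P.generators.π).val.app (op W')).hom
        (map_linearCombination_freeSection P.relations.s W' b)).symm
      rw [Finsupp.apply_linearCombination]
      exact congrArg (fun v => Finsupp.linearCombination _ v b) (funext hρ')
    rw [← (hb W' hW').1 h1]
    exact (Finsupp.range_linearCombination _).le ⟨b, rfl⟩

end Site

/-! ### Local presentations over minimal open sets of a ringed space -/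

section

variable {X : RingedSpace.{u, u}} [Finite X.carrier]

/-- A member of a cover of `U_p` that contains `p` contains all of `U_p`. -/
lemma isLocalObj_over {U : Opens X.carrier} {p : X.carrier} (h : minOpen p ≤ U) :
    IsLocalObj ((Opens.grothendieckTopology X.carrier).over U) (Over.mk (homOfLE h)) := by
  intro S hS
  rw [GrothendieckTopology.mem_over_iff] at hS
  obtain ⟨V, f, hf, hV⟩ := hS p (mem_minOpen.2 specializes_rfl)
  have hf' := (Sieve.overEquiv_iff S f).1 hf
  rw [← Sieve.id_mem_iff_eq_top]
  let g : Over.mk (homOfLE h) ⟶ Over.mk (f ≫ homOfLE h) := Over.homMk (homOfLE (minOpen_le hV))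
  exact S.downward_closed hf' g

lemma exists_relations_minOpen (M : OMod X) [M.IsQuasicoherent] {p q : X.carrier} (h : q ⤳ p) :
    ∃ (I K : Type u) (s : I → Sec M (minOpen p)) (ρ : K → I →₀ Scal X (minOpen p)),
      (∀ k, Finsupp.linearCombination _ s (ρ k) = 0) ∧
      Function.Surjective (Finsupp.linearCombination (Scal X (minOpen p)) s) ∧
      Function.Surjective (Finsupp.linearCombination (Scal X (minOpen q))
        (fun i => res M (minOpen_mono h) (s i))) ∧
      ∀ a, Finsupp.linearCombination (Scal X (minOpen q))
          (fun i => res M (minOpen_mono h) (s i)) a = 0 →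
        a ∈ Submodule.span (Scal X (minOpen q))
          (Set.range fun k => (ρ k).mapRange (resS (X := X) (minOpen_mono h)) (map_zero _)) := by
  obtain ⟨Q⟩ := (inferInstance : M.IsQuasicoherent).nonempty_quasicoherentData
  obtain ⟨V, f, ⟨i, ⟨g⟩⟩, hV⟩ := Q.coversTop ⊤ p trivial
  have hp : minOpen p ≤ Q.X i := (minOpen_le hV).trans g.le
  exact exists_relations (Q.presentation i)
    (Over.homMk (homOfLE (minOpen_mono h)) : Over.mk (homOfLE ((minOpen_mono h).trans hp)) ⟶
      Over.mk (homOfLE hp)) (isLocalObj_over hp) (isLocalObj_over _)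

end

/-! ### Base change of modules along ring homomorphisms -/

section BaseChange

open TensorProduct

variable {A B C : Type*} [CommRing A] [CommRing B] [CommRing C]

/-- A module over the target of a ring homomorphism, as a module over its source. -/
abbrev toLinear (φ : A →+* B) {M N : Type*} [AddCommGroup M] [AddCommGroup N] [Module A M]
    [Module B N] (f : M →+ N) (hf : ∀ a m, f (a • m) = φ a • f m) :
    letI := Module.compHom N φ
    M →ₗ[A] N :=
  letI := Module.compHom N φ
  { f with map_smul' := hf }

/-- The map `f` exhibits `N` as the base change of `M` along `φ`. -/
structure IsBC (φ : A →+* B) {M N : Type*} [AddCommGroup M] [AddCommGroup N] [Module A M]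
    [Module B N] (f : M →+ N) : Prop where
  map_smul : ∀ a m, f (a • m) = φ a • f m
  isBaseChange :
    letI : Algebra A B := φ.toAlgebra
    letI : Module A N := Module.compHom N φ
    haveI : IsScalarTower A B N := .of_algebraMap_smul fun _ _ => rfl
    IsBaseChange B (toLinear φ f map_smul)

/-- `IsBC` builds its algebra and module structures from `φ`; any other compatible structures
coincide with these. -/
lemma isBC_iff {φ : A →+* B} {M N : Type*} [AddCommGroup M] [AddCommGroup N] [Module A M]
    [Module B N] [i : Algebra A B] [j : Module A N] [IsScalarTower A B N]
    (hφ : algebraMap A B = φ) (f : M →ₗ[A] N) :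
    IsBC φ f.toAddMonoidHom ↔ IsBaseChange B f := by
  have h2 : j = Module.compHom N φ := Module.ext' _ _ fun a n =>
    (algebraMap_smul B a n).symm.trans (congrArg (· • n) (RingHom.congr_fun hφ a))
  have h1 : i = φ.toAlgebra := Algebra.algebra_ext _ _ fun a => RingHom.congr_fun hφ a
  subst h1
  subst h2
  let := Module.compHom N φ
  exact ⟨fun h => h.isBaseChange, fun h => ⟨fun a m => LinearMap.map_smul f a m, h⟩⟩

lemma isBC_iff' {φ : A →+* B} {M N : Type*} [AddCommGroup M] [AddCommGroup N] [Module A M]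
    [Module B N] [Algebra A B] [Module A N] [IsScalarTower A B N]
    (hφ : algebraMap A B = φ) {f : M →+ N} {g : M →ₗ[A] N} (h : ∀ m, g m = f m) :
    IsBC φ f ↔ IsBaseChange B g := by
  have : f = g.toAddMonoidHom := AddMonoidHom.ext fun m => (h m).symm
  subst this
  exact isBC_iff hφ g

namespace IsBC

variable {φ : A →+* B} {ψ : B →+* C} {M N P : Type*} [AddCommGroup M] [AddCommGroup N]
  [AddCommGroup P] [Module A M] [Module B N] [Module C P] {f : M →+ N} {g : N →+ P}

lemma of_comp (hf : IsBC φ f) (hg : ∀ b n, g (b • n) = ψ b • g n)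
    (h : IsBC (ψ.comp φ) (g.comp f)) : IsBC ψ g := by
  let : Algebra _ _ := φ.toAlgebra
  let := ψ.toAlgebra
  let := (ψ.comp φ).toAlgebra
  let : Module A N := Module.compHom N φ
  let := Module.compHom P ψ
  let := Module.compHom P (ψ.comp φ)
  have : IsScalarTower A B N := .of_algebraMap_smul fun _ _ => rfl
  have : IsScalarTower B C P := .of_algebraMap_smul fun _ _ => rfl
  have : IsScalarTower A C P := .of_algebraMap_smul fun _ _ => rfl
  have : IsScalarTower A B P := .of_algebraMap_smul fun _ _ => rfl
  have : IsScalarTower A B C := .of_algebraMap_eq fun _ => rfl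
  exact ⟨hg, IsBaseChange.of_comp (h := toLinear ψ g hg) hf.isBaseChange h.isBaseChange⟩

lemma pi {ι : Type*} [Finite ι] {M N : ι → Type*} [∀ i, AddCommGroup (M i)]
    [∀ i, AddCommGroup (N i)] [∀ i, Module A (M i)] [∀ i, Module B (N i)] (f : ∀ i, M i →+ N i)
    (hf : ∀ i, IsBC φ (f i)) {F : (∀ i, M i) →+ (∀ i, N i)} (hF : ∀ m i, F m i = f i (m i)) :
    IsBC φ F := by
  let : Algebra _ _ := φ.toAlgebra
  let (i : ι) : Module A (N i) := Module.compHom (N i) φ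
  have (i : ι) : IsScalarTower A B (N i) := .of_algebraMap_smul fun _ _ => rfl
  exact (isBC_iff' rfl fun m => funext fun i => (hF m i).symm).2
    (IsBaseChange.pi _ fun i => (hf i).isBaseChange)

/-- Base change along a pushout of rings. -/
lemma of_pushout {B' : Type*} [CommRing B'] {A' : Type*} [CommRing A'] {φ : A →+* A'}
    {α : A →+* B} {α' : A' →+* B'} {β : B →+* B'} (hα : β.comp α = α'.comp φ)
    (h : letI := Module.compHom B α; letI := Module.compHom B' α'; IsBC φ β.toAddMonoidHom)
    {M N : Type*} [AddCommGroup M] [AddCommGroup N] [Module B M] [Module B' N] {f : M →+ N}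
    (hf : IsBC β f) :
    letI := Module.compHom M α; letI := Module.compHom N α'; IsBC φ f := by
  let := φ.toAlgebra
  let := α.toAlgebra
  let := α'.toAlgebra
  let := β.toAlgebra
  let := (β.comp α).toAlgebra
  let := Module.compHom M α
  let := Module.compHom N α'
  let := Module.compHom N (β.comp α)
  let := Module.compHom N β
  have : IsScalarTower A B M := .of_algebraMap_smul fun _ _ => rfl
  have : IsScalarTower A B N := .of_algebraMap_smul fun _ _ => rfl
  have : IsScalarTower A' B' N := .of_algebraMap_smul fun _ _ => rfl
  have : IsScalarTower A A' N := .of_algebraMap_smul fun a n =>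
    congrArg (· • n) (RingHom.congr_fun hα a).symm
  have : IsScalarTower B B' N := .of_algebraMap_smul fun _ _ => rfl
  have : IsScalarTower A B B' := .of_algebraMap_eq fun _ => rfl
  have : IsScalarTower A A' B' := .of_algebraMap_eq fun a => RingHom.congr_fun hα a
  have hp : Algebra.IsPushout A A' B B' :=
    ⟨(isBC_iff' (f := β.toAddMonoidHom) rfl fun _ => rfl).1 h⟩
  refine (isBC_iff' (g := (toLinear β f hf.map_smul).restrictScalars A) rfl fun _ => rfl).2 ?_
  -- As `B' = A' ⊗[A] B`, one has `A' ⊗[A] M = B' ⊗[B] M`.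
  exact IsBaseChange.of_equiv ((Algebra.IsPushout.cancelBaseChange A A' B B' M).symm ≪≫ₗ
    hf.isBaseChange.equiv.restrictScalars A') fun m => by
      rw [LinearEquiv.trans_apply, Algebra.IsPushout.cancelBaseChange_symm_tmul, map_one]
      exact (hf.isBaseChange.equiv_tmul 1 m).trans (one_smul _ _)

/-- `B ⊗ M` is generated by the `1 ⊗ s i`, and the images of the relations `ρ` vanish in it. Since
they span all relations in `N`, the map from `B ⊗ M` to `N` is injective. -/
lemma of_relations {I K : Type*} (hφ : ∀ a m, f (a • m) = φ a • f m) (s : I → M) (ρ : K → I →₀ A)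
    (h₀ : ∀ k, Finsupp.linearCombination A s (ρ k) = 0)
    (h₁ : Function.Surjective (Finsupp.linearCombination A s))
    (h₂ : Function.Surjective (Finsupp.linearCombination B (fun i => f (s i))))
    (h₃ : ∀ a, Finsupp.linearCombination B (fun i => f (s i)) a = 0 →
      a ∈ Submodule.span B (Set.range fun k => (ρ k).mapRange φ (map_zero _))) :
    IsBC φ f := by
  refine ⟨hφ, ?_⟩
  let := φ.toAlgebra
  let : Module A N := Module.compHom N φ
  have : IsScalarTower A B N := .of_algebraMap_smul fun _ _ => rfl
  let L : B ⊗[A] M →ₗ[B] N := (toLinear φ f hφ).liftBaseChange B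
  let p : (I →₀ B) →ₗ[B] B ⊗[A] M := Finsupp.linearCombination B (fun i => 1 ⊗ₜ s i)
  have hp' (a : I →₀ A) : p (a.mapRange φ (map_zero _)) =
      1 ⊗ₜ Finsupp.linearCombination A s a := by
    induction a using Finsupp.induction_linear with
    | zero => simp
    | add a b ha hb => rw [Finsupp.mapRange_add (map_add _), map_add, map_add, ha, hb, tmul_add]
    | single i a =>
      rw [Finsupp.mapRange_single, Finsupp.linearCombination_single,
        Finsupp.linearCombination_single, ← TensorProduct.smul_tmul]
      exact smul_tmul' (φ a) (1 : B) (s i)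
  have hp : Function.Surjective p := by
    intro x
    rw [← LinearMap.mem_range]
    induction x using TensorProduct.induction_on with
    | zero => exact zero_mem _
    | add x y hx hy => exact add_mem hx hy
    | tmul b m =>
      obtain ⟨a, rfl⟩ := h₁ m
      rw [← mul_one b, ← smul_eq_mul, ← smul_tmul', ← hp']
      exact Submodule.smul_mem _ _ ⟨_, rfl⟩
  have hL (a) : L (p a) = Finsupp.linearCombination B (fun i => f (s i)) a := by
    refine (Finsupp.apply_linearCombination B L _ a).trans ?_
    congr 2
    ext i
    exact (LinearMap.liftBaseChange_tmul _ _ _ _).trans (one_smul _ _)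
  have hinj : Function.Injective L := by
    rw [injective_iff_map_eq_zero]
    intro x hx
    obtain ⟨a, rfl⟩ := hp x
    rw [hL] at hx
    have := h₃ a hx
    change a ∈ LinearMap.ker p
    refine Submodule.span_le.2 ?_ this
    rintro _ ⟨k, rfl⟩
    change p _ = 0
    rw [hp', h₀, tmul_zero]
  have hsurj : Function.Surjective L := fun n => by
    obtain ⟨a, rfl⟩ := h₂ n
    exact ⟨p a, hL a⟩
  exact IsBaseChange.of_equiv (LinearEquiv.ofBijective L ⟨hinj, hsurj⟩) fun m =>
    (LinearMap.liftBaseChange_tmul _ _ _ _).trans (one_smul _ _)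

/-- Right exactness of base change, from the universal property: `M` maps to the quotient of `I →₀
B` by the span of the relations, this map extends to `N`, and it sends the vanishing combination to
the class of `a`. -/
lemma mem_span_relations (hf : IsBC φ f) {I : Type*} (s : I → M)
    (h₁ : Function.Surjective (Finsupp.linearCombination A s)) (a : I →₀ B)
    (ha : Finsupp.linearCombination B (fun i => f (s i)) a = 0) :
    a ∈ Submodule.span B (Set.range fun k : LinearMap.ker (Finsupp.linearCombination A s) =>
      k.1.mapRange φ (map_zero _)) := by
  let := φ.toAlgebra
  let : Module A N := Module.compHom N φ
  have : IsScalarTower A B N := .of_algebraMap_smul fun _ _ => rfl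
  set S := Submodule.span B (Set.range fun k : LinearMap.ker (Finsupp.linearCombination A s) =>
      k.1.mapRange φ (map_zero _)) with hS
  let G : (I →₀ A) →ₗ[A] ((I →₀ B) ⧸ S) :=
    (S.mkQ.restrictScalars A).comp (Finsupp.mapRange.linearMap (Algebra.linearMap A B))
  have hG : LinearMap.ker (Finsupp.linearCombination A s) ≤ LinearMap.ker G := fun x hx =>
    (Submodule.Quotient.mk_eq_zero S).2 (Submodule.subset_span ⟨⟨x, hx⟩, rfl⟩)
  let g : M →ₗ[A] ((I →₀ B) ⧸ S) := ((LinearMap.ker _).liftQ G hG).comp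
    ((Finsupp.linearCombination A s).quotKerEquivOfSurjective h₁).symm.toLinearMap
  have hg (i : I) : g (s i) = S.mkQ (Finsupp.single i 1) := by
    have : ((Finsupp.linearCombination A s).quotKerEquivOfSurjective h₁).symm (s i) =
        Submodule.Quotient.mk (Finsupp.single i 1) := by
      rw [LinearEquiv.symm_apply_eq]
      simp
    simp only [g, LinearMap.comp_apply, LinearEquiv.coe_coe, this]
    simp [G]
  let l := hf.isBaseChange.lift g
  have hl (i : I) : l (f (s i)) = S.mkQ (Finsupp.single i 1) :=
    (hf.isBaseChange.lift_eq g (s i)).trans (hg i)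
  have key : S.mkQ a = 0 := by
    rw [← map_zero l, ← ha, Finsupp.apply_linearCombination, show l ∘ (fun i => f (s i)) =
      S.mkQ ∘ fun i => Finsupp.single i 1 from funext hl, ← Finsupp.apply_linearCombination]
    congr 1
    simp [Finsupp.linearCombination_apply]
  exact (Submodule.Quotient.mk_eq_zero S).1 key

lemma surjective_linearCombination (hf : IsBC φ f) {I : Type*} (s : I → M)
    (h₁ : Function.Surjective (Finsupp.linearCombination A s)) :
    Function.Surjective (Finsupp.linearCombination B (fun i => f (s i))) := by
  let := φ.toAlgebra
  let : Module A N := Module.compHom N φ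
  have : IsScalarTower A B N := .of_algebraMap_smul fun _ _ => rfl
  intro n
  rw [← LinearMap.mem_range]
  induction n using hf.isBaseChange.inductionOn with
  | zero => exact zero_mem _
  | add a b ha hb => exact add_mem ha hb
  | smul b n h => exact Submodule.smul_mem _ _ h
  | tmul m =>
    obtain ⟨a, rfl⟩ := h₁ m
    refine ⟨a.mapRange φ (map_zero _), ?_⟩
    change _ = f _
    induction a using Finsupp.induction_linear with
    | zero => simp only [Finsupp.mapRange_zero, map_zero]
    | add a b ha hb => rw [Finsupp.mapRange_add (map_add _), map_add, map_add, map_add, ha, hb]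
    | single i a =>
      rw [Finsupp.mapRange_single, Finsupp.linearCombination_single,
        Finsupp.linearCombination_single, hf.map_smul]

end IsBC

end BaseChange

/-! ### Presentations of sheaves of modules on sites with enough local objects -/

section Site

open CategoryTheory.Limits

universe v₁ u₁

variable {C : Type u₁} [Category.{v₁} C] {J : GrothendieckTopology C} {R : Sheaf J RingCat.{u}}

/-- A family of objects is a basis of a site if every object is covered by members of the family. -/
def IsSiteBasis (J : GrothendieckTopology C) {ι : Type*} (V : ι → C) : Prop :=
  ∀ (W : C) (S : Sieve W), (∀ (i : ι) (f : V i ⟶ W), S f) → S ∈ J W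

variable {ι : Type*} {V : ι → C}

lemma IsSiteBasis.epi_of_surjective (hJ : IsSiteBasis J V) {M N : SheafOfModules.{u} R}
    (φ : M ⟶ N) (h : ∀ i, Function.Surjective (φ.val.app (op (V i))).hom) : Epi φ := by
  refine ⟨fun {P} a b hab => ?_⟩
  apply SheafOfModules.hom_ext
  apply PresheafOfModules.hom_ext
  rintro ⟨W⟩
  ext s
  apply P.isSheaf.isSeparated _ _ (hJ W (Presheaf.imageSieve
    ((PresheafOfModules.toPresheaf R.obj).map φ.val) s) fun i f => h i _)
  rintro Y f ⟨t, ht⟩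
  have ha := PresheafOfModules.naturality_apply a.val f.op s
  have hb := PresheafOfModules.naturality_apply b.val f.op s
  refine ha.symm.trans (Eq.trans ?_ hb)
  have ht' : (φ.val.app (op Y)).hom t = N.val.map f.op s := ht
  have := congrArg (fun c : M ⟶ P => (c.val.app (op _)).hom t) hab
  exact ((congrArg (a.val.app (op _)).hom ht').symm.trans this).trans
    (congrArg (b.val.app (op _)).hom ht')

/-- The global section attached to an element over a terminal object. -/
def secOfTerminal {T : C} (hT : IsTerminal T) {M : SheafOfModules.{u} R} (x : M.val.obj (op T)) :
    M.sections :=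
  PresheafOfModules.sectionsMk (fun W => M.val.restrictₛₗ (hT.from W.unop).op x) (by
    intro V W f
    have : (hT.from W.unop).op = (hT.from V.unop).op ≫ f :=
      Quiver.Hom.unop_inj (hT.hom_ext _ _)
    rw [this]
    exact (M.val.map_comp_apply _ _ _).symm)

variable [HasSheafify J AddCommGrpCat.{u}] [J.WEqualsLocallyBijective AddCommGrpCat.{u}]

/-- All sections over the terminal object serve as generators, and all linear relations among them
as relations. Exactness is needed only on the basis of local objects, where the free sheaves are
free modules. -/
lemma IsSiteBasis.nonempty_presentation (hJ : IsSiteBasis J V)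
    (hV : ∀ i, IsLocalObj J (V i)) {T : C}
    (hT : IsTerminal T) (M : SheafOfModules.{u} R)
    (h₁ : ∀ i, Function.Surjective (Finsupp.linearCombination (R.obj.obj (op (V i)))
      (fun x : M.val.obj (op T) => M.val.restrictₛₗ (hT.from (V i)).op x)))
    (h₂ : ∀ i a, Finsupp.linearCombination (R.obj.obj (op (V i)))
      (fun x : M.val.obj (op T) => M.val.restrictₛₗ (hT.from (V i)).op x) a = 0 →
      a ∈ Submodule.span (R.obj.obj (op (V i))) (Set.range fun k : LinearMap.ker
        (Finsupp.linearCombination (R.obj.obj (op T)) (fun x : M.val.obj (op T) => x)) =>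
          k.1.mapRange (R.obj.map (hT.from (V i)).op).hom (map_zero _))) :
    Nonempty M.Presentation := by
  let s : M.val.obj (op T) → M.sections := secOfTerminal hT
  have hπ (W : C) (a) : ((M.freeHomEquiv.symm s).val.app (op W)).hom
      (Finsupp.linearCombination _ (fun i => secAt (SheafOfModules.freeSection (R := R) i) W) a) =
      Finsupp.linearCombination _ (fun x => M.val.restrictₛₗ (hT.from W).op x) a :=
    map_linearCombination_freeSection s W a
  let G : M.GeneratingSections :=
    { I := _
      s := s
      epi := hJ.epi_of_surjective _ fun i m => by
        obtain ⟨a, rfl⟩ := h₁ i m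
        exact ⟨_, hπ (V i) a⟩ }
  let Kt := LinearMap.ker (Finsupp.linearCombination (R.obj.obj (op T))
    (fun x : M.val.obj (op T) => x))
  have hK (k : Kt) : ∃ t, ((kernel.ι G.π).val.app (op T)).hom t = Finsupp.linearCombination _
      (fun i => secAt (SheafOfModules.freeSection (R := R) i) T) k.1 := by
    refine exists_kernel_eq G.π T ((hπ T k.1).trans ?_)
    refine Eq.trans ?_ k.2
    congr 2
    ext x
    have : (hT.from T).op = 𝟙 (op T) := Quiver.Hom.unop_inj (hT.hom_ext _ _)
    rw [this]
    change M.val.presheaf.map (𝟙 _) x = x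
    rw [M.val.presheaf.map_id]
    rfl
  choose t ht using hK
  let r : Kt → (kernel G.π).sections := fun k => secOfTerminal hT (t k)
  refine ⟨⟨G, ⟨Kt, r, hJ.epi_of_surjective _ fun i x => ?_⟩⟩⟩
  have hinj : Function.Injective ((kernel.ι G.π).val.app (op (V i))).hom := by
    have : Mono (kernel.ι G.π).val := inferInstanceAs (Mono ((SheafOfModules.forget _).map _))
    exact PresheafOfModules.injective_of_mono (kernel.ι G.π).val (op (V i))
  obtain ⟨a, ha⟩ := ((hV i).linearCombination_bijective _).2
    (((kernel.ι G.π).val.app (op (V i))).hom x)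
  have ha' := h₂ i a (by
    rw [← hπ, ha]
    exact congrArg (fun c : kernel G.π ⟶ M => (c.val.app (op (V i))).hom x) (kernel.condition G.π))
  rw [← Finsupp.range_linearCombination] at ha'
  obtain ⟨b, rfl⟩ := ha'
  refine ⟨Finsupp.linearCombination _
    (fun j => secAt (SheafOfModules.freeSection (R := R) j) (V i)) b, hinj ?_⟩
  rw [← ha]
  refine (congrArg ((kernel.ι G.π).val.app (op (V i))).hom
    (map_linearCombination_freeSection r (V i) b)).trans ?_
  rw [Finsupp.apply_linearCombination, Finsupp.apply_linearCombination]
  congr 2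
  ext k
  change ((kernel.ι G.π).val.app (op (V i))).hom
    ((kernel G.π).val.restrictₛₗ (hT.from (V i)).op (t k)) =
    Finsupp.linearCombination _ _ (k.1.mapRange (R.obj.map (hT.from (V i)).op).hom (map_zero _))
  refine (PresheafOfModules.naturality_apply (kernel.ι G.π).val (hT.from (V i)).op (t k)).trans ?_
  refine (congrArg ((SheafOfModules.free _).val.restrictₛₗ (hT.from (V i)).op) (ht k)).trans ?_
  rw [restrict_linearCombination]
  congr 2
  ext i
  exact secAt_map _ _

end Site


/-! ### Quasi-coherent modules on finite ringed spaces -/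

section

variable {X : RingedSpace.{u, u}}

instance (M : OMod X) (U : Opens X.carrier) : Module (O X U) (Sec M U) :=
  inferInstanceAs (Module (Scal X U) (Sec M U))

variable [Finite X.carrier]

/-- A presentation on a neighbourhood of `p` presents both `M_p` and `M_q` by the same generators
and relations. -/
lemma isBC_of_isQuasicoherent (M : OMod X) [M.IsQuasicoherent] {p q : X.carrier} (h : q ⤳ p) :
    IsBC (resO (X := X) (minOpen_mono h)) (res M (minOpen_mono h)) := by
  obtain ⟨I, K, s, ρ, h₀, h₁, h₂, h₃⟩ := exists_relations_minOpen M h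
  exact IsBC.of_relations (res_smul M _) s ρ h₀ h₁ h₂ h₃

lemma isSiteBasis_over (U : Opens X.carrier) :
    IsSiteBasis ((Opens.grothendieckTopology X.carrier).over U)
      (fun q : {q // minOpen q ≤ U} => Over.mk (homOfLE q.2)) := by
  intro W S hS
  rw [GrothendieckTopology.mem_over_iff]
  intro x hx
  refine ⟨minOpen x, homOfLE (minOpen_le hx), ?_, mem_minOpen.2 specializes_rfl⟩
  rw [Sieve.overEquiv_iff]
  exact hS ⟨x, (minOpen_le hx).trans W.hom.le⟩ _

lemma nonempty_presentation_over (M : OMod X) (p : X.carrier)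
    (h : ∀ (q : X.carrier) (h : q ⤳ p),
      IsBC (resO (X := X) (minOpen_mono h)) (res M (minOpen_mono h))) :
    Nonempty (M.over (minOpen p)).Presentation := by
  have hsurj : Function.Surjective (Finsupp.linearCombination (O X (minOpen p))
      (fun x : Sec M (minOpen p) => x)) := fun x =>
    ⟨Finsupp.single x 1, (Finsupp.linearCombination_single _ _ _).trans (one_smul _ _)⟩
  have hq (q : {q // minOpen q ≤ minOpen p}) : q.1 ⤳ p :=
    mem_minOpen.1 (q.2 (mem_minOpen.2 specializes_rfl))
  refine (isSiteBasis_over (minOpen p)).nonempty_presentation (fun q => isLocalObj_over q.2)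
    Over.mkIdTerminal (M.over (minOpen p)) (fun q => ?_) (fun q a ha => ?_)
  · exact (h q.1 (hq q)).surjective_linearCombination _ hsurj
  · exact (h q.1 (hq q)).mem_span_relations _ hsurj a ha

/-- The minimal open sets cover, and over `U_p` any presentation of `M_p` remains one at every `q ≥
p` by base change. -/
lemma isQuasicoherent_of_isBC (M : OMod X)
    (h : ∀ (p q : X.carrier) (h : q ⤳ p),
      IsBC (resO (X := X) (minOpen_mono h)) (res M (minOpen_mono h))) : M.IsQuasicoherent := by
  have hc : (Opens.grothendieckTopology X.carrier).CoversTop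
      (fun p : X.carrier => minOpen p) := fun W x hx =>
    ⟨minOpen x, homOfLE (minOpen_le hx), ⟨x, ⟨𝟙 _⟩⟩, mem_minOpen.2 specializes_rfl⟩
  apply SheafOfModules.IsQuasicoherent.mk
  constructor
  exact SheafOfModules.QuasicoherentData.mk (C := Opens X.carrier) (R := ringSheaf X) (M := M)
    (I := X.carrier) (X := fun p : X.carrier => minOpen p) hc
    fun p => (nonempty_presentation_over M p (h p)).some

end

/-! ### Tensoring bounded exact complexes of flat modules -/

section FlatComplex

open TensorProduct Function

variable {A : Type u} [CommRing A]

lemma flat_pi {ι : Type*} [Finite ι] (E : ι → Type*) [∀ i, AddCommGroup (E i)]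
    [∀ i, Module A (E i)] [∀ i, Module.Flat A (E i)] : Module.Flat A (∀ i, E i) := by
  classical
  have := Fintype.ofFinite ι
  exact Module.Flat.of_linearEquiv (DirectSum.linearEquivFunOnFintype A ι E).symm

lemma exists_flat_presentation (T : Type u) [AddCommGroup T] [Module A T] :
    ∃ (F K : Type u) (_ : AddCommGroup F) (_ : AddCommGroup K) (_ : Module A F) (_ : Module A K)
      (_ : Module.Flat A F) (ι : K →ₗ[A] F) (π : F →ₗ[A] T),
      Injective ι ∧ Exact ι π ∧ Surjective π :=
  ⟨T →₀ A, LinearMap.ker (Finsupp.linearCombination A (id : T → T)), inferInstance, inferInstance,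
    inferInstance, inferInstance, inferInstance, Submodule.subtype _,
    Finsupp.linearCombination A id, Subtype.val_injective, LinearMap.exact_subtype_ker_map _,
    Finsupp.linearCombination_id_surjective A T⟩

/-- Dimension shifting: if the complex `E₁ ⟶ E₂ ⟶ E₃`, tensored with any module, is exact, then
so is the exact complex `E₀ ⟶ E₁ ⟶ E₂`, provided that `E₃` is flat. -/
lemma lTensor_exact_of_forall_lTensor_exact {E₀ E₁ E₂ E₃ : Type u} [AddCommGroup E₀]
    [AddCommGroup E₁] [AddCommGroup E₂] [AddCommGroup E₃] [Module A E₀] [Module A E₁]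
    [Module A E₂] [Module A E₃] [Module.Flat A E₃] {f : E₀ →ₗ[A] E₁} {g : E₁ →ₗ[A] E₂}
    {h : E₂ →ₗ[A] E₃} (hfg : Exact f g) (hgh : h ∘ₗ g = 0)
    (H : ∀ (K : Type u) [AddCommGroup K] [Module A K], Exact (g.lTensor K) (h.lTensor K))
    (T : Type u) [AddCommGroup T] [Module A T] : Exact (f.lTensor T) (g.lTensor T) := by
  obtain ⟨F, K, _, _, _, _, _, ι, π, hK, hι, hπ⟩ := exists_flat_presentation (A := A) T
  intro x
  constructor
  · intro hx
    obtain ⟨y, rfl⟩ := LinearMap.rTensor_surjective E₁ hπ x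
    have hy : π.rTensor E₂ (g.lTensor _ y) = 0 := by
      rw [← hx]
      exact LinearMap.congr_fun ((LinearMap.rTensor_comp_lTensor _ _ _).trans
        (LinearMap.lTensor_comp_rTensor _ _ _).symm) y
    obtain ⟨k, hk⟩ := (rTensor_exact E₂ hι hπ _).1 hy
    -- Flatness of `E₃` keeps `K ⊗ E₃` inside `F ⊗ E₃`, where the image of `k` is zero because `h ∘
    -- g = 0`.
    have hk' : h.lTensor K k = 0 := by
      apply Module.Flat.rTensor_preserves_injective_linearMap (M := E₃) ι hK
      rw [map_zero]
      have : ι.rTensor E₃ (h.lTensor K k) = h.lTensor _ (ι.rTensor E₂ k) :=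
        LinearMap.congr_fun ((LinearMap.rTensor_comp_lTensor _ _ _).trans
          (LinearMap.lTensor_comp_rTensor _ _ _).symm) k
      rw [this, hk, ← LinearMap.comp_apply, ← LinearMap.lTensor_comp, hgh, LinearMap.lTensor_zero]
      rfl
    obtain ⟨k', rfl⟩ := (H K k).1 hk'
    have hz : g.lTensor _ (y - ι.rTensor E₁ k') = 0 := by
      rw [map_sub, sub_eq_zero, ← hk]
      exact LinearMap.congr_fun ((LinearMap.rTensor_comp_lTensor _ _ _).trans
        (LinearMap.lTensor_comp_rTensor _ _ _).symm) k'
    -- The corrected lift is a cocycle with coefficients in the flat module `F`, where exactness is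
    -- preserved.
    obtain ⟨z, hz⟩ := (Module.Flat.lTensor_exact F hfg _).1 hz
    refine ⟨π.rTensor E₀ z, ?_⟩
    have h1 : f.lTensor T (π.rTensor E₀ z) = π.rTensor E₁ (f.lTensor _ z) :=
      LinearMap.congr_fun ((LinearMap.lTensor_comp_rTensor _ _ _).trans
        (LinearMap.rTensor_comp_lTensor _ _ _).symm) z
    rw [h1, hz, map_sub, ← LinearMap.comp_apply (π.rTensor E₁), ← LinearMap.rTensor_comp,
      hι.linearMap_comp_eq_zero, LinearMap.rTensor_zero, LinearMap.zero_apply, sub_zero]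
  · rintro ⟨y, rfl⟩
    rw [← LinearMap.comp_apply, ← LinearMap.lTensor_comp, hfg.linearMap_comp_eq_zero,
      LinearMap.lTensor_zero, LinearMap.zero_apply]

section

variable (E : ℕ → Type u) [∀ n, AddCommGroup (E n)] [∀ n, Module A (E n)]
  [∀ n, Module.Flat A (E n)] (d : ∀ n, E n →ₗ[A] E (n + 1)) (hd : ∀ n, Exact (d n) (d (n + 1)))
  (N : ℕ) (hN : ∀ n, N ≤ n → Subsingleton (E n))

include hd hN

lemma lTensor_exact_of_bounded (n : ℕ) (T : Type u) [AddCommGroup T] [Module A T] :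
    Exact ((d n).lTensor T) ((d (n + 1)).lTensor T) := by
  -- Descending induction from the degrees where the complex is zero; `T` must vary because each
  -- step passes to a syzygy of `T`.
  suffices ∀ k n, N ≤ n + k → ∀ (T : Type u) [AddCommGroup T] [Module A T],
      Exact ((d n).lTensor T) ((d (n + 1)).lTensor T) from
    this N n (Nat.le_add_left _ _) T
  intro k
  induction k with
  | zero =>
    intro n hn T _ _ x
    have := hN (n + 1) (by omega)
    have hx : x = 0 := Subsingleton.elim _ _
    rw [hx, map_zero]
    exact ⟨fun _ => ⟨0, map_zero _⟩, fun _ => rfl⟩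
  | succ k ih =>
    intro n hn T _ _
    exact lTensor_exact_of_forall_lTensor_exact (hd n) (hd (n + 1)).linearMap_comp_eq_zero
      (fun K _ _ => ih (n + 1) (by omega) K) T

variable {Z : Type u} [AddCommGroup Z] [Module A Z] (ι : Z →ₗ[A] E 0) (hι : Injective ι)
  (hι' : Exact ι (d 0))

include hι'

lemma lTensor_exact_zero_of_bounded (T : Type u) [AddCommGroup T] [Module A T] :
    Exact (ι.lTensor T) ((d 0).lTensor T) :=
  lTensor_exact_of_forall_lTensor_exact hι' (hd 0).linearMap_comp_eq_zero
    (fun K _ _ => lTensor_exact_of_bounded E d hd N hN 0 K) T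

include hι

lemma lTensor_injective_of_bounded (T : Type u) [AddCommGroup T] [Module A T] :
    Injective (ι.lTensor T) := by
  -- Injectivity is exactness after a zero module placed in front, so the same shifting applies; `Z`
  -- need not be flat.
  have h : Exact (0 : PUnit.{u + 1} →ₗ[A] Z) ι := by
    intro z
    constructor
    · intro hz
      exact ⟨0, (hι (hz.trans (map_zero ι).symm)).symm⟩
    · rintro ⟨y, rfl⟩
      exact map_zero ι
  have := lTensor_exact_of_forall_lTensor_exact h hι'.linearMap_comp_eq_zero
    (fun K _ _ => lTensor_exact_zero_of_bounded E d hd N hN ι hι' K) T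
  rw [injective_iff_map_eq_zero]
  intro x hx
  obtain ⟨y, rfl⟩ := (this x).1 hx
  rw [LinearMap.lTensor_zero, LinearMap.zero_apply]

end

end FlatComplex

/-! ### Base change and the standard cochains -/

section TensorComparison

open TensorProduct

lemma IsBC.exists_tensorPi_equiv {A : Type u} [CommRing A] {I : Type*} [Finite I] {B : I → Type u}
    [∀ i, CommRing (B i)] [∀ i, Algebra A (B i)] {P : I → Type u} [∀ i, AddCommGroup (P i)]
    [∀ i, Module (B i) (P i)] {T : Type u} [AddCommGroup T] [Module A T] {f : ∀ i, T →+ P i}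
    (hf : ∀ i, IsBC (algebraMap A (B i)) (f i)) :
    ∃ Θ : T ⊗[A] (∀ i, B i) ≃+ ∀ i, P i, ∀ t b i, Θ (t ⊗ₜ b) i = b i • f i t := by
  classical
  have := Fintype.ofFinite I
  let (i : I) : Module A (P i) := Module.compHom _ (algebraMap A (B i))
  have (i : I) : IsScalarTower A (B i) (P i) := .of_algebraMap_smul fun _ _ => rfl
  have h (i : I) : IsBaseChange (B i) (toLinear (algebraMap A (B i)) (f i) (hf i).map_smul) :=
    (isBC_iff' rfl fun _ => rfl).1 (hf i)
  refine ⟨(TensorProduct.piRight A A T B).toAddEquiv.trans (AddEquiv.piCongrRight fun i =>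
    ((TensorProduct.comm A T (B i)).toAddEquiv.trans (h i).equiv.toAddEquiv)), fun t b i => ?_⟩
  exact (h i).equiv_tmul (b i) t

/-- An additive map is determined by its values on pure tensors, so bijectivity may be checked on
any convenient description of the comparison map. -/
lemma IsBC.of_bijective {A : Type*} {B : Type u} [CommRing A] [CommRing B] [Algebra A B]
    {φ : A →+* B} (hφ : algebraMap A B = φ) {T N : Type u} [AddCommGroup T]
    [AddCommGroup N] [Module A T] [Module B N] {f : T →+ N} (hf : ∀ a t, f (a • t) = φ a • f t)
    (h : ∀ L : T ⊗[A] B →+ N, (∀ t b, L (t ⊗ₜ b) = b • f t) → Function.Bijective L) :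
    IsBC φ f := by
  subst hφ
  let : Module A N := Module.compHom N (algebraMap A B)
  have : IsScalarTower A B N := .of_algebraMap_smul fun _ _ => rfl
  let L : B ⊗[A] T →ₗ[B] N := (toLinear (algebraMap A B) f hf).liftBaseChange B
  have hL (b : B) (t : T) : L (b ⊗ₜ t) = b • f t := LinearMap.liftBaseChange_tmul _ _ _ _
  have hb := h (L.toAddMonoidHom.comp (TensorProduct.comm A T B).toLinearMap.toAddMonoidHom)
    fun t b => hL b t
  have hb' : Function.Bijective L := (Function.Bijective.of_comp_iff L
    (TensorProduct.comm A T B).bijective).1 hb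
  exact (isBC_iff' (g := toLinear (algebraMap A B) f hf) rfl fun _ => rfl).2
    (IsBaseChange.of_equiv (LinearEquiv.ofBijective L hb') fun t =>
      (hL 1 t).trans (one_smul _ _))

variable {X : RingedSpace.{u, u}} [Finite X.carrier]

/-- The structure sheaf as a sheaf of abelian groups. -/
abbrev unitAb (X : RingedSpace.{u, u}) : TopCat.Sheaf AddCommGrpCat.{u} X.carrier :=
  toAb (SheafOfModules.unit (ringSheaf X))

/-- The product of a cochain of functions with a section of a module. -/
def smulCoch {V : Opens X.carrier} (M : OMod X) {n : ℕ}
    (b : (ChainCover.std V).Coch (unitAb X).obj n) (t : Sec M V) :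
    (ChainCover.std V).Coch (toAb M).obj n :=
  fun c => HSMul.hSMul (α := O X (minOpen c.1.last)) (β := Sec M (minOpen c.1.last))
    (b c) (res M (last_le c.1 c.2) t)

lemma d_smulCoch {V : Opens X.carrier} (M : OMod X) {n : ℕ}
    (b : (ChainCover.std V).Coch (unitAb X).obj n) (t : Sec M V) :
    (ChainCover.std V).d (toAb M).obj n (smulCoch M b t) =
      smulCoch M ((ChainCover.std V).d (unitAb X).obj n b) t := by
  funext c
  let m (k : Fin (n + 2)) : O X (minOpen c.1.last) :=
    resO (X := X) (minOpen_mono (c.1.face_last k)) (b ⟨c.1.face k, c.1.face_mem k c.2⟩)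
  refine Eq.trans ?_ (Finset.sum_smul (f := fun k : Fin (n + 2) => (-1 : ℤ) ^ (k : ℕ) • m k)
    (s := Finset.univ) (x := res M (last_le c.1 c.2) t)).symm
  change ∑ k : Fin (n + 2), (-1 : ℤ) ^ (k : ℕ) • res M (minOpen_mono (c.1.face_last k))
    (HSMul.hSMul (α := O X (minOpen (c.1.face k).last)) (β := Sec M (minOpen (c.1.face k).last))
      (b ⟨c.1.face k, c.1.face_mem k c.2⟩) (res M (last_le _ (c.1.face_mem k c.2)) t)) = _
  refine Finset.sum_congr rfl fun k _ => ?_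
  refine Eq.trans (congrArg ((-1 : ℤ) ^ (k : ℕ) • ·) ((res_smul M
    (minOpen_mono (c.1.face_last k)) _ _).trans (congrArg _ (res_res M _ _ t)))) ?_
  exact (map_zsmul (LinearMap.toSpanSingleton (O X (minOpen c.1.last))
    (Sec M (minOpen c.1.last)) (res M (last_le c.1 c.2) t)) ((-1 : ℤ) ^ (k : ℕ)) (m k)).symm

variable [T0Space X.carrier] (M : OMod X) {U V : Opens X.carrier} (hV : V ≤ U)
  (hflat : ∀ x (hx : x ∈ V), (resO (X := X) ((minOpen_le hx).trans hV)).Flat)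
  (hM : ∀ x (hx : x ∈ V), IsBC (resO (X := X) ((minOpen_le hx).trans hV))
    (res M ((minOpen_le hx).trans hV)))
  (hO : ∀ n, (ChainCover.std V).ExactAt (unitAb X).obj n)

include hflat hM hO

/-- The standard cochains of `M` over `V` are `M(U)` tensored with those of `𝒪`, since chains are
finitely many and each `M_x` with `x ∈ V` is a base change of `M(U)`. The cochains of `𝒪` are flat
over `𝒪(U)`, bounded and exact, so tensoring preserves exactness, including at the augmentation,
which identifies `M(V)`. -/
lemma std_exactAt_and_isBC :
    (∀ n, (ChainCover.std V).ExactAt (toAb M).obj n) ∧ IsBC (resO hV) (res M hV) := by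
  let I (n : ℕ) := {c : Chain X.carrier n // c.pt 0 ∈ V}
  have (n : ℕ) : Finite (Chain X.carrier n) :=
    Finite.of_injective Chain.pt fun _ _ h => Chain.ext h
  let B (n : ℕ) (c : I n) : Type u := O X (minOpen c.1.last)
  let (n : ℕ) (c : I n) : CommRing (B n c) :=
    inferInstanceAs (CommRing (O X (minOpen c.1.last)))
  have hU {n : ℕ} (c : I n) : minOpen c.1.last ≤ U := (last_le c.1 c.2).trans hV
  let (n : ℕ) (c : I n) : Algebra (O X U) (B n c) := (resO (X := X) (hU c)).toAlgebra
  let P (n : ℕ) (c : I n) : Type u := Sec M (minOpen c.1.last)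
  let (n : ℕ) (c : I n) : AddCommGroup (P n c) :=
    inferInstanceAs (AddCommGroup (Sec M (minOpen c.1.last)))
  let (n : ℕ) (c : I n) : Module (B n c) (P n c) :=
    inferInstanceAs (Module (O X (minOpen c.1.last)) (Sec M (minOpen c.1.last)))
  have mem_last {n : ℕ} (c : I n) : c.1.last ∈ V :=
    last_le c.1 c.2 (mem_minOpen.2 specializes_rfl)
  have (n : ℕ) (c : I n) : Module.Flat (O X U) (B n c) := hflat _ (mem_last c)
  have (n : ℕ) : Module.Flat (O X U) (∀ c, B n c) := flat_pi _
  let d (n : ℕ) : (∀ c, B n c) →ₗ[O X U] (∀ c, B (n + 1) c) :=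
    { (ChainCover.std V).d (unitAb X).obj n with
      map_smul' := fun a b => by
        let t : Sec (SheafOfModules.unit (ringSheaf X)) V := resO (X := X) hV a
        have h (m : ℕ) (b : ∀ c, B m c) : a • b = smulCoch (n := m) _ b t := funext fun c =>
          (mul_comm _ _).trans (congrArg (fun r : B m c => b c * r)
            (resO_resO (X := X) hV (last_le c.1 c.2) a).symm)
        exact (congrArg _ (h n b)).trans ((d_smulCoch _ _ t).trans (h (n + 1) _).symm) }
  have hd (n : ℕ) : Function.Exact (d n) (d (n + 1)) := by
    intro s
    constructor
    · exact hO n s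
    · rintro ⟨t, rfl⟩
      exact (ChainCover.std V).d_d (unitAb X).obj n t
  have hN (n : ℕ) (hn : Nat.card X.carrier ≤ n) : Subsingleton (∀ c, B n c) := by
    have := isEmpty_chain_of_card_le hn
    infer_instance
  -- `Θ` is the identification of the two complexes; `hc` below is its compatibility with the
  -- differentials.
  choose Θ hΘ using fun n => IsBC.exists_tensorPi_equiv (T := Sec M U) (A := O X U) (B := B n)
    (P := P n) (f := fun c => res M (hU c)) fun c => hM _ (mem_last c)
  have hc (n : ℕ) (x) : (ChainCover.std V).d (toAb M).obj n (Θ n x) =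
      Θ (n + 1) ((d n).lTensor (Sec M U) x) := by
    induction x using TensorProduct.induction_on with
    | zero => simp only [map_zero]; exact map_zero _
    | add x y hx hy =>
      simp only [map_add]
      exact (map_add ((ChainCover.std V).d (toAb M).obj n) _ _).trans (congrArg₂ (· + ·) hx hy)
    | tmul t b =>
      have h (m : ℕ) (b : ∀ c, B m c) : Θ m (t ⊗ₜ b) = smulCoch (n := m) M b (res M hV t) :=
        funext fun c => (hΘ m t b c).trans (congrArg _ (res_res M hV (last_le c.1 c.2) t).symm)
      rw [LinearMap.lTensor_tmul, h, h]
      exact d_smulCoch M _ _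
  have hΘd (n : ℕ) (s : (ChainCover.std V).Coch (toAb M).obj n)
      (hs : (ChainCover.std V).d (toAb M).obj n s = 0) :
      ∃ x, Θ n x = s ∧ (d n).lTensor (Sec M U) x = 0 := by
    obtain ⟨x, rfl⟩ := (Θ n).surjective s
    exact ⟨x, rfl, (Θ (n + 1)).injective ((hc n x).symm.trans (hs.trans (map_zero _).symm))⟩
  let := (resO (X := X) hV).toAlgebra
  refine ⟨fun n s hs => ?_, IsBC.of_bijective rfl (res_smul M hV) fun L hL => ?_⟩
  · obtain ⟨x, rfl, hx⟩ := hΘd (n + 1) s hs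
    obtain ⟨y, rfl⟩ := (lTensor_exact_of_bounded _ d hd _ hN n (Sec M U) x).1 hx
    exact ⟨Θ n y, hc n y⟩
  · let ι : O X V →ₗ[O X U] (∀ c, B 0 c) :=
      { (ChainCover.std V).aug (unitAb X).obj with
        map_smul' := fun a b => funext fun c =>
          (map_mul (resO (X := X) (last_le c.1 c.2)) (resO hV a) b).trans
            (congrArg (· * _) (resO_resO hV (last_le c.1 c.2) a)) }
    have hι : Function.Injective ι := (ChainCover.std V).aug_injective (unitAb X)
    have hι' : Function.Exact ι (d 0) := by
      intro s
      constructor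
      · exact (ChainCover.std V).exists_aug_eq (unitAb X) s
      · rintro ⟨t, rfl⟩
        exact (ChainCover.std V).d_aug (F := (unitAb X).obj) t
    have hLι (x) : (ChainCover.std V).aug (toAb M).obj (L x) =
        Θ 0 (ι.lTensor (Sec M U) x) := by
      induction x using TensorProduct.induction_on with
      | zero => simp only [map_zero]; exact map_zero _
      | add x y hx hy =>
        simp only [map_add]
        exact (map_add ((ChainCover.std V).aug (toAb M).obj) _ _).trans
          (congrArg₂ (· + ·) hx hy)
      | tmul t b =>
        rw [LinearMap.lTensor_tmul, hL]
        refine funext fun c => Eq.trans ?_ (hΘ 0 t (ι b) c).symm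
        exact (res_smul M (last_le c.1 c.2) b _).trans (congrArg _ (res_res M _ _ t))
    constructor
    · intro x y hxy
      refine lTensor_injective_of_bounded _ d hd _ hN ι hι hι' (Sec M U) ((Θ 0).injective ?_)
      rw [← hLι, ← hLι, hxy]
    · intro m
      obtain ⟨x, hx, hx'⟩ := hΘd 0 _ ((ChainCover.std V).d_aug (F := (toAb M).obj) m)
      obtain ⟨y, rfl⟩ := (lTensor_exact_zero_of_bounded _ d hd _ hN ι hι' (Sec M U) x).1 hx'
      exact ⟨y, (ChainCover.std V).aug_injective (toAb M) ((hLι y).trans hx)⟩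

end TensorComparison

/-! ### Semi-separated spaces -/

section SemiSeparated

open TensorProduct

namespace RingData

variable {Z : TopCat.{u}} [Finite Z] (R : RingData Z)

/-- An element of the ring at `z` as a section over the smallest open neighbourhood of `z`. -/
def ofStalk (z : Z) : R.stalk z →+* R.sec (minOpen z) where
  toFun a := ⟨fun y => R.map (mem_minOpen.1 y.2) a, fun _ _ h => R.map_map _ h a⟩
  map_one' := Subtype.ext (funext fun _ => map_one _)
  map_mul' _ _ := Subtype.ext (funext fun _ => map_mul _ _ _)
  map_zero' := Subtype.ext (funext fun _ => map_zero _)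
  map_add' _ _ := Subtype.ext (funext fun _ => map_add _ _ _)

lemma ofStalk_bijective (z : Z) : Function.Bijective (R.ofStalk z) := by
  have hz : z ∈ minOpen z := mem_minOpen.2 specializes_rfl
  constructor
  · intro a b hab
    have := congrFun (congrArg Subtype.val hab) ⟨z, hz⟩
    exact (R.map_self z _ a).symm.trans (this.trans (R.map_self z _ b))
  · intro s
    exact ⟨s.1 ⟨z, hz⟩, Subtype.ext (funext fun y => s.2 ⟨z, hz⟩ y (mem_minOpen.1 y.2))⟩

lemma secRes_ofStalk {z w : Z} (h : w ⤳ z) (a : R.stalk z) :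
    R.secRes (minOpen_mono h) (R.ofStalk z a) = R.ofStalk w (R.map h a) :=
  Subtype.ext (funext fun _ => (R.map_map _ _ a).symm)

end RingData

variable {X : RingedSpace.{u, u}} [Finite X.carrier]

instance : Finite (TopCat.of (X.carrier × X.carrier)) :=
  inferInstanceAs (Finite (X.carrier × X.carrier))

instance : Finite (prod X X).carrier := inferInstanceAs (Finite (X.carrier × X.carrier))

/-- The first coprojection into the stalk of `X × X`. -/
def prodLeft (z : X.carrier × X.carrier) : O X (minOpen z.1) →+* (prodData X X).stalk z :=
  Algebra.TensorProduct.includeLeftRingHom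

/-- The second coprojection into the stalk of `X × X`. -/
def prodRight (z : X.carrier × X.carrier) : O X (minOpen z.2) →+* (prodData X X).stalk z :=
  (Algebra.TensorProduct.includeRight (R := ℤ) (A := O X (minOpen z.1))
    (B := O X (minOpen z.2))).toRingHom

/-- The second coprojection into the sections of `X × X` over a minimal open subset. -/
def secRight (z : X.carrier × X.carrier) :
    O X (minOpen z.2) →+* (prodData X X).sec (minOpen (X := TopCat.of (X.carrier × X.carrier)) z) :=
  ((prodData X X).ofStalk z).comp (prodRight z)

/-- The sections over the minimal open set of `(p, q)` are `𝒪_p ⊗_ℤ 𝒪_q`, the base change of `𝒪_p`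
along `ℤ → 𝒪_q`. -/
lemma isBC_prodLeft (z : X.carrier × X.carrier) :
    letI := Module.compHom ((prodData X X).sec
      (minOpen (X := TopCat.of (X.carrier × X.carrier)) z)) (secRight z)
    IsBC (Int.castRingHom (O X (minOpen z.2)))
      (((prodData X X).ofStalk z).comp (prodLeft z)).toAddMonoidHom := by
  let := Module.compHom ((prodData X X).sec
      (minOpen (X := TopCat.of (X.carrier × X.carrier)) z)) (secRight z)
  refine IsBC.of_bijective rfl (fun n t => ?_) fun L hL => ?_
  · refine (map_zsmul (((prodData X X).ofStalk z).comp (prodLeft z)).toAddMonoidHom n t).trans ?_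
    refine (zsmul_eq_mul _ _).trans (congrArg (· * _) ?_)
    exact (map_intCast (secRight z) n).symm
  · let G : O X (minOpen z.1) ⊗[ℤ] O X (minOpen z.2) →+ _ :=
      ((prodData X X).ofStalk z).toAddMonoidHom
    have : L = G := by
      refine AddMonoidHom.ext fun x => ?_
      induction x using TensorProduct.induction_on with
      | zero => exact (map_zero L).trans (map_zero G).symm
      | add x y hx hy =>
        exact (map_add L x y).trans ((congrArg₂ (· + ·) hx hy).trans (map_add G x y).symm)
      | tmul t b =>
        refine (hL t b).trans ?_
        refine (map_mul ((prodData X X).ofStalk z) _ _).symm.trans (congrArg _ ?_)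
        refine (Algebra.TensorProduct.tmul_mul_tmul (R := ℤ) (1 : O X (minOpen z.1)) t b
          (1 : O X (minOpen z.2))).trans ?_
        rw [one_mul, mul_one]
    rw [this]
    exact (prodData X X).ofStalk_bijective z

lemma secRes_secRight (p : X.carrier) {q q' : X.carrier} (h : q' ⤳ q) (h' : (p, q') ⤳ (p, q))
    (b : O X (minOpen q)) : (prodData X X).secRes (minOpen_mono h') (secRight (p, q) b) =
      secRight (p, q') (resO (X := X) (minOpen_mono h) b) := by
  refine ((prodData X X).secRes_ofStalk h' _).trans (congrArg _ ?_)
  exact (prodRes_tmul X X h' 1 b).trans (congrArg (· ⊗ₜ[ℤ] _) (map_one _))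

/-- Both tensor products are base changes of `𝒪_p` from `ℤ`, so cancellation shows that `𝒪_p ⊗ 𝒪_q'`
is the pushout of `𝒪_p ⊗ 𝒪_q` along `𝒪_q → 𝒪_q'`. -/
lemma isBC_secRes (p : X.carrier) {q q' : X.carrier} (h : q' ⤳ q) (h' : (p, q') ⤳ (p, q)) :
    letI := Module.compHom ((prodData X X).sec
      (minOpen (X := TopCat.of (X.carrier × X.carrier)) (p, q))) (secRight (p, q))
    letI := Module.compHom ((prodData X X).sec
      (minOpen (X := TopCat.of (X.carrier × X.carrier)) (p, q'))) (secRight (p, q'))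
    IsBC (resO (X := X) (minOpen_mono h))
      ((prodData X X).secRes (minOpen_mono h')).toAddMonoidHom := by
  let := Module.compHom ((prodData X X).sec
      (minOpen (X := TopCat.of (X.carrier × X.carrier)) (p, q))) (secRight (p, q))
  let := Module.compHom ((prodData X X).sec
      (minOpen (X := TopCat.of (X.carrier × X.carrier)) (p, q'))) (secRight (p, q'))
  have hL (a : O X (minOpen p)) : (prodData X X).secRes (minOpen_mono h')
      ((prodData X X).ofStalk (p, q) (prodLeft (p, q) a)) =
      (prodData X X).ofStalk (p, q') (prodLeft (p, q') a) := by
    refine ((prodData X X).secRes_ofStalk h' _).trans (congrArg _ ?_)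
    exact (prodRes_tmul X X h' a 1).trans (congrArg₂ (· ⊗ₜ[ℤ] ·) (resO_self _ a) (map_one _))
  refine IsBC.of_comp (isBC_prodLeft (p, q)) (fun b s => ?_) ?_
  · exact (map_mul ((prodData X X).secRes (minOpen_mono h')) _ _).trans
      (congrArg (· * _) (secRes_secRight p h h' b))
  · have e1 : (resO (X := X) (minOpen_mono h)).comp (Int.castRingHom (O X (minOpen q))) =
      Int.castRingHom (O X (minOpen q')) := RingHom.ext_int _ _
    have e2 : ((prodData X X).secRes (minOpen_mono h')).toAddMonoidHom.comp
        (((prodData X X).ofStalk (p, q)).comp (prodLeft (p, q))).toAddMonoidHom =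
        (((prodData X X).ofStalk (p, q')).comp (prodLeft (p, q'))).toAddMonoidHom :=
      AddMonoidHom.ext hL
    have := isBC_prodLeft (p, q')
    rw [← e1, ← e2] at this
    exact this

lemma diagRingHom_secRight (z : X.carrier × X.carrier)
    (h : (Opens.map (diagBase X)).obj (minOpen (X := TopCat.of (X.carrier × X.carrier)) z) ≤
      minOpen z.2) (b : O X (minOpen z.2)) :
    diagRingHom X (minOpen (X := TopCat.of (X.carrier × X.carrier)) z) (secRight z b) =
      resO h b := by
  refine O_ext fun x hx => (diagRingHom_res X _ _ x hx).trans ?_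
  refine Eq.trans ?_ (resO_resO _ _ _).symm
  have h' : (x, x) ⤳ z := mem_minOpen.1 hx
  refine (congrArg (mulStalk X x) (prodRes_tmul X X h' 1 b)).trans ?_
  refine (Algebra.TensorProduct.lmul'_apply_tmul _ _).trans ?_
  rw [map_one, one_mul]

lemma IsBC.of_smul_eq {A B : Type*} [CommRing A] [CommRing B] {φ : A →+* B} {M N : Type*}
    [AddCommGroup M] [AddCommGroup N] {i i' : Module A M} {j j' : Module B N} {f : M →+ N}
    (h : @IsBC _ _ _ _ φ _ _ _ _ i j f)
    (hi : ∀ (a : A) (m : M), i.toSMul.smul a m = i'.toSMul.smul a m)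
    (hj : ∀ (b : B) (n : N), j.toSMul.smul b n = j'.toSMul.smul b n) :
    @IsBC _ _ _ _ φ _ _ _ _ i' j' f := by
  have e : i = i' := Module.ext' _ _ hi
  have e' : j = j' := Module.ext' _ _ hj
  subst e e'
  exact h

/-- Quasi-coherence of `δ_* 𝒪` gives base change from `(p, q)` to `(p, q')`; by the pushout square
this is base change along `𝒪_q → 𝒪_q'`. The open sets enter through equations because the
intersections agree with the preimages under `δ` only propositionally. -/
lemma IsSemiSeparated.isBC_resO (hX : IsSemiSeparated X) (p : X.carrier) {q q' : X.carrier}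
    (h : q' ⤳ q) {V V' : Opens X.carrier} (hV : V = minOpen q ⊓ minOpen p)
    (hV' : V' = minOpen q' ⊓ minOpen p) (hq : V ≤ minOpen q) (hq' : V' ≤ minOpen q')
    (hVV' : V' ≤ V) :
    letI := Module.compHom (O X V) (resO hq)
    letI := Module.compHom (O X V') (resO hq')
    IsBC (resO (X := X) (minOpen_mono h)) (resO hVV').toAddMonoidHom := by
  have e (q : X.carrier) : minOpen q ⊓ minOpen p = (Opens.map (diagBase X)).obj
      (minOpen (X := TopCat.of (X.carrier × X.carrier)) (p, q)) := by
    ext x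
    exact ((and_congr mem_minOpen mem_minOpen).trans and_comm).trans
      (specializes_prod.symm.trans
      (mem_minOpen (X := TopCat.of (X.carrier × X.carrier)) (x := (p, q)) (y := (x, x))).symm)
  obtain rfl := hV.trans (e q)
  obtain rfl := hV'.trans (e q')
  have h' : (p, q') ⤳ (p, q) := specializes_prod.2 ⟨specializes_rfl, h⟩
  have := hX.isQuasicoherent
  have := IsBC.of_pushout (B := O (prod X X) (minOpen (X := (prod X X).carrier) (p, q)))
    (B' := O (prod X X) (minOpen (X := (prod X X).carrier) (p, q')))
    (α := secRight (p, q)) (α' := secRight (p, q'))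
    (β := resO (X := prod X X) (minOpen_mono h')) (RingHom.ext (secRes_secRight p h h'))
    (isBC_secRes p h h') (isBC_of_isQuasicoherent (X := prod X X)
      ((push (diag X)).obj (SheafOfModules.unit (ringSheaf X))) h')
  exact IsBC.of_smul_eq this
    (fun a m => congrArg (· * m) (diagRingHom_secRight (p, q) hq a))
    (fun a m => congrArg (· * m) (diagRingHom_secRight (p, q') hq' a))

variable [T0Space X.carrier]

/-- `U_p ∩ U_q` is the preimage of `U_p × U_q` under the diagonal. -/
lemma IsSemiSeparated.std_exactAt_unitAb (hX : IsSemiSeparated X) (p q : X.carrier) (n : ℕ) :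
    (ChainCover.std (minOpen p ⊓ minOpen q)).ExactAt (unitAb X).obj n := by
  have e : minOpen p ⊓ minOpen q = (Opens.map (diag X).hom.base).obj
      (minOpen (X := TopCat.of (X.carrier × X.carrier)) (p, q)) := by
    ext x
    exact (and_congr mem_minOpen mem_minOpen).trans (specializes_prod.symm.trans
      (mem_minOpen (X := TopCat.of (X.carrier × X.carrier)) (x := (p, q)) (y := (x, x))).symm)
  rw [e]
  exact std_exactAt_of_isZero_rightDerived _ _ hX.isZero _ n

variable (M : OMod X) [M.IsQuasicoherent]

lemma IsSemiSeparated.std_exactAt_and_isBC (hX : IsSemiSeparated X) (p q : X.carrier) :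
    (∀ n, (ChainCover.std (minOpen p ⊓ minOpen q)).ExactAt (toAb M).obj n) ∧
      IsBC (resO (inf_le_right : minOpen p ⊓ minOpen q ≤ minOpen q))
        (res M (inf_le_right : minOpen p ⊓ minOpen q ≤ minOpen q)) :=
  FiniteRinged.std_exactAt_and_isBC M inf_le_right
    (fun x hx => hX.isFiniteSpace q x (mem_minOpen.1 hx.2))
    (fun _ hx => isBC_of_isQuasicoherent M (mem_minOpen.1 hx.2)) (hX.std_exactAt_unitAb p q)

/-- Finite products preserve base change, so a single chain ending at `x` suffices. Both `M(U_q ∩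
U_x)` and `M(U_q' ∩ U_x)` are base changes of `M_x`, so the second is a base change of the first
along the restriction of `𝒪`, itself a pushout of `𝒪_q → 𝒪_q'`. -/
lemma IsSemiSeparated.isQuasicoherent_cechObj (hX : IsSemiSeparated X) (n : ℕ) :
    (cechObj M n).IsQuasicoherent := by
  have (n : ℕ) : Finite (Chain X.carrier n) :=
    Finite.of_injective Chain.pt fun _ _ h => Chain.ext h
  refine isQuasicoherent_of_isBC _ fun q q' h => ?_
  let (c : Chain X.carrier n) : Module (O X (minOpen q)) (Sec M (minOpen q ⊓ minOpen c.last)) :=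
    Module.compHom _ (resO (X := X) (V := minOpen q ⊓ minOpen c.last) inf_le_left)
  let (c : Chain X.carrier n) : Module (O X (minOpen q')) (Sec M (minOpen q' ⊓ minOpen c.last)) :=
    Module.compHom _ (resO (X := X) (V := minOpen q' ⊓ minOpen c.last) inf_le_left)
  refine IsBC.pi (fun c : Chain X.carrier n => res M (inf_le_inf_right _ (minOpen_mono h)))
    (fun c => ?_) (fun m c => rfl)
  have h1 := (hX.std_exactAt_and_isBC M q c.last).2
  have h2 := (hX.std_exactAt_and_isBC M q' c.last).2
  have hle : minOpen q' ⊓ minOpen c.last ≤ minOpen q ⊓ minOpen c.last :=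
    inf_le_inf_right _ (minOpen_mono h)
  have e1 : resO (inf_le_right : minOpen q' ⊓ minOpen c.last ≤ minOpen c.last) =
      (resO hle).comp (resO inf_le_right) := RingHom.ext fun a => (resO_resO _ _ a).symm
  have e2 : res M (inf_le_right : minOpen q' ⊓ minOpen c.last ≤ minOpen c.last) =
      (res M hle).comp (res M inf_le_right) := AddMonoidHom.ext fun a => (res_res M _ _ a).symm
  rw [e1, e2] at h2
  have h3 := IsBC.of_comp (ψ := resO hle) h1 (res_smul M hle) h2
  exact IsBC.of_pushout (RingHom.ext fun a => (resO_resO _ _ a).trans (resO_resO _ _ a).symm)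
    (hX.isBC_resO c.last h rfl rfl inf_le_left inf_le_left hle) h3

end SemiSeparated

/-! ### The pseudo-Čech complex -/

section PseudoCech

variable {X : RingedSpace.{u, u}} [Finite X.carrier]

/-- The cover of `W` by the intersections of all minimal open sets with it. -/
def ChainCover.cech' {X : TopCat.{u}} [Finite X] (W : Opens X) : ChainCover X where
  V := ⊤
  A := W
  N x := minOpen x ⊓ W
  N_le _ _ := inf_le_right
  N_le_minOpen _ := inf_le_left
  mono h := inf_le_inf_right W (minOpen_mono h)
  mem_V _ _ := trivial
  mem_N _ h := ⟨mem_minOpen.2 specializes_rfl, h⟩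

/-- The standard cochains of `Č^n M` on `X` split, chain by chain, into the cochains of `M` on the
sets `U_y ∩ U_c` for the last point of `c`. The order of the intersection in `cech'` is chosen to
match them definitionally. -/
lemma std_top_d_cechObj_apply (M : OMod X) (n m : ℕ)
    (s : (ChainCover.std (⊤ : Opens X.carrier)).Coch (toAb (cechObj M n)).obj m)
    (y : {y : Chain X.carrier (m + 1) // y.pt 0 ∈ (⊤ : Opens X.carrier)})
    (c : Chain X.carrier n) :
    ((ChainCover.std ⊤).d (toAb (cechObj M n)).obj m s y : CechSec M n (minOpen y.1.last)) c =
      (ChainCover.cech' (minOpen c.last)).d (toAb M).obj m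
        (fun z => (s z : CechSec M n (minOpen z.1.last)) c) y := by
  let e : CechSec M n (minOpen y.1.last) →+ Sec M (minOpen y.1.last ⊓ minOpen c.last) :=
    Pi.evalAddMonoidHom _ c
  let f (k : Fin (m + 2)) : CechSec M n (minOpen y.1.last) :=
    cechRes M n (minOpen_mono (y.1.face_last k)) (s ⟨y.1.face k, y.1.face_mem k y.2⟩)
  refine (map_sum e (fun k : Fin (m + 2) => (-1 : ℤ) ^ (k : ℕ) • f k) Finset.univ).trans ?_
  exact Finset.sum_congr rfl fun k _ => map_zsmul e _ (f k)

variable [T0Space X.carrier] (M : OMod X) [M.IsQuasicoherent]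

lemma IsSemiSeparated.cech_exactAt (hX : IsSemiSeparated X) (p : X.carrier) (n : ℕ) :
    (ChainCover.cech (minOpen p)).ExactAt (toAb M).obj n :=
  ChainCover.exactAt_of_std _ n (toAb M) (fun x => (hX.std_exactAt_and_isBC M p x).1)
    (fun m => ChainCover.std_minOpen_exactAt p m (toAb M))

lemma IsSemiSeparated.cech'_exactAt (hX : IsSemiSeparated X) (p : X.carrier) (n : ℕ) :
    (ChainCover.cech' (minOpen p)).ExactAt (toAb M).obj n :=
  ChainCover.exactAt_of_std _ n (toAb M) (fun x => (hX.std_exactAt_and_isBC M x p).1)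
    (fun m => ChainCover.std_minOpen_exactAt p m (toAb M))

lemma IsSemiSeparated.isResolution_cechAug (hX : IsSemiSeparated X) :
    IsResolution (K := cechComplex M) (cechAug M) := by
  refine isResolution_of_sections (cechObj M) (cechD M) (cechD_comp M) (cechAug M)
    (fun x s t h => ?_) (fun x s => ?_) (fun x s hs => ?_) (fun n x s hs => ?_)
  · exact (ChainCover.cech (minOpen x)).aug_injective (toAb M)
      (funext fun c => congrFun h c.1)
  · exact funext fun c => congrFun
      ((ChainCover.cech (minOpen x)).d_aug (F := (toAb M).obj) s) ⟨c, trivial⟩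
  · obtain ⟨t, ht⟩ := (ChainCover.cech (minOpen x)).exists_aug_eq (toAb M)
      (fun c => (s : CechSec M 0 (minOpen x)) c.1) (funext fun c => congrFun hs c.1)
    exact ⟨t, funext fun c => congrFun ht ⟨c, trivial⟩⟩
  · obtain ⟨t, ht⟩ := hX.cech_exactAt M x n
      (fun c => (s : CechSec M (n + 1) (minOpen x)) c.1) (funext fun c => congrFun hs c.1)
    exact ⟨(fun c => t ⟨c, trivial⟩ : CechSec M n (minOpen x)),
      funext fun c => congrFun ht ⟨c, trivial⟩⟩

/-- Cohomology vanishes once the standard cochains over `X` are exact; preimages are found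
separately for each chain `c` and assembled. -/
lemma IsSemiSeparated.isAcyclic_cechObj (hX : IsSemiSeparated X) (n : ℕ) :
    IsAcyclic (cechObj M n) := by
  intro i hi
  obtain ⟨k, rfl⟩ := Nat.exists_eq_succ_of_ne_zero hi.ne'
  refine subsingleton_H_of_std_exactAt k _ fun m s hs => ?_
  have h (c : Chain X.carrier n) := hX.cech'_exactAt M c.last m
    (fun z => (s z : CechSec M n (minOpen z.1.last)) c) (funext fun y =>
      (std_top_d_cechObj_apply M n (m + 1) s y c).symm.trans
        (congrFun (show (_ : CechSec M n (minOpen y.1.last)) = _ from congrFun hs y) c))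
  choose t ht using h
  refine ⟨fun z => (fun c => t c z : CechSec M n (minOpen z.1.last)), funext fun y => ?_⟩
  exact funext fun c => (std_top_d_cechObj_apply M n m _ y c).trans (congrFun (ht c) y)

end PseudoCech

end

end FiniteRinged

theorem theorem2p6 (X : RingedSpace.{u, u}) [Finite X.carrier] [T0Space X.carrier]
    (M : FiniteRinged.OMod X) :
    ((∃ n : ℕ, ∀ i : ℕ, n < i → Limits.IsZero ((FiniteRinged.stdComplex M).X i)) ∧
      (∀ i : ℕ, topologicalKrullDim X.carrier < i →
        Limits.IsZero ((FiniteRinged.stdComplex M).X i)) ∧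
      (∀ i : ℕ, FiniteRinged.IsFlasque ((FiniteRinged.stdComplex M).X i)) ∧
      FiniteRinged.IsResolution (K := FiniteRinged.stdComplex M) (FiniteRinged.stdAug M)) ∧
    (FiniteRinged.IsSemiSeparated X → M.IsQuasicoherent →
      FiniteRinged.IsResolution (K := FiniteRinged.cechComplex M) (FiniteRinged.cechAug M) ∧
      ∀ i : ℕ, FiniteRinged.IsAcyclic ((FiniteRinged.cechComplex M).X i) ∧
        ((FiniteRinged.cechComplex M).X i).IsQuasicoherent) := by
  have h (i : ℕ) (hi : IsEmpty (FiniteRinged.Chain X.carrier i)) :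
      Limits.IsZero ((FiniteRinged.stdComplex M).X i) := FiniteRinged.isZero_stdObj M i hi
  refine ⟨⟨⟨Nat.card X.carrier, fun i hi => h i (FiniteRinged.isEmpty_chain_of_card_le hi.le)⟩,
    fun i hi => h i ⟨fun c => hi.not_ge (FiniteRinged.le_topologicalKrullDim c)⟩,
    FiniteRinged.isFlasque_stdObj M, FiniteRinged.isResolution_stdAug M⟩,
    fun hX _ => ⟨hX.isResolution_cechAug M, fun i =>
      ⟨hX.isAcyclic_cechObj M i, hX.isQuasicoherent_cechObj M i⟩⟩⟩
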